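/- Let $n \ge 2$ and $\lambda > 0$. A convex body in $\mathbb{R}^n$ is a compact convex set with non-empty interior. A convex body $K$ is $\lambda$-convex if for every $p \in \partial K$ there are a neighbourhood $U_p$ of $p$ and a closed ball $B_{\lambda,p}$ of radius $1/\lambda$ such that $p \in \partial B_{\lambda,p}$ and $U_p \cap K \subset B_{\lambda,p}$. A $\lambda$-convex spindle is the intersection of all closed balls of radius $1/\lambda$ that contain two given distinct points at distance at most $2/\lambda$. The circumradius $R(K)$ is the radius of the smallest ball containing $K$. The intrinsic volumes $V_0(K), \dots, V_n(K)$ are the coefficients in the Steiner formula $\mathrm{Vol}(K + \varepsilon \boldsymbol{B}) = \sum_{j=0}^n \kappa_{n-j} V_j(K)\, \varepsilon^{n-j}$ for all $\varepsilon > 0$, where $\boldsymbol{B}$ is the closed unit ball of $\mathbb{R}^n$ and $\kappa_m$ is the volume of the unit ball of $\mathbb{R}^m$ (so $V_1$ is the mean width up to a constant factor depending only on $n$). Let $K \subset \mathbb{R}^n$ be a $\lambda$-convex body and let $S \subset \mathbb{R}^n$ be a $\lambda$-convex spindle. If $R(K) = R(S)$, then $$V_1(K) \ge V_1(S),$$ with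 equality if and only if $K$ is a $\lambda$-convex spindle. -/

import Mathlib

open scoped Pointwise Topology

namespace LambdaConvex

/-- Euclidean `n`-space. -/
abbrev E (n : ℕ) : Type := EuclideanSpace ℝ (Fin n)

/-- A convex body: a compact convex set with non-empty interior. -/
def IsConvexBody {n : ℕ} (K : Set (E n)) : Prop :=
  IsCompact K ∧ Convex ℝ K ∧ (interior K).Nonempty

/-- A `lam`-convex body: a convex body such that near each boundary point `p` it lies in some
closed ball of radius `1 / lam` having `p` on its boundary. -/
def IsLambdaConvexBody {n : ℕ} (lam : ℝ) (K : Set (E n)) : Prop :=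
  IsConvexBody K ∧
    ∀ p ∈ frontier K, ∃ U ∈ 𝓝 p, ∃ c : E n,
      p ∈ Metric.sphere c (1 / lam) ∧ U ∩ K ⊆ Metric.closedBall c (1 / lam)

/-- The intersection of all closed balls of radius `1 / lam` that contain both `x` and `y`. -/
def spindle {n : ℕ} (lam : ℝ) (x y : E n) : Set (E n) :=
  ⋂ c ∈ {c : E n | x ∈ Metric.closedBall c (1 / lam) ∧ y ∈ Metric.closedBall c (1 / lam)},
    Metric.closedBall c (1 / lam)

/-- A `lam`-convex spindle: `spindle lam x y` for two distinct points (its vertices) at distance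
at most `2 / lam`. -/
def IsSpindle {n : ℕ} (lam : ℝ) (S : Set (E n)) : Prop :=
  ∃ x y : E n, x ≠ y ∧ dist x y ≤ 2 / lam ∧ S = spindle lam x y

/-- The circumradius: the smallest radius of a closed ball that contains `K`. -/
noncomputable def circumradius {n : ℕ} (K : Set (E n)) : ℝ :=
  sInf {r : ℝ | 0 ≤ r ∧ ∃ c : E n, K ⊆ Metric.closedBall c r}

/-- The volume of the unit ball of Euclidean `k`-space. -/
noncomputable def kappa (k : ℕ) : ℝ :=
  MeasureTheory.volume.real (Metric.closedBall (0 : E k) 1)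

/-- `V 0, …, V n` are the coefficients in the Steiner formula of `K`:
`Vol (K + ε B) = ∑ j, κ_{n-j} V_j ε ^ (n - j)` for all `ε > 0`
(and `V` is extended by zero to indices above `n`, which makes it unique). -/
def IsSteinerCoefficients {n : ℕ} (K : Set (E n)) (V : ℕ → ℝ) : Prop :=
  (∀ ε : ℝ, 0 < ε →
    MeasureTheory.volume.real (K + ε • Metric.closedBall (0 : E n) 1) =
      ∑ j ∈ Finset.range (n + 1), kappa (n - j) * V j * ε ^ (n - j)) ∧
  ∀ j, n < j → V j = 0

open Classical in
/-- The `j`-th intrinsic volume `V_j(K)`: the `j`-th coefficient in the Steiner formula. -/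
noncomputable def intrinsicVolume {n : ℕ} (j : ℕ) (K : Set (E n)) : ℝ :=
  if h : ∃ V : ℕ → ℝ, IsSteinerCoefficients K V then h.choose j else 0

end LambdaConvex

/-! Write `r = 1 / lam` and let `h` be the common circumradius. Up to a positive factor depending
only on `n`, `V₁(K)` is the mean of the support function of `K` over the unit sphere:
`exists_steiner_polynomial` proves Steiner's formula, and `coeff_steiner_polynomial` identifies the
coefficient of degree `n - 1` with the first variation of the volume of the unit ball under addition
of `K`. Means over the sphere are written throughout as integrals over the unit ball of functions of
`‖x‖⁻¹ • x`. It remains to compare support functions in mean.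

Let `o` be the circumcentre of `K`. The body touches its circumsphere at points `o + h • e i`, and
there are positive weights with `∑ i, w i • e i = 0`. By Blaschke's rolling theorem
(`subset_closedBall_of_support`), for each unit `u` some ball of radius `r` contains `K` and has the
same support value at `u`. Its centre `c` satisfies `‖c - o‖² ≤ r² - h²`, because the weights
balance. Hence the support function of `K` relative to `o` is at least `profile r h ⟪u, e i⟫`
whenever `⟪u, e i⟫ ≥ 0` (`IsLambdaConvexBody.profile_le_supportFn`). For a spindle with axis `e`,
the support function relative to its centre is exactly `profile r h |⟪u, e⟫|`.

Divide the sphere into the cells of directions whose nearest `e i` is a given one. A cell lies in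
the hemisphere around its `e i`, since the weights balance, and it is preserved when moving towards
`e i`. So the mean over the cell of an increasing function of `⟪u, e i⟫` is at least the mean over
the hemisphere (`halfBall_mean_le_cone_mean`), which is the spindle's mean by symmetry. Summing over
the cells gives the inequality (`integral_antipodal_le_integral`).

In the case of equality with `h < r`, the support function relative to `o` equals the profile of the
largest `⟪u, e i⟫` for every `u`. If no two `e i` were antipodal, some `u` would have two nearest
ones, and its supporting ball would force them to coincide. If `h = r`, then `K` contains the whole
circumball. Either way there are antipodal contact points, the support function dominates that of
the spindle they span, and equality of the means makes the two bodies equal. -/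

namespace LambdaConvex

/-! ### Support functions of compact sets. -/

section Support

variable {V : Type*} [NormedAddCommGroup V] [InnerProductSpace ℝ V]

/-- The support function of a set. -/
noncomputable def supportFn (A : Set V) (u : V) : ℝ :=
  sSup ((fun x => inner ℝ u x) '' A)

theorem inner_le_supportFn {A : Set V} (hA : IsCompact A) {x : V} (hx : x ∈ A) (u : V) :
    inner ℝ u x ≤ supportFn A u :=
  le_csSup (hA.image (by fun_prop)).bddAbove (Set.mem_image_of_mem _ hx)

theorem exists_inner_eq_supportFn {A : Set V} (hA : IsCompact A) (hne : A.Nonempty) (u : V) :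
    ∃ x ∈ A, inner ℝ u x = supportFn A u :=
  (hA.image (f := fun x => inner ℝ u x) (by fun_prop)).sSup_mem (hne.image _)

theorem supportFn_le {A : Set V} (hne : A.Nonempty) {u : V} {c : ℝ}
    (h : ∀ x ∈ A, inner ℝ u x ≤ c) : supportFn A u ≤ c :=
  csSup_le (hne.image _) (by rintro _ ⟨x, hx, rfl⟩; exact h x hx)

theorem supportFn_add {A B : Set V} (hA : IsCompact A) (hA' : A.Nonempty)
    (hB : IsCompact B) (hB' : B.Nonempty) (u : V) :
    supportFn (A + B) u = supportFn A u + supportFn B u := by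
  apply le_antisymm
  · refine supportFn_le (hA'.add hB') ?_
    rintro _ ⟨a, ha, b, hb, rfl⟩
    simp only [inner_add_right]
    exact add_le_add (inner_le_supportFn hA ha u) (inner_le_supportFn hB hb u)
  · obtain ⟨a, ha, h1⟩ := exists_inner_eq_supportFn hA hA' u
    obtain ⟨b, hb, h2⟩ := exists_inner_eq_supportFn hB hB' u
    rw [← h1, ← h2, ← inner_add_right]
    exact inner_le_supportFn (hA.add hB) (Set.add_mem_add ha hb) u

theorem supportFn_smul_right {A : Set V} (hA : IsCompact A) (hA' : A.Nonempty) {c : ℝ}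
    (hc : 0 ≤ c) (u : V) : supportFn A (c • u) = c * supportFn A u := by
  apply le_antisymm
  · refine supportFn_le hA' fun x hx => ?_
    rw [real_inner_smul_left]
    exact mul_le_mul_of_nonneg_left (inner_le_supportFn hA hx u) hc
  · obtain ⟨a, ha, h1⟩ := exists_inner_eq_supportFn hA hA' u
    rw [← h1, ← real_inner_smul_left]
    exact inner_le_supportFn hA ha _

theorem supportFn_smul_set {A : Set V} (hA : IsCompact A) (hA' : A.Nonempty) {c : ℝ}
    (hc : 0 ≤ c) (u : V) : supportFn (c • A) u = c * supportFn A u := by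
  apply le_antisymm
  · refine supportFn_le hA'.smul_set ?_
    rintro _ ⟨x, hx, rfl⟩
    simp only [real_inner_smul_right]
    exact mul_le_mul_of_nonneg_left (inner_le_supportFn hA hx u) hc
  · obtain ⟨a, ha, h1⟩ := exists_inner_eq_supportFn hA hA' u
    rw [← h1, ← real_inner_smul_right]
    exact inner_le_supportFn (hA.smul c) (Set.smul_mem_smul_set ha) _

theorem continuous_supportFn {A : Set V} (hA : IsCompact A) : Continuous (supportFn A) := by
  unfold supportFn
  exact hA.continuous_sSup (f := fun u x => inner ℝ u x) (by fun_prop)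

theorem subset_of_supportFn_le {A B : Set V} [CompleteSpace V] (hA : IsCompact A)
    (hB : IsCompact B) (hB' : B.Nonempty) (hBc : Convex ℝ B)
    (h : ∀ u : V, ‖u‖ = 1 → supportFn A u ≤ supportFn B u) : A ⊆ B := by
  intro x hx
  by_contra hxB
  obtain ⟨f, c, hf1, hf2⟩ := geometric_hahn_banach_closed_point hBc hB.isClosed hxB
  set v := (InnerProductSpace.toDual ℝ V).symm f with hv
  have hfv : ∀ y, f y = inner ℝ v y := fun y => by
    rw [hv, InnerProductSpace.toDual_symm_apply]
  obtain ⟨b, hb⟩ := hB'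
  have hv0 : v ≠ 0 := by
    intro h0
    have h1 := hf1 b hb
    rw [hfv, h0, inner_zero_left] at h1
    rw [hfv, h0, inner_zero_left] at hf2
    linarith
  have hn : 0 < ‖v‖ := norm_pos_iff.2 hv0
  have h1 := h (‖v‖⁻¹ • v) (by rw [norm_smul, norm_inv, norm_norm, inv_mul_cancel₀ hn.ne'])
  have hinv : 0 ≤ ‖v‖⁻¹ := inv_nonneg.2 hn.le
  rw [supportFn_smul_right hA ⟨x, hx⟩ hinv, supportFn_smul_right hB ⟨b, hb⟩ hinv] at h1
  have h2 : supportFn A v ≤ supportFn B v := le_of_mul_le_mul_left h1 (inv_pos.2 hn)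
  have h3 := inner_le_supportFn hA hx v
  have h4 : supportFn B v ≤ c := supportFn_le ⟨b, hb⟩ fun y hy => by
    rw [← hfv]; exact (hf1 y hy).le
  rw [hfv] at hf2
  linarith

theorem supportFn_closedBall {r : ℝ} (hr : 0 ≤ r) (u : V) :
    supportFn (Metric.closedBall (0 : V) r) u = r * ‖u‖ := by
  have hub : ∀ x ∈ Metric.closedBall (0 : V) r, inner ℝ u x ≤ r * ‖u‖ := fun x hx => by
    rw [mem_closedBall_zero_iff] at hx
    nlinarith [real_inner_le_norm u x, norm_nonneg u]
  apply le_antisymm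
  · exact supportFn_le ⟨0, by simpa using hr⟩ hub
  · rcases eq_or_ne u 0 with rfl | hu
    · have : (fun x : V => inner ℝ (0 : V) x) '' Metric.closedBall (0 : V) r = {0} := by
        simp only [inner_zero_left]
        exact Set.Nonempty.image_const ⟨0, by simpa using hr⟩ 0
      rw [supportFn, this]; simp
    · refine le_csSup ⟨r * ‖u‖, ?_⟩ ⟨(r / ‖u‖) • u, ?_, ?_⟩
      · rintro _ ⟨x, hx, rfl⟩; exact hub x hx
      · have : 0 < ‖u‖ := norm_pos_iff.2 hu
        rw [mem_closedBall_zero_iff, norm_smul, norm_div, norm_norm, Real.norm_eq_abs,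
          abs_of_nonneg hr, div_mul_cancel₀ _ this.ne']
      · have : 0 < ‖u‖ := norm_pos_iff.2 hu
        simp only [real_inner_smul_right, real_inner_self_eq_norm_sq]
        field_simp

theorem supportFn_segment_neg (v u : V) :
    supportFn (segment ℝ (-v) v) u = |inner ℝ u v| := by
  have hc : IsCompact (segment ℝ (-v) v) := by
    rw [← convexHull_pair (𝕜 := ℝ)]; exact (Set.toFinite _).isCompact_convexHull ℝ
  apply le_antisymm
  · refine supportFn_le ⟨v, right_mem_segment ℝ _ _⟩ ?_
    rintro _ ⟨a, b, ha, hb, hab, rfl⟩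
    rw [inner_add_right, real_inner_smul_right, real_inner_smul_right, inner_neg_right]
    have h1 := neg_abs_le (inner ℝ u v)
    have h2 := le_abs_self (inner ℝ u v)
    nlinarith
  · refine abs_le'.2 ⟨inner_le_supportFn hc (right_mem_segment ℝ _ _) u, ?_⟩
    rw [← inner_neg_right]
    exact inner_le_supportFn hc (left_mem_segment ℝ _ _) u

end Support

/-! ### Volume of the Minkowski sum of a convex set and a segment. -/

section Segments

variable {V : Type*} [NormedAddCommGroup V] [NormedSpace ℝ V]

theorem isCompact_segment' (x y : V) : IsCompact (segment ℝ x y) := by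
  rw [← convexHull_pair (𝕜 := ℝ)]; exact (Set.toFinite _).isCompact_convexHull ℝ

theorem mem_add_segment {A : Set V} {w x : V} {t : ℝ} (ht : 0 ≤ t) :
    x ∈ A + segment ℝ 0 (t • w) ↔ ∃ a ∈ A, ∃ p, 0 ≤ p ∧ p ≤ t ∧ x = a + p • w := by
  rw [segment_eq_image']
  constructor
  · rintro ⟨a, ha, _, ⟨θ, ⟨h0, h1⟩, rfl⟩, rfl⟩
    refine ⟨a, ha, θ * t, by positivity, mul_le_of_le_one_left ht h1, ?_⟩
    simp [mul_smul]
  · rintro ⟨a, ha, p, hp0, hpt, rfl⟩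
    refine Set.add_mem_add ha ?_
    rcases ht.eq_or_lt with rfl | ht'
    · obtain rfl : p = 0 := le_antisymm hpt hp0
      exact ⟨0, by simp, by simp⟩
    · refine ⟨p / t, ⟨by positivity, (div_le_one ht').2 hpt⟩, ?_⟩
      simp only [sub_zero, zero_add, smul_smul, div_mul_cancel₀ _ ht'.ne']

/-- Together with `add_segment_inter` this feeds inclusion–exclusion: the volume added by the
segment `[0, t • w]` is additive in `t`. -/
theorem add_segment_union (A : Set V) (w : V) {s t : ℝ} (hs : 0 ≤ s) (ht : 0 ≤ t) :
    (A + segment ℝ 0 (s • w)) ∪ (s • w +ᵥ (A + segment ℝ 0 (t • w))) =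
      A + segment ℝ 0 ((s + t) • w) := by
  ext x
  simp only [Set.mem_union, Set.mem_vadd_set, vadd_eq_add]
  rw [mem_add_segment hs, mem_add_segment (add_nonneg hs ht)]
  constructor
  · rintro (⟨a, ha, p, h0, h1, rfl⟩ | ⟨y, hy, rfl⟩)
    · exact ⟨a, ha, p, h0, by linarith, rfl⟩
    · obtain ⟨a, ha, p, h0, h1, rfl⟩ := (mem_add_segment ht).1 hy
      exact ⟨a, ha, s + p, by linarith, by linarith, by module⟩
  · rintro ⟨a, ha, p, h0, h1, rfl⟩
    rcases le_total p s with h | h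
    · exact Or.inl ⟨a, ha, p, h0, h, rfl⟩
    · exact Or.inr ⟨a + (p - s) • w, (mem_add_segment ht).2
        ⟨a, ha, p - s, by linarith, by linarith, rfl⟩, by module⟩

/-- If `x = a + p • w = s • w + a' + q • w` with `p ≤ s` and `0 ≤ q`, then `x - s • w` lies between
`a` and `a'` on a line of direction `w`, so it belongs to the convex set `A`. -/
theorem add_segment_inter {A : Set V} (hA : Convex ℝ A) (w : V) {s t : ℝ} (hs : 0 ≤ s)
    (ht : 0 ≤ t) :
    (A + segment ℝ 0 (s • w)) ∩ (s • w +ᵥ (A + segment ℝ 0 (t • w))) = s • w +ᵥ A := by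
  ext x
  simp only [Set.mem_inter_iff, Set.mem_vadd_set, vadd_eq_add]
  rw [mem_add_segment hs]
  constructor
  · rintro ⟨⟨a, ha, p, h0, h1, rfl⟩, ⟨y, hy, hyx⟩⟩
    obtain ⟨a', ha', q, hq0, hq1, rfl⟩ := (mem_add_segment ht).1 hy
    refine ⟨a + (p - s) • w, ?_, by module⟩
    rcases eq_or_lt_of_le (by linarith : 0 ≤ (s - p) + q) with h | h
    · have : p - s = 0 := by linarith
      simpa [this] using ha
    · have haa : a = a' + ((s - p) + q) • w := by
        have : a = s • w + (a' + q • w) - p • w := by rw [hyx]; abel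
        rw [this]; module
      have := hA ha ha' (a := q / ((s - p) + q)) (b := (s - p) / ((s - p) + q))
        (by positivity) (div_nonneg (by linarith) h.le) (by field_simp; ring)
      convert this using 1
      rw [haa]
      have e1 : q / ((s - p) + q) + (s - p) / ((s - p) + q) = 1 := by field_simp; ring
      have e2 : q / ((s - p) + q) * ((s - p) + q) = q := by field_simp
      have e3 : (s - p) / ((s - p) + q) = 1 - q / ((s - p) + q) := by linarith
      rw [e3, smul_add, smul_smul, e2]
      module
  · rintro ⟨a, ha, rfl⟩
    exact ⟨⟨a, ha, s, hs, le_rfl, by abel⟩, a, (mem_add_segment ht).2 ⟨a, ha, 0, le_rfl, ht, by simp⟩, rfl⟩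

end Segments

/-- A monotone function on `[0, ∞)` that satisfies Cauchy's functional equation is linear. -/
theorem linear_of_monotone_additive {g : ℝ → ℝ} (hm : ∀ s t, 0 ≤ s → s ≤ t → g s ≤ g t)
    (ha : ∀ s t, 0 ≤ s → 0 ≤ t → g (s + t) = g s + g t) {t : ℝ} (ht : 0 ≤ t) :
    g t = t * g 1 := by
  have h0 : g 0 = 0 := by have := ha 0 0 le_rfl le_rfl; simp at this; exact this
  have hn : ∀ (n : ℕ) (s : ℝ), 0 ≤ s → g (n * s) = n * g s := by
    intro n s hs
    induction n with
    | zero => simp [h0]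
    | succ k ih =>
      push_cast
      rw [add_mul, one_mul, ha _ _ (by positivity) hs, ih]; ring
  have h1 : 0 ≤ g 1 := h0 ▸ hm 0 1 le_rfl zero_le_one
  -- `n * t` lies between the integers `m` and `m + 1`, where `g` is already known. Monotonicity and
  -- division by `n` leave an error of at most `g 1 / n`.
  have key : ∀ n : ℕ, 0 < n → |g t - t * g 1| ≤ g 1 / n := by
    intro n hnpos
    have hn' : (0 : ℝ) < n := by exact_mod_cast hnpos
    have e1 := Nat.floor_le (by positivity : 0 ≤ (n : ℝ) * t)
    have e2 := (Nat.lt_floor_add_one ((n : ℝ) * t)).le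
    set m := ⌊(n : ℝ) * t⌋₊
    have f1 := hm _ _ (by positivity) e1
    have f2 := hm _ _ (by positivity) e2
    have g1 := hn m 1 zero_le_one
    have g2 := hn (m + 1) 1 zero_le_one
    push_cast at g2
    rw [mul_one] at g1 g2
    rw [g1, hn n t ht] at f1
    rw [g2, hn n t ht] at f2
    rw [abs_le, ← neg_div, div_le_iff₀ hn', le_div_iff₀ hn']
    constructor <;> nlinarith
  have hlim : Filter.Tendsto (fun n : ℕ => g 1 / (n : ℝ)) Filter.atTop (𝓝 0) :=
    tendsto_const_div_atTop_nhds_zero_nat _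
  have := ge_of_tendsto hlim (Filter.eventually_atTop.2 ⟨1, fun n hn => key n hn⟩)
  have h2 := abs_nonpos_iff.1 this
  linarith

section Volume

open MeasureTheory

variable {V : Type*} [NormedAddCommGroup V] [NormedSpace ℝ V] [FiniteDimensional ℝ V]
  [MeasurableSpace V] [BorelSpace V] (μ : Measure V) [μ.IsAddHaarMeasure]

omit [NormedSpace ℝ V] [FiniteDimensional ℝ V] [BorelSpace V] in
theorem measureReal_mono_of_isCompact {A B : Set V} (hB : IsCompact B) (h : A ⊆ B) :
    μ.real A ≤ μ.real B :=
  measureReal_mono h hB.measure_lt_top.ne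

/-- The increment over `μ.real A` is monotone in `t`, and additive by inclusion–exclusion, hence
linear. -/
theorem measureReal_add_segment {A : Set V} (hA : IsCompact A) (hAc : Convex ℝ A)
    (w : V) {t : ℝ} (ht : 0 ≤ t) :
    μ.real (A + segment ℝ 0 (t • w)) =
      μ.real A + t * (μ.real (A + segment ℝ 0 w) - μ.real A) := by
  have hcpt : ∀ s : ℝ, IsCompact (A + segment ℝ 0 (s • w)) := fun s =>
    hA.add (isCompact_segment' _ _)
  have hadd : ∀ s t : ℝ, 0 ≤ s → 0 ≤ t → μ.real (A + segment ℝ 0 ((s + t) • w)) + μ.real A =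
      μ.real (A + segment ℝ 0 (s • w)) + μ.real (A + segment ℝ 0 (t • w)) := by
    intro s t hs ht
    have hv : ∀ (B : Set V) (x : V), μ.real (x +ᵥ B) = μ.real B := fun B x => by
      simp [measureReal_def, measure_vadd]
    have h := measureReal_union_add_inter (μ := μ) (s := A + segment ℝ 0 (s • w))
      (t := s • w +ᵥ (A + segment ℝ 0 (t • w))) ((hcpt t).vadd _).measurableSet
      (hcpt s).measure_lt_top.ne ((hcpt t).vadd (s • w)).measure_lt_top.ne
    rwa [add_segment_union A w hs ht, add_segment_inter hAc w hs ht, hv, hv] at h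
  have := linear_of_monotone_additive
    (g := fun t => μ.real (A + segment ℝ 0 (t • w)) - μ.real A) ?_ ?_ ht
  · simp only [one_smul] at this
    linarith
  · intro s t hs hst
    have : μ.real (A + segment ℝ 0 (s • w)) ≤ μ.real (A + segment ℝ 0 (t • w)) := by
      apply measureReal_mono_of_isCompact μ (hcpt t)
      intro x hx
      obtain ⟨a, ha, p, h0, h1, rfl⟩ := (mem_add_segment hs).1 hx
      exact (mem_add_segment (hs.trans hst)).2 ⟨a, ha, p, h0, h1.trans hst, rfl⟩
    linarith
  · intro s t hs ht
    have := hadd s t hs ht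
    linarith

theorem measureReal_add_smul_segment {A : Set V} (hA : IsCompact A) (hAc : Convex ℝ A)
    (v : V) {t : ℝ} (ht : 0 ≤ t) :
    μ.real (A + t • segment ℝ (-v) v) =
      μ.real A + t * (μ.real (A + segment ℝ (-v) v) - μ.real A) := by
  have hseg : ∀ s : ℝ, s • segment ℝ (-v) v = (-(s • v)) +ᵥ segment ℝ 0 (s • ((2 : ℝ) • v)) := by
    intro s
    ext x
    simp only [segment_eq_image', Set.mem_smul_set, Set.mem_vadd_set, Set.mem_image,
      exists_exists_and_eq_and, vadd_eq_add]
    refine exists_congr fun θ => and_congr_right fun _ => ?_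
    have : s • (-v + θ • (v - -v)) = -(s • v) + (0 + θ • (s • (2 : ℝ) • v - 0)) := by module
    rw [this]
  have hv : ∀ s : ℝ, μ.real (A + s • segment ℝ (-v) v) =
      μ.real (A + segment ℝ 0 (s • ((2 : ℝ) • v))) := by
    intro s
    have : A + (-(s • v) +ᵥ segment ℝ 0 (s • ((2 : ℝ) • v))) =
        -(s • v) +ᵥ (A + segment ℝ 0 (s • ((2 : ℝ) • v))) := by
      rw [← Set.singleton_vadd, ← Set.singleton_vadd, vadd_eq_add, vadd_eq_add, add_left_comm]
    rw [hseg, this]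
    simp [measureReal_def, measure_vadd]
  have h1 := hv 1
  rw [one_smul, one_smul] at h1
  rw [hv, h1]
  exact measureReal_add_segment μ hA hAc _ ht

end Volume

/-! ### Zonotopes and polynomial volume growth. -/

/-- Finite Minkowski sums of segments centred at the origin. -/
inductive IsZonotope {V : Type*} [AddCommGroup V] [Module ℝ V] : Set V → Prop
  | zero : IsZonotope {0}
  | add_segment {Z : Set V} (v : V) (hZ : IsZonotope Z) : IsZonotope (Z + segment ℝ (-v) v)

namespace IsZonotope

variable {V : Type*} [NormedAddCommGroup V] [NormedSpace ℝ V]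

theorem isCompact {Z : Set V} (hZ : IsZonotope Z) : IsCompact Z := by
  induction hZ with
  | zero => exact isCompact_singleton
  | add_segment v _ ih => exact ih.add (isCompact_segment' _ _)

theorem convex {Z : Set V} (hZ : IsZonotope Z) : Convex ℝ Z := by
  induction hZ with
  | zero => exact convex_singleton _
  | add_segment v _ ih => exact ih.add (convex_segment _ _)

theorem nonempty {Z : Set V} (hZ : IsZonotope Z) : Z.Nonempty := by
  induction hZ with
  | zero => exact Set.singleton_nonempty _
  | add_segment v _ ih => exact ih.add ⟨v, right_mem_segment ℝ _ _⟩

theorem add {Z Z' : Set V} (hZ : IsZonotope Z) (hZ' : IsZonotope Z') : IsZonotope (Z + Z') := by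
  induction hZ' with
  | zero => simpa using hZ
  | add_segment v _ ih => rw [← add_assoc]; exact ih.add_segment v

theorem smul {Z : Set V} (hZ : IsZonotope Z) (c : ℝ) : IsZonotope (c • Z) := by
  induction hZ with
  | zero => simpa using IsZonotope.zero
  | add_segment v _ ih =>
    rw [smul_add]
    have : c • segment ℝ (-v) v = segment ℝ (-(c • v)) (c • v) := by
      have := image_segment ℝ (LinearMap.lsmul ℝ V c).toAffineMap (-v) v
      rw [← Set.image_smul, ← smul_neg]
      exact this
    rw [this]
    exact ih.add_segment _

-- Induction on the number of segments, for all `A` at once. A new segment `S` contributes `t * (μ(A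
-- + S + t • Z) - μ(A + t • Z))`, and the induction hypothesis applies to both `A` and `A + S`.
open MeasureTheory in
theorem exists_polynomial [FiniteDimensional ℝ V] [MeasurableSpace V] [BorelSpace V]
    (μ : Measure V) [μ.IsAddHaarMeasure] {Z : Set V} (hZ : IsZonotope Z) :
    ∀ {A : Set V}, IsCompact A → Convex ℝ A →
      ∃ p : Polynomial ℝ, ∀ t : ℝ, 0 ≤ t → μ.real (A + t • Z) = p.eval t := by
  induction hZ with
  | zero => exact fun {A} _ _ => ⟨Polynomial.C (μ.real A), fun t _ => by simp⟩
  | @add_segment Z v hZ ih =>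
    intro A hA hAc
    obtain ⟨p, hp⟩ := ih hA hAc
    obtain ⟨q, hq⟩ := ih (hA.add (isCompact_segment' (-v) v)) (hAc.add (convex_segment (-v) v))
    refine ⟨p + Polynomial.X * (q - p), fun t ht => ?_⟩
    rw [smul_add, ← add_assoc, measureReal_add_smul_segment μ (hA.add (hZ.isCompact.smul t))
      (hAc.add (hZ.convex.smul t)) v ht, hp t ht, add_right_comm, hq t ht]
    simp

end IsZonotope

theorem natDegree_le_of_abs_eval_le {p : Polynomial ℝ} {n : ℕ} {C : ℝ}
    (h : ∀ t : ℝ, 0 ≤ t → |p.eval t| ≤ C * (1 + t) ^ n) : p.natDegree ≤ n := by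
  by_contra! hlt
  have hq : ((Polynomial.X + 1 : Polynomial ℝ) ^ n).degree = n := by
    rw [Polynomial.degree_pow, ← Polynomial.C_1, Polynomial.degree_X_add_C]; simp
  have hdeg : ((Polynomial.X + 1 : Polynomial ℝ) ^ n).degree < p.degree := by
    rw [hq]; exact Polynomial.degree_lt_degree (p := Polynomial.X ^ n) (by simpa using hlt) |>.trans_eq' (by simp)
  have ht := Polynomial.abs_div_tendsto_atTop_atTop_of_degree_gt p _ hdeg
    (pow_ne_zero _ (Polynomial.X_add_C_ne_zero 1))
  obtain ⟨t, h1, h2⟩ := ((ht.eventually_gt_atTop C).and (Filter.eventually_ge_atTop 0)).exists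
  have hpos : (0 : ℝ) < (1 + t) ^ n := by positivity
  have := h t h2
  rw [abs_div] at h1
  simp only [Polynomial.eval_pow, Polynomial.eval_add, Polynomial.eval_X,
    Polynomial.eval_one] at h1
  rw [add_comm t 1, abs_of_pos hpos, lt_div_iff₀ hpos] at h1
  linarith

/-- A polynomial of degree at most `n` is a fixed linear combination of its values at `0, …, n`.
Convergence at these nodes therefore carries the interpolation formula over to the limit. -/
theorem exists_polynomial_of_tendsto {n : ℕ} {p : ℕ → Polynomial ℝ} {f : ℝ → ℝ}
    (hp : ∀ k, (p k).natDegree ≤ n)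
    (h : ∀ t : ℝ, 0 ≤ t → Filter.Tendsto (fun k => (p k).eval t) Filter.atTop (𝓝 (f t))) :
    ∃ q : Polynomial ℝ, q.natDegree ≤ n ∧ ∀ t : ℝ, 0 ≤ t → f t = q.eval t := by
  have hinj : Set.InjOn (fun i : ℕ => (i : ℝ)) (Finset.range (n + 1)) :=
    Nat.cast_injective.injOn
  refine ⟨Lagrange.interpolate (Finset.range (n + 1)) (fun i : ℕ => (i : ℝ)) fun i => f i, ?_, ?_⟩
  · have := Lagrange.degree_interpolate_lt (s := Finset.range (n + 1))
      (v := fun i : ℕ => (i : ℝ)) (fun i => f i) hinj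
    rw [Finset.card_range] at this
    exact Polynomial.natDegree_le_iff_coeff_eq_zero.2 fun N hN =>
      Polynomial.coeff_eq_zero_of_degree_lt (this.trans_le (by exact_mod_cast hN))
  · intro t ht
    have hk : ∀ k, p k = Lagrange.interpolate (Finset.range (n + 1)) (fun i : ℕ => (i : ℝ))
        fun i => (p k).eval (i : ℝ) := fun k => by
      refine Lagrange.eq_interpolate hinj ?_
      rw [Finset.card_range]
      exact lt_of_le_of_lt Polynomial.degree_le_natDegree (by exact_mod_cast Nat.lt_succ_of_le (hp k))
    refine tendsto_nhds_unique (h t ht) ?_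
    have : (fun k => (p k).eval t) = fun k => ∑ i ∈ Finset.range (n + 1), (p k).eval (i : ℝ) *
        (Lagrange.basis (Finset.range (n + 1)) (fun i : ℕ => (i : ℝ)) i).eval t := by
      funext k
      conv_lhs => rw [hk k]
      simp [Lagrange.interpolate_apply, Polynomial.eval_finsetSum]
    rw [this]
    simp only [Lagrange.interpolate_apply, Polynomial.eval_finsetSum, Polynomial.eval_mul,
      Polynomial.eval_C]
    exact tendsto_finsetSum _ fun i _ => (h i (Nat.cast_nonneg i)).mul_const _

/-! ### Approximation of the ball by zonotopes, and Steiner's formula. -/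

section Ball

open MeasureTheory

variable {V : Type*} [NormedAddCommGroup V] [InnerProductSpace ℝ V] [FiniteDimensional ℝ V]
  [MeasurableSpace V] [BorelSpace V]

omit [FiniteDimensional ℝ V] [MeasurableSpace V] [BorelSpace V] in
theorem exists_linearIsometryEquiv_map_eq {x y : V} (h : ‖x‖ = ‖y‖) :
    ∃ f : V ≃ₗᵢ[ℝ] V, f x = y :=
  ⟨_, Submodule.reflection_sub h⟩

theorem setIntegral_comp_isometry (f : V ≃ₗᵢ[ℝ] V) {S : Set V} (hS : f ⁻¹' S = S)
    (F : V → ℝ) : ∫ x in S, F (f x) = ∫ x in S, F x := by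
  have h := (f.measurePreserving.restrict_preimage_emb f.toMeasurableEquiv.measurableEmbedding
    S).integral_comp f.toMeasurableEquiv.measurableEmbedding F
  rw [hS] at h
  exact h

theorem integral_abs_inner_closedBall_pos {x : V} (hx : x ≠ 0) :
    0 < ∫ u in Metric.closedBall (0 : V) 1, |inner ℝ x u| := by
  have hc : Continuous fun u : V => |inner ℝ x u| := by fun_prop
  have hi : IntegrableOn (fun u : V => |inner ℝ x u|) (Metric.closedBall (0 : V) 1) :=
    hc.continuousOn.integrableOn_compact (isCompact_closedBall _ _)
  refine lt_of_le_of_ne (integral_nonneg fun _ => abs_nonneg _) fun h0 => ?_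
  have h1 := (integral_eq_zero_iff_of_nonneg (fun _ => abs_nonneg _) hi).1 h0.symm
  have h2 := Measure.eqOn_open_of_ae_eq (U := Metric.ball (0 : V) 1)
    (ae_restrict_of_ae_restrict_of_subset Metric.ball_subset_closedBall h1) Metric.isOpen_ball
    hc.continuousOn continuous_const.continuousOn
  have hn : 0 < ‖x‖ := norm_pos_iff.2 hx
  have h3 := h2 (x := (2 * ‖x‖)⁻¹ • x) (by
    rw [mem_ball_zero_iff, norm_smul, norm_inv, norm_mul, norm_norm, Real.norm_ofNat]
    field_simp; norm_num)
  simp only [Pi.zero_apply, abs_eq_zero, real_inner_smul_right, real_inner_self_eq_norm_sq] at h3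
  have : (2 * ‖x‖)⁻¹ * ‖x‖ ^ 2 ≠ 0 := by positivity
  exact this h3

/-- The Euclidean ball is a limit of zonotopes. -/
theorem exists_isZonotope_closedBall [Nontrivial V] {δ : ℝ} (hδ : 0 < δ) :
    ∃ Z : Set V, IsZonotope Z ∧ Metric.closedBall 0 1 ⊆ Z ∧ Z ⊆ Metric.closedBall 0 (1 + δ) := by
  let F : V → C(Metric.sphere (0 : V) 1, ℝ) := fun u => ⟨fun x => |inner ℝ x.1 u|, by fun_prop⟩
  have hF : Continuous F := by
    refine ContinuousMap.continuous_of_continuous_uncurry _ ?_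
    change Continuous fun p : V × Metric.sphere (0 : V) 1 => |inner ℝ p.2.1 p.1|
    fun_prop
  -- The support functions of zonotopes form a convex set containing each `F u`, the support
  -- function of `[-u, u]`. The average of `F` over the unit ball lies in its closure, and by
  -- rotation invariance this average is a constant `c > 0`, the support function of a ball.
  let s : Set C(Metric.sphere (0 : V) 1, ℝ) :=
    {f | ∃ Z : Set V, IsZonotope Z ∧ ∀ x : Metric.sphere (0 : V) 1, f x = supportFn Z x.1}
  have hs : Convex ℝ s := by
    rintro f ⟨Z, hZ, hf⟩ g ⟨Z', hZ', hg⟩ a b ha hb -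
    refine ⟨a • Z + b • Z', (hZ.smul a).add (hZ'.smul b), fun x => ?_⟩
    rw [supportFn_add (hZ.isCompact.smul a) hZ.nonempty.smul_set (hZ'.isCompact.smul b)
      hZ'.nonempty.smul_set, supportFn_smul_set hZ.isCompact hZ.nonempty ha,
      supportFn_smul_set hZ'.isCompact hZ'.nonempty hb, ← hf, ← hg]
    rfl
  have hFs : ∀ u, F u ∈ s := fun u =>
    ⟨{0} + segment ℝ (-u) u, IsZonotope.zero.add_segment u, fun x => by
      rw [Set.singleton_zero, zero_add, supportFn_segment_neg]; rfl⟩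
  have hi : IntegrableOn F (Metric.closedBall (0 : V) 1) :=
    hF.continuousOn.integrableOn_compact (isCompact_closedBall _ _)
  have hvol : (volume (Metric.closedBall (0 : V) 1)) ≠ 0 :=
    (Metric.measure_closedBall_pos _ _ one_pos).ne'
  have hvol' : (volume (Metric.closedBall (0 : V) 1)) ≠ ⊤ := measure_closedBall_lt_top.ne
  have hmem := hs.set_average_mem_closure hvol hvol' (Filter.Eventually.of_forall hFs) hi
  rw [setAverage_eq] at hmem
  obtain ⟨x₀, hx₀⟩ : ∃ x : V, ‖x‖ = 1 := exists_norm_eq V zero_le_one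
  set c := (volume.real (Metric.closedBall (0 : V) 1))⁻¹ *
    ∫ u in Metric.closedBall (0 : V) 1, |inner ℝ x₀ u| with hcdef
  have hcpos : 0 < c := by
    refine mul_pos (inv_pos.2 (ENNReal.toReal_pos hvol hvol'))
      (integral_abs_inner_closedBall_pos fun h => ?_)
    rw [h, norm_zero] at hx₀; exact zero_ne_one hx₀
  have hval : ∀ x : Metric.sphere (0 : V) 1,
      ((volume.real (Metric.closedBall (0 : V) 1))⁻¹ •
        ∫ u in Metric.closedBall (0 : V) 1, F u) x = c := by
    intro x
    rw [ContinuousMap.smul_apply, ContinuousMap.integral_apply hi, smul_eq_mul, hcdef]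
    congr 1
    obtain ⟨f, hf⟩ := exists_linearIsometryEquiv_map_eq (x := x₀) (y := x.1) (by simp [hx₀])
    rw [← setIntegral_comp_isometry f (S := Metric.closedBall (0 : V) 1) (by ext; simp)]
    simp only [F, ContinuousMap.coe_mk]
    congr 1
    ext u
    rw [← hf, LinearIsometryEquiv.inner_map_map]
  -- Chosen so that `(1 + η) / (1 - η) = 1 + δ`: after division by `c * (1 - η)`, a support function
  -- within `c * η` of `c` lies between `1` and `1 + δ`.
  set η := δ / (2 + δ) with hη
  have hη0 : 0 < η := by positivity
  have hη1 : η < 1 := by rw [hη, div_lt_one (by positivity)]; linarith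
  obtain ⟨f, ⟨Z, hZ, hfZ⟩, hd⟩ := Metric.mem_closure_iff.1 hmem (c * η) (by positivity)
  have hclose : ∀ x : V, ‖x‖ = 1 → |c - supportFn Z x| ≤ c * η := by
    intro x hx
    have h1 := ContinuousMap.dist_apply_le_dist (f := (volume.real (Metric.closedBall (0 : V) 1))⁻¹ •
        ∫ u in Metric.closedBall (0 : V) 1, F u) (g := f) ⟨x, by simpa using hx⟩
    rw [hval, hfZ, Real.dist_eq] at h1
    exact h1.trans hd.le
  have hk : 0 ≤ (c * (1 - η))⁻¹ := inv_nonneg.2 (mul_nonneg hcpos.le (by linarith))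
  have hk' : 0 < c * (1 - η) := mul_pos hcpos (by linarith)
  have hZ' := hZ.smul (c * (1 - η))⁻¹
  refine ⟨(c * (1 - η))⁻¹ • Z, hZ', ?_, ?_⟩
  · refine subset_of_supportFn_le (isCompact_closedBall _ _) hZ'.isCompact hZ'.nonempty
      hZ'.convex fun u hu => ?_
    rw [supportFn_closedBall zero_le_one, hu, supportFn_smul_set hZ.isCompact hZ.nonempty hk,
      one_mul, inv_mul_eq_div, le_div_iff₀ hk']
    have := abs_le.1 (hclose u hu)
    linarith [this.2]
  · refine subset_of_supportFn_le hZ'.isCompact (isCompact_closedBall _ _)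
      (Metric.nonempty_closedBall.2 (by positivity)) (convex_closedBall _ _) fun u hu => ?_
    rw [supportFn_closedBall (by positivity), hu,
      supportFn_smul_set hZ.isCompact hZ.nonempty hk, mul_one, inv_mul_eq_div, div_le_iff₀ hk']
    have := abs_le.1 (hclose u hu)
    have he : (1 + δ) * (1 - η) = 1 + η := by rw [hη]; field_simp; ring
    nlinarith [this.1]

variable (μ : Measure V) [μ.IsAddHaarMeasure]

theorem measureReal_smul (c : ℝ) (hc : 0 ≤ c) (A : Set V) :
    μ.real (c • A) = c ^ Module.finrank ℝ V * μ.real A := by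
  rw [measureReal_def, Measure.addHaar_smul, ENNReal.toReal_mul, ENNReal.toReal_ofReal (abs_nonneg _),
    abs_of_nonneg (by positivity), measureReal_def]

/-- Convexity gives `A + δ • a₀ ⊆ (1 + δ) • A`, so a translate of the left-hand body lies in `(1 +
δ) • (A + t • B)`. -/
theorem measureReal_add_smul_le {A B : Set V} (hA : IsCompact A) (hAc : Convex ℝ A)
    (hne : A.Nonempty) (hB : IsCompact B) {δ t : ℝ} (hδ : 0 ≤ δ) :
    μ.real (A + (t * (1 + δ)) • B) ≤ (1 + δ) ^ Module.finrank ℝ V * μ.real (A + t • B) := by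
  obtain ⟨a₀, ha₀⟩ := hne
  have hv : ∀ (B : Set V) (x : V), μ.real (x +ᵥ B) = μ.real B := fun B x => by
    simp [measureReal_def, measure_vadd]
  rw [← measureReal_smul μ _ (by positivity), ← hv (A + (t * (1 + δ)) • B) (δ • a₀)]
  refine measureReal_mono_of_isCompact μ ((hA.add (hB.smul t)).smul _) ?_
  rintro _ ⟨_, ⟨a, ha, _, ⟨b, hb, rfl⟩, rfl⟩, rfl⟩
  refine ⟨((1 + δ)⁻¹ • a + ((1 + δ)⁻¹ * δ) • a₀) + t • b, Set.add_mem_add ?_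
    (Set.smul_mem_smul_set hb), ?_⟩
  · exact hAc ha ha₀ (by positivity) (by positivity) (by field_simp)
  · simp only [vadd_eq_add, smul_add, smul_smul]
    rw [mul_inv_cancel_left₀ (by positivity), mul_inv_cancel₀ (by positivity), mul_comm t, one_smul]
    abel

/-- **Steiner's formula**: the volume of the parallel bodies of a compact convex set is a
polynomial in the distance. -/
theorem exists_steiner_polynomial [Nontrivial V] {A : Set V} (hA : IsCompact A)
    (hAc : Convex ℝ A) (hne : A.Nonempty) :
    ∃ p : Polynomial ℝ, p.natDegree ≤ Module.finrank ℝ V ∧ ∀ t : ℝ, 0 ≤ t →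
      μ.real (A + t • Metric.closedBall (0 : V) 1) = p.eval t := by
  have hB : IsCompact (Metric.closedBall (0 : V) 1) := isCompact_closedBall _ _
  choose Z hZ hBZ hZB using fun k : ℕ =>
    exists_isZonotope_closedBall (V := V) (δ := 1 / ((k : ℝ) + 1)) (by positivity)
  choose p hp using fun k => (hZ k).exists_polynomial μ hA hAc
  have hup : ∀ k t, 0 ≤ t → (p k).eval t ≤
      (1 + 1 / ((k : ℝ) + 1)) ^ Module.finrank ℝ V * μ.real (A + t • Metric.closedBall (0 : V) 1) := by
    intro k t ht
    have hδ : (0 : ℝ) ≤ 1 / ((k : ℝ) + 1) := by positivity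
    rw [← hp k t ht]
    refine le_trans (measureReal_mono_of_isCompact μ (hA.add (hB.smul _)) ?_)
      (measureReal_add_smul_le μ hA hAc hne hB hδ)
    refine Set.add_subset_add_left ?_
    rw [mul_smul]
    refine Set.smul_set_mono ((hZB k).trans_eq ?_)
    rw [smul_unitClosedBall_of_nonneg (by positivity)]
  have hlo : ∀ k t, 0 ≤ t → μ.real (A + t • Metric.closedBall (0 : V) 1) ≤ (p k).eval t := by
    intro k t ht
    rw [← hp k t ht]
    exact measureReal_mono_of_isCompact μ (hA.add ((hZ k).isCompact.smul _))
      (Set.add_subset_add_left (Set.smul_set_mono (hBZ k)))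
  refine exists_polynomial_of_tendsto (p := p) (fun k => ?_) fun t ht => ?_
  -- The degree is bounded through growth: `A + t • B` lies in a ball of radius `M * (1 + t)`.
  · obtain ⟨M, hM1, hM⟩ : ∃ M : ℝ, 1 ≤ M ∧ A ⊆ Metric.closedBall 0 M := by
      obtain ⟨M, hM⟩ := hA.isBounded.subset_closedBall 0
      exact ⟨max 1 M, le_max_left _ _, hM.trans (Metric.closedBall_subset_closedBall (le_max_right _ _))⟩
    refine natDegree_le_of_abs_eval_le (C := (1 + 1 / ((k : ℝ) + 1)) ^ Module.finrank ℝ V *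
      (M ^ Module.finrank ℝ V * μ.real (Metric.closedBall (0 : V) 1))) fun t ht => ?_
    rw [abs_of_nonneg (measureReal_nonneg.trans (hlo k t ht))]
    refine (hup k t ht).trans ?_
    rw [mul_assoc, mul_right_comm, ← mul_pow, ← measureReal_smul μ (M * (1 + t)) (by positivity),
      smul_unitClosedBall_of_nonneg (r := M * (1 + t)) (by positivity)]
    refine mul_le_mul_of_nonneg_left (measureReal_mono_of_isCompact μ (isCompact_closedBall _ _) ?_)
      (by positivity)
    rintro _ ⟨a, ha, _, ⟨b, hb, rfl⟩, rfl⟩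
    have h1 := mem_closedBall_zero_iff.1 (hM ha)
    have h2 := mem_closedBall_zero_iff.1 hb
    rw [mem_closedBall_zero_iff]
    refine (norm_add_le _ _).trans ?_
    simp only [norm_smul, Real.norm_eq_abs, abs_of_nonneg ht]
    nlinarith
  · refine tendsto_of_tendsto_of_tendsto_of_le_of_le tendsto_const_nhds ?_
      (fun k => hlo k t ht) (fun k => hup k t ht)
    have h1 : Filter.Tendsto (fun k : ℕ => 1 + 1 / ((k : ℝ) + 1)) Filter.atTop (𝓝 (1 + 0)) :=
      tendsto_const_nhds.add tendsto_one_div_add_atTop_nhds_zero_nat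
    have h2 := (h1.pow (Module.finrank ℝ V)).mul_const
      (μ.real (A + t • Metric.closedBall (0 : V) 1))
    simpa using h2

end Ball

/-! ### Polar coordinates. -/

section

variable {V : Type*} [NormedAddCommGroup V] [NormedSpace ℝ V]

theorem inv_norm_smul_smul_sphere (r : Set.Ioi (0 : ℝ)) (ω : Metric.sphere (0 : V) 1) :
    ‖(r : ℝ) • (ω : V)‖⁻¹ • ((r : ℝ) • (ω : V)) = ω := by
  have hr : (0 : ℝ) < r := r.2
  rw [norm_smul, norm_eq_of_mem_sphere ω, mul_one, Real.norm_of_nonneg hr.le, smul_smul,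
    inv_mul_cancel₀ hr.ne', one_smul]

theorem norm_smul_sphere (r : Set.Ioi (0 : ℝ)) (ω : Metric.sphere (0 : V) 1) :
    ‖(r : ℝ) • (ω : V)‖ = r := by
  have hr : (0 : ℝ) < r := r.2
  rw [norm_smul, norm_eq_of_mem_sphere ω, mul_one, Real.norm_of_nonneg hr.le]

end

section Polar

open MeasureTheory Measure

variable {V : Type*} [NormedAddCommGroup V] [NormedSpace ℝ V] [FiniteDimensional ℝ V]
  [Nontrivial V] [MeasurableSpace V] [BorelSpace V] (μ : Measure V) [μ.IsAddHaarMeasure]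

/-- Polar coordinates as a measure preserving map. -/
theorem measurePreserving_polar :
    MeasurePreserving (fun p : Metric.sphere (0 : V) 1 × Set.Ioi (0 : ℝ) => (p.2 : ℝ) • (p.1 : V))
      (μ.toSphere.prod (volumeIoiPow (Module.finrank ℝ V - 1))) μ := by
  have h1 := (measurePreserving_homeomorphUnitSphereProd μ).symm
    (homeomorphUnitSphereProd V).toMeasurableEquiv
  have h2 : MeasurePreserving (Subtype.val : ({0}ᶜ : Set V) → V) (μ.comap (↑)) μ := by
    refine ⟨measurable_subtype_coe, ?_⟩
    rw [map_comap_subtype_coe (measurableSet_singleton _).compl, restrict_compl_singleton]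
  exact h2.comp h1

theorem lintegral_polar {F : V → ENNReal} (hF : Measurable F) :
    ∫⁻ x, F x ∂μ = ∫⁻ ω, ∫⁻ r, F ((r : ℝ) • (ω : V))
      ∂(volumeIoiPow (Module.finrank ℝ V - 1)) ∂μ.toSphere := by
  have hp := measurePreserving_polar μ
  rw [← hp.lintegral_comp hF, lintegral_prod (fun p : Metric.sphere (0 : V) 1 × Set.Ioi (0 : ℝ) =>
    F ((p.2 : ℝ) • (p.1 : V))) (hF.comp hp.measurable).aemeasurable]

/-- The volume of a star body in terms of its radial function. -/
theorem measureReal_star {ρ : V → ℝ} (hρ : Measurable ρ) (hpos : ∀ x, 0 < ρ x) :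
    μ.real {x | ‖x‖ < ρ (‖x‖⁻¹ • x)} =
      ∫ x in Metric.ball (0 : V) 1, ρ (‖x‖⁻¹ • x) ^ Module.finrank ℝ V ∂μ := by
  have hn : 0 < Module.finrank ℝ V := Module.finrank_pos
  have hn1 : Module.finrank ℝ V - 1 + 1 = Module.finrank ℝ V := Nat.sub_add_cancel hn
  have hm : Measurable fun x : V => ρ (‖x‖⁻¹ • x) :=
    hρ.comp (measurable_norm.inv.smul measurable_id)
  have hS : MeasurableSet {x : V | ‖x‖ < ρ (‖x‖⁻¹ • x)} := measurableSet_lt measurable_norm hm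
  rw [integral_eq_lintegral_of_nonneg_ae (Filter.Eventually.of_forall fun x => by
    have := hpos (‖x‖⁻¹ • x); positivity) (hm.pow_const _).aestronglyMeasurable, measureReal_def]
  congr 1
  rw [← lintegral_indicator_one hS, ← lintegral_indicator measurableSet_ball,
    lintegral_polar μ (measurable_one.indicator hS),
    lintegral_polar μ ((hm.pow_const _).ennreal_ofReal.indicator measurableSet_ball)]
  -- On the ray through `ω` both sides equal `ρ ω ^ n / n`, where `n` is the dimension.
  refine lintegral_congr fun ω => ?_
  have e1 : ∀ r : Set.Ioi (0 : ℝ), Set.indicator {x : V | ‖x‖ < ρ (‖x‖⁻¹ • x)} 1 ((r : ℝ) • (ω : V)) =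
      Set.indicator (Set.Iio (⟨ρ ω, hpos ω⟩ : Set.Ioi (0 : ℝ))) (1 : Set.Ioi (0 : ℝ) → ENNReal) r := by
    intro r
    simp only [Set.indicator, Set.mem_ofPred_eq, inv_norm_smul_smul_sphere]
    simp only [norm_smul_sphere, Set.mem_Iio, ← Subtype.coe_lt_coe, Pi.one_apply]
  have e2 : ∀ r : Set.Ioi (0 : ℝ), Set.indicator (Metric.ball (0 : V) 1)
      (fun x => ENNReal.ofReal (ρ (‖x‖⁻¹ • x) ^ Module.finrank ℝ V)) ((r : ℝ) • (ω : V)) =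
      Set.indicator (Set.Iio (⟨1, Set.mem_Ioi.2 one_pos⟩ : Set.Ioi (0 : ℝ)))
        (fun _ => ENNReal.ofReal (ρ ω ^ Module.finrank ℝ V)) r := by
    intro r
    simp only [Set.indicator, inv_norm_smul_smul_sphere]
    simp only [mem_ball_zero_iff, norm_smul_sphere, Set.mem_Iio, ← Subtype.coe_lt_coe]
  simp_rw [e1, e2]
  rw [lintegral_indicator_one measurableSet_Iio, lintegral_indicator measurableSet_Iio,
    setLIntegral_const, volumeIoiPow_apply_Iio, volumeIoiPow_apply_Iio, hn1,
    ← ENNReal.ofReal_mul (pow_nonneg (hpos ω).le _)]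
  simp only [one_pow]
  congr 1
  ring

end Polar

/-! ### First variation of the volume of the unit ball. -/

theorem one_add_pow_le {y : ℝ} (h1 : -1 ≤ y) (h2 : y ≤ 1) (n : ℕ) :
    (1 + y) ^ n ≤ 1 + n * y + 4 ^ n * y ^ 2 := by
  induction n with
  | zero => simp; positivity
  | succ k ih =>
    have hk : (k : ℝ) ≤ 4 ^ k := by
      exact_mod_cast (Nat.lt_pow_self (by norm_num : 1 < 4)).le
    have h4 : (0 : ℝ) ≤ 4 ^ k := by positivity
    have hy : 0 ≤ 1 + y := by linarith
    have := mul_le_mul_of_nonneg_right ih hy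
    rw [pow_succ]
    refine this.trans ?_
    push_cast
    have e : 1 + (↑k + 1) * y + 4 ^ (k + 1) * y ^ 2 - (1 + ↑k * y + 4 ^ k * y ^ 2) * (1 + y) =
      y ^ 2 * ((4 ^ k - k) + 4 ^ k * (1 - y) + 4 ^ k) := by ring
    have : 0 ≤ y ^ 2 * ((4 ^ k - k) + 4 ^ k * (1 - y) + 4 ^ k) := by
      apply mul_nonneg (sq_nonneg _)
      have := mul_nonneg h4 (sub_nonneg.2 h2)
      linarith
    linarith

theorem eval_zero_eq_zero_of_abs_le {p : Polynomial ℝ} {C t₀ : ℝ} (ht₀ : 0 < t₀)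
    (h : ∀ t : ℝ, 0 < t → t < t₀ → |p.eval t| ≤ C * t) : p.eval 0 = 0 := by
  have h1 : Filter.Tendsto (fun t => |p.eval t|) (𝓝[>] 0) (𝓝 |p.eval 0|) :=
    (p.continuous.abs.tendsto 0).mono_left nhdsWithin_le_nhds
  have h2 : Filter.Tendsto (fun t : ℝ => C * t) (𝓝[>] 0) (𝓝 (C * 0)) :=
    ((continuous_const.mul continuous_id).tendsto 0).mono_left nhdsWithin_le_nhds
  have h3 := le_of_tendsto_of_tendsto h1 h2 (by
    filter_upwards [Ioo_mem_nhdsGT ht₀] with t ht using h t ht.1 ht.2)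
  rw [mul_zero] at h3
  exact abs_nonpos_iff.1 h3

/-- The first two coefficients of a polynomial with a given first order expansion at `0`. -/
theorem coeff_of_abs_sub_le {p : Polynomial ℝ} {a b C t₀ : ℝ} (ht₀ : 0 < t₀)
    (h : ∀ t : ℝ, 0 < t → t < t₀ → |p.eval t - (a + b * t)| ≤ C * t ^ 2) :
    p.coeff 0 = a ∧ p.coeff 1 = b := by
  set q := p - Polynomial.C a - Polynomial.C b * Polynomial.X with hq
  have he : ∀ t, q.eval t = p.eval t - (a + b * t) := fun t => by simp [hq]; ring
  have h0 : q.eval 0 = 0 := by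
    refine eval_zero_eq_zero_of_abs_le (C := |C| * t₀) ht₀ fun t h1 h2 => ?_
    rw [he]
    refine (h t h1 h2).trans ?_
    have := le_abs_self C
    have := abs_nonneg C
    nlinarith [mul_nonneg this (mul_nonneg h1.le (sub_nonneg.2 h2.le)), sq_nonneg t]
  obtain ⟨s, hs⟩ := Polynomial.X_dvd_iff.2 (by rwa [Polynomial.coeff_zero_eq_eval_zero] : q.coeff 0 = 0)
  have h1 : s.eval 0 = 0 := by
    refine eval_zero_eq_zero_of_abs_le (C := C) ht₀ fun t h1 h2 => ?_
    have := h t h1 h2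
    rw [← he, hs, Polynomial.eval_mul, Polynomial.eval_X, abs_mul, abs_of_pos h1, pow_two,
      ← mul_assoc, mul_comm (C * t), ] at this
    exact le_of_mul_le_mul_left this h1
  have hc0 : q.coeff 0 = 0 := by rwa [Polynomial.coeff_zero_eq_eval_zero]
  have hc1 : q.coeff 1 = 0 := by
    rw [hs, Polynomial.coeff_X_mul, Polynomial.coeff_zero_eq_eval_zero, h1]
  simp [hq] at hc0 hc1
  constructor <;> linarith

section FirstOrder

open MeasureTheory

variable {V : Type*} [NormedAddCommGroup V] [InnerProductSpace ℝ V]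

theorem abs_supportFn_le {A : Set V} (hA : IsCompact A) (hne : A.Nonempty) {M : ℝ}
    (hM : ∀ x ∈ A, ‖x‖ ≤ M) {u : V} (hu : ‖u‖ ≤ 1) : |supportFn A u| ≤ M := by
  obtain ⟨x, hx, h⟩ := exists_inner_eq_supportFn hA hne u
  rw [← h]
  have := abs_real_inner_le_norm u x
  have := hM x hx
  nlinarith [norm_nonneg x, norm_nonneg u]

theorem norm_inv_norm_smul_le (x : V) : ‖‖x‖⁻¹ • x‖ ≤ 1 := by
  rw [norm_smul, norm_inv, norm_norm]
  exact inv_mul_le_one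

/-- With `u = ‖x‖⁻¹ • x`, the norm of `x = b + t • a` is `⟪u, x⟫ ≤ 1 + t * supportFn A u`. The term
`t ^ 2` only makes the inequality strict. -/
theorem closedBall_add_smul_subset {A : Set V} (hA : IsCompact A) {t : ℝ} (ht : 0 < t) :
    Metric.closedBall (0 : V) 1 + t • A ⊆
      {x | ‖x‖ < 1 + t * supportFn A (‖x‖⁻¹ • x) + t ^ 2 ∨ x = 0} := by
  rintro x ⟨b, hb, _, ⟨a, ha, rfl⟩, rfl⟩
  rw [mem_closedBall_zero_iff] at hb
  set x := b + t • a with hx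
  change ‖x‖ < 1 + t * supportFn A (‖x‖⁻¹ • x) + t ^ 2 ∨ x = 0
  rcases eq_or_ne x 0 with h0 | h0
  · exact Or.inr h0
  left
  have hn : 0 < ‖x‖ := norm_pos_iff.2 h0
  set u := ‖x‖⁻¹ • x with hu
  have hun : ‖u‖ = 1 := by rw [hu, norm_smul, norm_inv, norm_norm, inv_mul_cancel₀ hn.ne']
  have h1 : inner ℝ u x = ‖x‖ := by
    rw [hu, real_inner_smul_left, real_inner_self_eq_norm_sq]; field_simp
  have h2 : inner ℝ u x = inner ℝ u b + t * inner ℝ u a := by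
    rw [hx, inner_add_right, real_inner_smul_right]
  have h3 := real_inner_le_norm u b
  have h4 := mul_le_mul_of_nonneg_left (inner_le_supportFn hA ha u) ht.le
  rw [hun, one_mul] at h3
  have : 0 < t ^ 2 := by positivity
  linarith

/-- Let `a` be a support point of `A` in the direction of `x`, with support value `s`. Then `‖x - t
• a‖² = (‖x‖ - t * s)² - (t * s)² + t² * ‖a‖²`, and the margin `t² * M²` pays for the last term. -/
theorem subset_closedBall_add_smul {A : Set V} (hA : IsCompact A) (hne : A.Nonempty) {M : ℝ}
    (hM : ∀ x ∈ A, ‖x‖ ≤ M) {t : ℝ} (ht : 0 < t) (htM : t * M ≤ 1 / 2) :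
    {x | ‖x‖ < 1 + t * supportFn A (‖x‖⁻¹ • x) - t ^ 2 * M ^ 2} ⊆
      Metric.closedBall (0 : V) 1 + t • A := by
  intro x hx
  rw [Set.mem_ofPred_eq] at hx
  set u := ‖x‖⁻¹ • x with hu
  obtain ⟨a, ha, hau⟩ := exists_inner_eq_supportFn hA hne u
  refine ⟨x - t • a, ?_, t • a, Set.smul_mem_smul_set ha, by simp⟩
  rw [mem_closedBall_zero_iff]
  have hM0 : 0 ≤ M := (norm_nonneg a).trans (hM a ha)
  have hxu : x = ‖x‖ • u := by
    rcases eq_or_ne x 0 with h0 | h0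
    · simp [h0]
    · rw [hu, smul_smul, mul_inv_cancel₀ (norm_ne_zero_iff.2 h0), one_smul]
  have h1 : ‖x - t • a‖ ^ 2 = ‖x‖ ^ 2 - 2 * (t * ‖x‖ * supportFn A u) + t ^ 2 * ‖a‖ ^ 2 := by
    rw [norm_sub_sq_real, real_inner_smul_right, norm_smul, Real.norm_of_nonneg ht.le]
    have : inner ℝ x a = ‖x‖ * supportFn A u := by
      conv_lhs => rw [hxu]
      rw [real_inner_smul_left, hau]
    rw [this]; ring
  have hs := abs_le.1 (abs_supportFn_le hA hne hM (u := u) (by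
    rw [hu]; exact norm_inv_norm_smul_le x))
  set s := supportFn A u
  have ha2 : ‖a‖ ^ 2 ≤ M ^ 2 := pow_le_pow_left₀ (norm_nonneg _) (hM a ha) 2
  have hx0 := norm_nonneg x
  set d := ‖x‖ - t * s with hd
  have hd1 : d ≤ 1 - (t * M) ^ 2 := by rw [hd]; nlinarith
  have hd2 : -(t * M) ≤ d := by rw [hd]; nlinarith
  have htM0 : 0 ≤ t * M := by positivity
  have hd3 : d ^ 2 ≤ 1 - (t * M) ^ 2 := by
    have h5 : (t * M) ^ 2 ≤ 1 / 4 := by nlinarith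
    rcases le_total 0 d with h | h
    · nlinarith [sq_nonneg (t * M)]
    · nlinarith
  have h6 : ‖x - t • a‖ ^ 2 ≤ 1 := by
    rw [h1]
    have h7 : t ^ 2 * ‖a‖ ^ 2 ≤ t ^ 2 * M ^ 2 := mul_le_mul_of_nonneg_left ha2 (sq_nonneg t)
    have h8 : ‖x‖ ^ 2 - 2 * (t * ‖x‖ * s) = d ^ 2 - (t * s) ^ 2 := by rw [hd]; ring
    nlinarith [sq_nonneg (t * s)]
  exact (sq_le_one_iff₀ (norm_nonneg _)).1 h6

variable [FiniteDimensional ℝ V] [MeasurableSpace V] [BorelSpace V]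

theorem measurable_comp_inv_norm_smul {F : V → ℝ} (hF : Measurable F) :
    Measurable fun x : V => F (‖x‖⁻¹ • x) :=
  hF.comp (measurable_norm.inv.smul measurable_id)

theorem integrableOn_comp_inv_norm_smul {F : V → ℝ} (hF : Measurable F) {M : ℝ}
    (hM : ∀ u : V, ‖u‖ ≤ 1 → |F u| ≤ M) (μ : Measure V) [IsFiniteMeasureOnCompacts μ] :
    IntegrableOn (fun x => F (‖x‖⁻¹ • x)) (Metric.ball (0 : V) 1) μ :=
  Measure.integrableOn_of_bounded (M := M) measure_ball_lt_top.ne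
    (measurable_comp_inv_norm_smul hF).aestronglyMeasurable
    (Filter.Eventually.of_forall fun x => hM _ (norm_inv_norm_smul_le x))

variable [Nontrivial V] (μ : Measure V) [μ.IsAddHaarMeasure]

/-- The first variation of the volume of the unit ball under addition of a convex set is the
integral of the support function. -/
theorem abs_measureReal_closedBall_add_smul_sub_le {A : Set V} (hA : IsCompact A)
    (hne : A.Nonempty) : ∃ C t₀ : ℝ, 0 < t₀ ∧ ∀ t : ℝ, 0 < t → t < t₀ →
      |μ.real (Metric.closedBall (0 : V) 1 + t • A) - (μ.real (Metric.ball (0 : V) 1) +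
        (Module.finrank ℝ V * ∫ x in Metric.ball (0 : V) 1, supportFn A (‖x‖⁻¹ • x) ∂μ) * t)| ≤
        C * t ^ 2 := by
  obtain ⟨M, hM1, hM⟩ : ∃ M : ℝ, 1 ≤ M ∧ ∀ x ∈ A, ‖x‖ ≤ M := by
    obtain ⟨M, hM⟩ := hA.isBounded.exists_norm_le
    exact ⟨max 1 M, le_max_left _ _, fun x hx => (hM x hx).trans (le_max_right _ _)⟩
  set n := Module.finrank ℝ V with hn
  set b := μ.real (Metric.ball (0 : V) 1) with hb
  have hb0 : 0 ≤ b := measureReal_nonneg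
  set I := ∫ x in Metric.ball (0 : V) 1, supportFn A (‖x‖⁻¹ • x) ∂μ with hI
  have hmeas : Measurable (supportFn A) := (continuous_supportFn hA).measurable
  have hbd : ∀ u : V, ‖u‖ ≤ 1 → |supportFn A u| ≤ M := fun u hu => abs_supportFn_le hA hne hM hu
  have hint := integrableOn_comp_inv_norm_smul hmeas hbd μ
  have hconst : ∀ c : ℝ, ∫ _ in Metric.ball (0 : V) 1, c ∂μ = c * b := fun c => by
    rw [setIntegral_const, smul_eq_mul, mul_comm]
  have hcint : ∀ c : ℝ, IntegrableOn (fun _ : V => c) (Metric.ball (0 : V) 1) μ := fun c =>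
    integrableOn_const measure_ball_lt_top.ne
  have hlin : ∀ α β : ℝ, ∫ x in Metric.ball (0 : V) 1, (α + β * supportFn A (‖x‖⁻¹ • x)) ∂μ =
      α * b + β * I := fun α β => by
    rw [integral_add (hcint α) (hint.const_mul β), hconst, integral_const_mul]
  have hlini : ∀ α β : ℝ, IntegrableOn (fun x => α + β * supportFn A (‖x‖⁻¹ • x))
      (Metric.ball (0 : V) 1) μ := fun α β => (hcint α).add (hint.const_mul β)
  refine ⟨(n + 4 ^ n * (M + 1) ^ 2 + n * M ^ 2) * b, (2 * (M + 1))⁻¹, by positivity,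
    fun t ht ht' => ?_⟩
  have htM : t * (M + 1) < 1 / 2 := by
    rw [← lt_div_iff₀ (by positivity)]
    calc t < _ := ht'
      _ = _ := by field_simp
  have ht1 : t ≤ 1 := by nlinarith
  have hcpt : IsCompact (Metric.closedBall (0 : V) 1 + t • A) :=
    (isCompact_closedBall _ _).add (hA.smul t)
  have hpow : ∀ s : ℝ, (∀ u : V, ‖u‖ ≤ 1 → |t * supportFn A u + s| ≤ 1) →
      IntegrableOn (fun x => (1 + t * supportFn A (‖x‖⁻¹ • x) + s) ^ n) (Metric.ball (0 : V) 1) μ := by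
    intro s hs
    refine integrableOn_comp_inv_norm_smul (F := fun u => (1 + t * supportFn A u + s) ^ n)
      (M := 2 ^ n) (by fun_prop) (fun u hu => ?_) μ
    rw [abs_pow]
    refine pow_le_pow_left₀ (abs_nonneg _) ?_ n
    have := abs_le.1 (hs u hu)
    exact abs_le.2 ⟨by linarith, by linarith⟩
  have hsb : ∀ u : V, ‖u‖ ≤ 1 → |t * supportFn A u| ≤ t * M := fun u hu => by
    rw [abs_mul, abs_of_pos ht]; exact mul_le_mul_of_nonneg_left (hbd u hu) ht.le
  have hup : μ.real (Metric.closedBall (0 : V) 1 + t • A) ≤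
      b + n * t * I + (n + 4 ^ n * (M + 1) ^ 2) * b * t ^ 2 := by
    -- The truncation at `1 / 4` makes `ρ` positive everywhere, as `measureReal_star` requires; it
    -- is inactive for `‖u‖ ≤ 1`.
    set ρ : V → ℝ := fun u => max (1 / 4) (1 + t * supportFn A u + t ^ 2) with hρ
    have hρu : ∀ u : V, ‖u‖ ≤ 1 → ρ u = 1 + t * supportFn A u + t ^ 2 := fun u hu => by
      have := abs_le.1 (hsb u hu)
      exact max_eq_right (by nlinarith [sq_nonneg t])
    have hst := measureReal_star μ (ρ := ρ) (by fun_prop) (fun u => by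
      rw [hρ]; exact lt_max_of_lt_left (by norm_num))
    have hsub : Metric.closedBall (0 : V) 1 + t • A ⊆ {x | ‖x‖ < ρ (‖x‖⁻¹ • x)} := by
      intro x hx
      rcases closedBall_add_smul_subset hA ht hx with h | h
      · exact h.trans_le (le_max_right _ _)
      · rw [Set.mem_ofPred_eq, h, norm_zero]; exact lt_max_of_lt_left (by norm_num)
    have hbdd : {x : V | ‖x‖ < ρ (‖x‖⁻¹ • x)} ⊆ Metric.ball 0 2 := by
      intro x hx
      rw [Set.mem_ofPred_eq, hρu _ (norm_inv_norm_smul_le x)] at hx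
      have := abs_le.1 (hsb _ (norm_inv_norm_smul_le x))
      rw [mem_ball_zero_iff]
      nlinarith
    refine (measureReal_mono hsub ((measure_mono hbdd).trans_lt measure_ball_lt_top).ne).trans ?_
    rw [hst]
    have hle : ∀ x : V, ρ (‖x‖⁻¹ • x) ^ n ≤
        (1 + n * t ^ 2 + 4 ^ n * (t * (M + 1)) ^ 2) + (n * t) * supportFn A (‖x‖⁻¹ • x) := by
      intro x
      have h1 := norm_inv_norm_smul_le x
      rw [hρu _ h1]
      have h2 := abs_le.1 (hsb _ h1)
      set s := supportFn A (‖x‖⁻¹ • x)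
      have h3 : |t * s + t ^ 2| ≤ t * (M + 1) := abs_le.2 ⟨by nlinarith, by nlinarith⟩
      have h5 := abs_le.1 h3
      have h4 := one_add_pow_le (y := t * s + t ^ 2) (by linarith) (by linarith) n
      have h6 : (t * s + t ^ 2) ^ 2 ≤ (t * (M + 1)) ^ 2 := sq_le_sq' h5.1 h5.2
      have h7 := mul_le_mul_of_nonneg_left h6 (by positivity : (0 : ℝ) ≤ 4 ^ n)
      rw [← add_assoc] at h4
      linarith
    refine (integral_mono ?_ (hlini _ _) hle).trans (le_of_eq ?_)
    · refine (hpow (t ^ 2) fun u hu => ?_).congr_fun (fun x _ => ?_) measurableSet_ball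
      · have := abs_le.1 (hsb u hu)
        exact abs_le.2 ⟨by nlinarith, by nlinarith⟩
      · simp only [hρu _ (norm_inv_norm_smul_le x)]
    · rw [hlin]; ring
  have hlo : b + n * t * I - n * M ^ 2 * b * t ^ 2 ≤
      μ.real (Metric.closedBall (0 : V) 1 + t • A) := by
    have htM2 : t ^ 2 * M ^ 2 ≤ 1 / 4 := by
      have : t * M ≤ 1 / 2 := by nlinarith
      have h0 : 0 ≤ t * M := by positivity
      nlinarith
    set ρ : V → ℝ := fun u => max (1 / 4) (1 + t * supportFn A u - t ^ 2 * M ^ 2) with hρ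
    have hρu : ∀ u : V, ‖u‖ ≤ 1 → ρ u = 1 + t * supportFn A u - t ^ 2 * M ^ 2 := fun u hu => by
      have := abs_le.1 (hsb u hu)
      exact max_eq_right (by nlinarith [sq_nonneg t])
    have hst := measureReal_star μ (ρ := ρ) (by fun_prop) (fun u => by
      rw [hρ]; exact lt_max_of_lt_left (by norm_num))
    have hsub : {x | ‖x‖ < ρ (‖x‖⁻¹ • x)} ⊆ Metric.closedBall (0 : V) 1 + t • A := by
      intro x hx
      rw [Set.mem_ofPred_eq, hρu _ (norm_inv_norm_smul_le x)] at hx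
      exact subset_closedBall_add_smul hA hne hM ht (by nlinarith) hx
    refine le_trans ?_ (measureReal_mono_of_isCompact μ hcpt hsub)
    rw [hst]
    have hle : ∀ x : V, (1 - n * (t ^ 2 * M ^ 2)) + (n * t) * supportFn A (‖x‖⁻¹ • x) ≤
        ρ (‖x‖⁻¹ • x) ^ n := by
      intro x
      have h1 := norm_inv_norm_smul_le x
      rw [hρu _ h1]
      have h2 := abs_le.1 (hsb _ h1)
      set s := supportFn A (‖x‖⁻¹ • x)
      have h4 := one_add_mul_le_pow (a := t * s - t ^ 2 * M ^ 2) (by nlinarith) n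
      rw [← add_sub_assoc] at h4
      linarith
    refine (le_of_eq ?_).trans (integral_mono (hlini _ _) ?_ hle)
    · rw [hlin]; ring
    · refine (hpow (-(t ^ 2 * M ^ 2)) fun u hu => ?_).congr_fun (fun x _ => ?_) measurableSet_ball
      · have := abs_le.1 (hsb u hu)
        exact abs_le.2 ⟨by nlinarith, by nlinarith⟩
      · simp only [hρu _ (norm_inv_norm_smul_le x), sub_eq_add_neg, hn]
  have p1 : 0 ≤ (n + 4 ^ n * (M + 1) ^ 2) * b * t ^ 2 := by positivity
  have p2 : 0 ≤ n * M ^ 2 * b * t ^ 2 := by positivity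
  exact abs_le.2 ⟨by nlinarith, by nlinarith⟩

/-- The coefficient of degree `n - 1` of the Steiner polynomial is the integral of the support
function. -/
theorem coeff_steiner_polynomial {A : Set V} (hA : IsCompact A) (hne : A.Nonempty)
    {p : Polynomial ℝ} (hdeg : p.natDegree ≤ Module.finrank ℝ V)
    (hp : ∀ t : ℝ, 0 < t → μ.real (A + t • Metric.closedBall (0 : V) 1) = p.eval t) :
    p.coeff (Module.finrank ℝ V - 1) =
      Module.finrank ℝ V * ∫ x in Metric.ball (0 : V) 1, supportFn A (‖x‖⁻¹ • x) ∂μ := by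
  obtain ⟨C, t₀, ht₀, h⟩ := abs_measureReal_closedBall_add_smul_sub_le μ hA hne
  have hn : 1 ≤ Module.finrank ℝ V := Module.finrank_pos
  -- Since `B + t • A = t • (A + t⁻¹ • B)`, exchanging the roles of `A` and the ball reverses the
  -- Steiner polynomial. The coefficient of degree `n - 1` becomes the linear one.
  have hq : ∀ t : ℝ, 0 < t → μ.real (Metric.closedBall (0 : V) 1 + t • A) =
      (p.reflect (Module.finrank ℝ V)).eval t := by
    intro t ht
    have h1 : Metric.closedBall (0 : V) 1 + t • A = t • (A + t⁻¹ • Metric.closedBall (0 : V) 1) := by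
      rw [smul_add, smul_smul, mul_inv_cancel₀ ht.ne', one_smul, add_comm]
    rw [h1, measureReal_smul μ t ht.le, hp _ (inv_pos.2 ht)]
    let _ : Invertible t⁻¹ := invertibleOfNonzero (inv_ne_zero ht.ne')
    have h2 := Polynomial.eval₂_reflect_mul_pow (RingHom.id ℝ) t⁻¹ (Module.finrank ℝ V) p hdeg
    rw [invOf_eq_inv, inv_inv] at h2
    change (p.reflect (Module.finrank ℝ V)).eval t * _ = p.eval t⁻¹ at h2
    rw [← h2, mul_comm, mul_assoc, ← mul_pow, inv_mul_cancel₀ ht.ne', one_pow, mul_one]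
  have := coeff_of_abs_sub_le (p := p.reflect (Module.finrank ℝ V)) ht₀ fun t h1 h2 => by
    rw [← hq t h1]; exact h t h1 h2
  rw [← this.2, Polynomial.coeff_reflect, Polynomial.revAt_le hn]

end FirstOrder

/-! ### The first intrinsic volume as an integral of the support function. -/

section IntrinsicVolume

open MeasureTheory

theorem kappa_pos (k : ℕ) : 0 < kappa k :=
  ENNReal.toReal_pos (Metric.measure_closedBall_pos _ _ one_pos).ne' measure_closedBall_lt_top.ne

/-- This makes the choice in `intrinsicVolume` harmless: polynomials that agree at all positive `t`
coincide. -/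
theorem IsSteinerCoefficients.eq {n : ℕ} {K : Set (E n)} {V : ℕ → ℝ}
    (hV : IsSteinerCoefficients K V) {p : Polynomial ℝ}
    (hp : ∀ t : ℝ, 0 < t → volume.real (K + t • Metric.closedBall (0 : E n) 1) = p.eval t)
    {j : ℕ} (hj : j ≤ n) : kappa (n - j) * V j = p.coeff (n - j) := by
  have h : p = ∑ j ∈ Finset.range (n + 1),
      Polynomial.C (kappa (n - j) * V j) * Polynomial.X ^ (n - j) := by
    refine Polynomial.eq_of_infinite_eval_eq _ _ (Set.Infinite.mono ?_ (Set.Ioi_infinite (0 : ℝ)))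
    intro t ht
    rw [Set.mem_ofPred_eq, ← hp t ht, hV.1 t ht]
    simp [Polynomial.eval_finsetSum]
  rw [h, Polynomial.finsetSum_coeff, Finset.sum_eq_single j]
  · rw [Polynomial.coeff_C_mul_X_pow, if_pos rfl]
  · intro i hi hij
    rw [Finset.mem_range] at hi
    rw [Polynomial.coeff_C_mul_X_pow, if_neg (by omega)]
  · intro h'
    exact absurd (Finset.mem_range.2 (by omega)) h'

theorem exists_isSteinerCoefficients {n : ℕ} {K : Set (E n)} {p : Polynomial ℝ}
    (hdeg : p.natDegree ≤ n)
    (hp : ∀ t : ℝ, 0 < t → volume.real (K + t • Metric.closedBall (0 : E n) 1) = p.eval t) :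
    ∃ V : ℕ → ℝ, IsSteinerCoefficients K V := by
  refine ⟨fun j => if j ≤ n then p.coeff (n - j) / kappa (n - j) else 0, fun t ht => ?_,
    fun j hj => if_neg (by omega)⟩
  rw [hp t ht, Polynomial.eval_eq_sum_range' (Nat.lt_succ_of_le hdeg), ← Finset.sum_range_reflect]
  refine Finset.sum_congr rfl fun j hj => ?_
  rw [Finset.mem_range] at hj
  simp only [if_pos (Nat.lt_succ_iff.1 hj), mul_div_cancel₀ _ (kappa_pos (n - j)).ne',
    Nat.succ_sub_one]

/-- The first intrinsic volume is, up to a factor, the mean of the support function. -/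
theorem kappa_mul_intrinsicVolume_one {n : ℕ} (hn : 1 ≤ n) {K : Set (E n)} (hK : IsCompact K)
    (hKc : Convex ℝ K) (hne : K.Nonempty) :
    kappa (n - 1) * intrinsicVolume 1 K =
      n * ∫ x in Metric.ball (0 : E n) 1, supportFn K (‖x‖⁻¹ • x) := by
  have : Nonempty (Fin n) := ⟨⟨0, hn⟩⟩
  obtain ⟨p, hdeg, hp⟩ := exists_steiner_polynomial (volume : Measure (E n)) hK hKc hne
  have hp' := fun t (ht : 0 < t) => hp t ht.le
  have hc := coeff_steiner_polynomial volume hK hne hdeg hp'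
  rw [finrank_euclideanSpace_fin] at hdeg hc
  have hex := exists_isSteinerCoefficients hdeg hp'
  rw [intrinsicVolume, dif_pos hex, hex.choose_spec.eq hp' hn, hc]

end IntrinsicVolume

/-! ### Blaschke's rolling theorem. -/

section Rolling

variable {V : Type*} [NormedAddCommGroup V] [InnerProductSpace ℝ V]

theorem norm_smul_add_smul_sq {e w : V} (he : ‖e‖ = 1) (hw : ‖w‖ = 1) (hew : inner ℝ e w = 0)
    (a b : ℝ) : ‖a • e + b • w‖ ^ 2 = a ^ 2 + b ^ 2 := by
  rw [norm_add_sq_real, norm_smul, norm_smul, he, hw, real_inner_smul_left, real_inner_smul_right,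
    hew, Real.norm_eq_abs, Real.norm_eq_abs, mul_one, mul_one, sq_abs, sq_abs]
  ring

/-- A circular arc of radius greater than `r` cannot touch from inside the boundary of a set that is
locally supported by a ball of radius `r`. -/
theorem not_circle_subset_of_ball_support {K : Set V} {m e w : V} (he : ‖e‖ = 1) (hw : ‖w‖ = 1)
    (hew : inner ℝ e w = 0) {r h a₁ b₁ k₁ : ℝ} (hρ : r ^ 2 < h ^ 2 + k₁ ^ 2)
    (hb₁ : 0 < b₁)
    (hcirc : a₁ ^ 2 + b₁ ^ 2 + 2 * b₁ * k₁ = h ^ 2)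
    (hmemK : ∀ a b : ℝ, 0 < b → a ^ 2 + b ^ 2 + 2 * b * k₁ = h ^ 2 → m + a • e + b • w ∈ K)
    {U : Set V} (hU : U ∈ 𝓝 (m + a₁ • e + b₁ • w)) {c : V}
    (hc : m + a₁ • e + b₁ • w ∈ Metric.sphere c r) (hUc : U ∩ K ⊆ Metric.closedBall c r) :
    False := by
  -- In the coordinates `(a, b)` the circle has centre `(0, -k₁)` and squared radius `h² + k₁²`; `(A
  -- δ, B δ)` is `(a₁, b₁)` rotated by `δ` about this centre.
  obtain ⟨A, hA⟩ : ∃ A : ℝ → ℝ, A = fun δ => Real.cos δ * a₁ - Real.sin δ * (b₁ + k₁) := ⟨_, rfl⟩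
  obtain ⟨B, hB⟩ : ∃ B : ℝ → ℝ, B = fun δ => Real.cos δ * (b₁ + k₁) + Real.sin δ * a₁ - k₁ :=
    ⟨_, rfl⟩
  have hAB : ∀ δ, A δ ^ 2 + B δ ^ 2 + 2 * B δ * k₁ = h ^ 2 := by
    intro δ
    have := Real.sin_sq_add_cos_sq δ
    have e1 : A δ ^ 2 + B δ ^ 2 + 2 * B δ * k₁ =
      (Real.sin δ ^ 2 + Real.cos δ ^ 2) * (a₁ ^ 2 + (b₁ + k₁) ^ 2) - k₁ ^ 2 := by
      simp only [hA, hB]; ring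
    rw [e1, this]; linarith
  have hAc : Continuous A := by rw [hA]; fun_prop
  have hBc : Continuous B := by rw [hB]; fun_prop
  have hA0 : A 0 = a₁ := by simp [hA]
  have hB0 : B 0 = b₁ := by simp [hB]
  have hev : ∀ᶠ δ in 𝓝 (0 : ℝ), 0 < B δ ∧ m + A δ • e + B δ • w ∈ U := by
    refine Filter.Eventually.and ?_ ?_
    · exact hBc.continuousAt.eventually_const_lt (by rwa [hB0])
    · have : Continuous fun δ => m + A δ • e + B δ • w := by fun_prop
      exact this.continuousAt.eventually_mem (by rwa [hA0, hB0])
  have hneg : Filter.Tendsto (fun δ : ℝ => -δ) (𝓝 0) (𝓝 0) := by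
    simpa using (continuous_neg.tendsto (0 : ℝ))
  obtain ⟨δ, ⟨hd1, hd2⟩, hδ0, hδ1⟩ := (((hev.and (hneg.eventually hev)).filter_mono
    nhdsWithin_le_nhds).and (Ioo_mem_nhdsGT (zero_lt_one' ℝ))).exists
  have hball : ∀ δ, 0 < B δ ∧ m + A δ • e + B δ • w ∈ U → ‖m + A δ • e + B δ • w - c‖ ^ 2 ≤ r ^ 2 := by
    rintro δ ⟨hδ, hδU⟩
    have := hUc ⟨hδU, hmemK _ _ hδ (hAB δ)⟩
    rw [mem_closedBall_iff_norm] at this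
    exact pow_le_pow_left₀ (norm_nonneg _) this 2
  have f1 := hball _ hd1
  have f2 := hball _ hd2
  have f3 : ‖m + a₁ • e + b₁ • w - c‖ ^ 2 = r ^ 2 := by
    rw [mem_sphere_iff_norm] at hc; rw [hc]
  obtain ⟨Q, hQ⟩ : ∃ Q, Q = m - k₁ • w - c := ⟨_, rfl⟩
  have hdec : ∀ a b : ℝ, a ^ 2 + b ^ 2 + 2 * b * k₁ = h ^ 2 → ‖m + a • e + b • w - c‖ ^ 2 =
      ‖Q‖ ^ 2 + 2 * (a * inner ℝ Q e + (b + k₁) * inner ℝ Q w) + (h ^ 2 + k₁ ^ 2) := by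
    intro a b hab
    have : m + a • e + b • w - c = Q + (a • e + (b + k₁) • w) := by rw [hQ]; module
    rw [this, norm_add_sq_real, norm_smul_add_smul_sq he hw hew, inner_add_right,
      real_inner_smul_right, real_inner_smul_right, ← hab]
    ring
  rw [hdec _ _ (hAB _)] at f1 f2
  rw [hdec _ _ hcirc] at f3
  have hcos : Real.cos δ < 1 := by
    rw [← Real.cos_zero]
    exact Real.cos_lt_cos_of_nonneg_of_le_pi le_rfl (by linarith [Real.pi_gt_three]) hδ0
  have hAs : A (-δ) = 2 * Real.cos δ * a₁ - A δ := by simp only [hA, Real.cos_neg, Real.sin_neg]; ring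
  have hBs : B (-δ) = 2 * Real.cos δ * (b₁ + k₁) - 2 * k₁ - B δ := by
    simp only [hB, Real.cos_neg, Real.sin_neg]; ring
  rw [hAs, hBs] at f2
  -- The average of the inequalities at `δ` and `-δ` is compared with the equality at angle `0`. The
  -- linear term is then nonnegative, so the equality gives `r² ≥ h² + k₁²`, a contradiction.
  have key : 0 ≤ (1 - Real.cos δ) * (a₁ * inner ℝ Q e + (b₁ + k₁) * inner ℝ Q w) := by linarith
  have hip := nonneg_of_mul_nonneg_right key (by linarith)
  have := sq_nonneg ‖Q‖
  linarith

/-- A circular arc of radius greater than `r` over a chord in the interior of `K` stays in the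
interior of `K`. -/
theorem arc_mem_interior {K : Set V} (hK : IsClosed K) (hKc : Convex ℝ K) {r : ℝ}
    (hloc : ∀ p ∈ frontier K, ∃ U ∈ 𝓝 p, ∃ c : V,
      p ∈ Metric.sphere c r ∧ U ∩ K ⊆ Metric.closedBall c r)
    {m e w : V} (he : ‖e‖ = 1) (hw : ‖w‖ = 1) (hew : inner ℝ e w = 0) {h k : ℝ} (hh : 0 < h)
    (hr : 0 < r) (hk : r < h ∨ (0 ≤ k ∧ r ^ 2 < h ^ 2 + k ^ 2))
    (h1 : m - h • e ∈ interior K) (h2 : m + h • e ∈ interior K) {a b : ℝ} (hb : 0 ≤ b)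
    (hab : a ^ 2 + b ^ 2 + 2 * b * k ≤ h ^ 2) : m + a • e + b • w ∈ interior K := by
  by_contra hbad
  set z : ℝ × ℝ → V := fun p => m + p.1 • e + p.2 • w with hz
  have hzc : Continuous z := by fun_prop
  set Bad : Set (ℝ × ℝ) :=
    {p | 0 ≤ p.2 ∧ p.1 ^ 2 + p.2 ^ 2 + 2 * p.2 * k ≤ h ^ 2 ∧ z p ∉ interior K} with hBad
  have hchord : ∀ a : ℝ, a ^ 2 ≤ h ^ 2 → m + a • e ∈ interior K := by
    intro a ha
    obtain ⟨ha1, ha2⟩ := abs_le.1 (abs_le_of_sq_le_sq ha hh.le)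
    have := hKc.interior h1 h2 (a := (h - a) / (2 * h)) (b := (h + a) / (2 * h))
      (div_nonneg (by linarith) (by linarith)) (div_nonneg (by linarith) (by linarith))
      (by field_simp; ring)
    convert this using 1
    have e1 : (h - a) / (2 * h) = 1 - (h + a) / (2 * h) := by field_simp; ring
    have e2 : a = 2 * ((h + a) / (2 * h)) * h - h := by field_simp; ring
    rw [e1]
    conv_lhs => rw [e2]
    module
  have hpos : ∀ p ∈ Bad, 0 < p.2 := by
    rintro ⟨a, b⟩ ⟨hb0, hle, hnot⟩
    refine lt_of_le_of_ne hb0 fun h0 => hnot ?_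
    simp only at h0 hle
    subst h0
    simp only [hz, zero_smul, add_zero]
    exact hchord a (by nlinarith)
  have hBc : IsCompact Bad := by
    refine Metric.isCompact_of_isClosed_isBounded ?_ ?_
    · have c1 : IsClosed {p : ℝ × ℝ | 0 ≤ p.2} := isClosed_le (by fun_prop) (by fun_prop)
      have c2 : IsClosed {p : ℝ × ℝ | p.1 ^ 2 + p.2 ^ 2 + 2 * p.2 * k ≤ h ^ 2} :=
        isClosed_le (by fun_prop) (by fun_prop)
      exact c1.inter (c2.inter (isOpen_interior.preimage hzc).isClosed_compl)
    · refine (Metric.isBounded_closedBall (x := (0 : ℝ × ℝ)) (r := 2 * h + 2 * |k|)).subset ?_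
      rintro ⟨a, b⟩ ⟨hb0, hle, -⟩
      simp only at hb0 hle
      have hs : a ^ 2 + (b + k) ^ 2 ≤ (h + |k|) ^ 2 := by
        nlinarith [sq_abs k, abs_nonneg k, mul_nonneg hh.le (abs_nonneg k)]
      have ha := abs_le_of_sq_le_sq (a := a) (b := h + |k|) (by nlinarith) (by positivity)
      have hb := abs_le_of_sq_le_sq (a := b + k) (b := h + |k|) (by nlinarith) (by positivity)
      have hk1 := neg_abs_le k
      have hk2 := le_abs_self k
      have hk0 := abs_nonneg k
      rw [abs_le] at ha hb
      rw [mem_closedBall_zero_iff, Prod.norm_def, Real.norm_eq_abs, Real.norm_eq_abs]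
      refine max_le (abs_le.2 ⟨by linarith, by linarith⟩) (abs_le.2 ⟨by linarith, by linarith⟩)
  -- `(h² - a² - b²) / b` is `2k` for the circle of the pencil through both ends of the chord and
  -- `(a, b)`. Its maximiser lies on the first arc, sweeping up from the chord, that meets the
  -- complement of `interior K`.
  obtain ⟨⟨a₁, b₁⟩, hmem, hmax⟩ := hBc.exists_isMaxOn (f := fun p : ℝ × ℝ =>
    (h ^ 2 - p.1 ^ 2 - p.2 ^ 2) / p.2) ⟨(a, b), hb, hab, hbad⟩
    (ContinuousOn.div (by fun_prop) (by fun_prop) fun p hp => (hpos p hp).ne')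
  have hb₁ : 0 < b₁ := hpos _ hmem
  obtain ⟨-, hle₁, hnot₁⟩ := hmem
  simp only at hle₁
  set k₁ := (h ^ 2 - a₁ ^ 2 - b₁ ^ 2) / b₁ / 2 with hk₁
  have hcirc : a₁ ^ 2 + b₁ ^ 2 + 2 * b₁ * k₁ = h ^ 2 := by rw [hk₁]; field_simp; ring
  have hkk : k ≤ k₁ := by
    have : 0 ≤ 2 * b₁ * (k₁ - k) := by linarith
    by_contra hlt
    push Not at hlt
    nlinarith
  have hρ : r ^ 2 < h ^ 2 + k₁ ^ 2 := by
    rcases hk with hk | ⟨hk0, hk⟩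
    · nlinarith [sq_nonneg k₁]
    · nlinarith
  have hmemK : ∀ a b : ℝ, 0 < b → a ^ 2 + b ^ 2 + 2 * b * k₁ ≤ h ^ 2 → z (a, b) ∈ K := by
    intro a b hb hle
    -- Shrinking towards the midpoint of the chord moves a point strictly below the arc `k₁`, where
    -- maximality excludes bad points. Closedness then puts the arc itself in `K`.
    have hin : ∀ t : ℝ, 0 < t → t < 1 → z (t * a, t * b) ∈ interior K := by
      intro t ht ht1
      by_contra hn
      have hS : 0 ≤ a ^ 2 + b ^ 2 := by positivity
      have hlt : (t * a) ^ 2 + (t * b) ^ 2 + 2 * (t * b) * k₁ < h ^ 2 := by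
        have e1 : (t * a) ^ 2 + (t * b) ^ 2 + 2 * (t * b) * k₁ =
          t * (a ^ 2 + b ^ 2 + 2 * b * k₁) - t * (1 - t) * (a ^ 2 + b ^ 2) := by ring
        have e2 : 0 ≤ t * (1 - t) * (a ^ 2 + b ^ 2) :=
          mul_nonneg (mul_nonneg ht.le (by linarith)) hS
        have e3 := mul_le_mul_of_nonneg_left hle ht.le
        have e4 : t * h ^ 2 < 1 * h ^ 2 := mul_lt_mul_of_pos_right ht1 (by positivity)
        linarith
      have htb : 0 < t * b := mul_pos ht hb
      have hbad' : (t * a, t * b) ∈ Bad :=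
        ⟨htb.le, by simp only; nlinarith [mul_le_mul_of_nonneg_left hkk htb.le], hn⟩
      have := hmax hbad'
      simp only [Set.mem_ofPred_eq] at this
      rw [div_le_iff₀ htb, show (h ^ 2 - a₁ ^ 2 - b₁ ^ 2) / b₁ = 2 * k₁ by rw [hk₁]; ring] at this
      linarith
    have hlim : Filter.Tendsto (fun t : ℝ => z (t * a, t * b)) (𝓝[<] 1) (𝓝 (z (1 * a, 1 * b))) := by
      refine Filter.Tendsto.mono_left ?_ nhdsWithin_le_nhds
      exact (hzc.comp (by fun_prop : Continuous fun t : ℝ => (t * a, t * b))).tendsto 1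
    rw [one_mul, one_mul] at hlim
    refine hK.mem_of_tendsto hlim ?_
    filter_upwards [Ioo_mem_nhdsLT (zero_lt_one' ℝ)] with t ht
    exact interior_subset (hin t ht.1 ht.2)
  have hz₁ : z (a₁, b₁) ∈ frontier K := by
    rw [hK.frontier_eq]
    exact ⟨hmemK a₁ b₁ hb₁ hcirc.le, hnot₁⟩
  obtain ⟨U, hU, c, hc, hUc⟩ := hloc _ hz₁
  exact not_circle_subset_of_ball_support he hw hew hρ hb₁ hcirc
    (fun a b hb hle => hmemK a b hb hle.le) hU hc hUc

/-- The chord is contracted towards an interior point, `arc_mem_interior` applies to the contracted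
chord, and the contraction tends to the identity. The strict inequality in `hab` leaves room for the
shorter half-chord `(1 - t) * h`. -/
theorem arc_mem {K : Set V} (hK : IsClosed K) (hKc : Convex ℝ K) (hKi : (interior K).Nonempty)
    {r : ℝ} (hloc : ∀ p ∈ frontier K, ∃ U ∈ 𝓝 p, ∃ c : V,
      p ∈ Metric.sphere c r ∧ U ∩ K ⊆ Metric.closedBall c r)
    {m e w : V} (he : ‖e‖ = 1) (hw : ‖w‖ = 1) (hew : inner ℝ e w = 0) {h k : ℝ} (hh : 0 < h)
    (hr : 0 < r) (hk : r < h ∨ (0 ≤ k ∧ r ^ 2 < h ^ 2 + k ^ 2))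
    (h1 : m - h • e ∈ K) (h2 : m + h • e ∈ K) {a b : ℝ} (hb : 0 ≤ b)
    (hab : a ^ 2 + b ^ 2 + 2 * b * k < h ^ 2) : m + a • e + b • w ∈ K := by
  obtain ⟨z₀, hz₀⟩ := hKi
  have hcont : Continuous fun t : ℝ => (1 - t) * h := by fun_prop
  have hc0 : (fun t : ℝ => (1 - t) * h) 0 = h := by simp
  have hev1 : ∀ᶠ t in 𝓝 (0 : ℝ), r < (1 - t) * h ∨ (0 ≤ k ∧ r ^ 2 < ((1 - t) * h) ^ 2 + k ^ 2) := by
    rcases hk with hk | ⟨hk0, hk⟩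
    · exact (hcont.continuousAt.eventually_const_lt (by simpa using hk)).mono fun t ht => Or.inl ht
    · have : Continuous fun t : ℝ => ((1 - t) * h) ^ 2 + k ^ 2 := by fun_prop
      exact (this.continuousAt.eventually_const_lt (by simpa using hk)).mono
        fun t ht => Or.inr ⟨hk0, ht⟩
  have hev2 : ∀ᶠ t in 𝓝 (0 : ℝ), a ^ 2 + b ^ 2 + 2 * b * k < ((1 - t) * h) ^ 2 := by
    have : Continuous fun t : ℝ => ((1 - t) * h) ^ 2 := by fun_prop
    exact this.continuousAt.eventually_const_lt (by simpa using hab)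
  have hlim : Filter.Tendsto (fun t : ℝ => ((1 - t) • m + t • z₀) + a • e + b • w) (𝓝[>] 0)
      (𝓝 (m + a • e + b • w)) := by
    refine Filter.Tendsto.mono_left ?_ nhdsWithin_le_nhds
    have : Continuous fun t : ℝ => ((1 - t) • m + t • z₀) + a • e + b • w := by fun_prop
    simpa using this.tendsto 0
  refine hK.mem_of_tendsto hlim ?_
  filter_upwards [nhdsWithin_le_nhds hev1, nhdsWithin_le_nhds hev2,
    Ioo_mem_nhdsGT (zero_lt_one' ℝ)] with t ht1 ht2 ht
  have hint : ∀ x ∈ K, (1 - t) • x + t • z₀ ∈ interior K := fun x hx => by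
    have := hKc.combo_self_interior_mem_interior hx hz₀ (a := 1 - t) (b := t)
      (by linarith [ht.2]) ht.1 (by ring)
    exact this
  refine interior_subset (arc_mem_interior hK hKc hloc he hw hew (h := (1 - t) * h)
    (mul_pos (by linarith [ht.2]) hh) hr ht1 ?_ ?_ hb ht2.le)
  · convert hint _ h1 using 1; module
  · convert hint _ h2 using 1; module

theorem exists_unit_orthogonal [FiniteDimensional ℝ V] (hdim : 2 ≤ Module.finrank ℝ V) (e : V) :
    ∃ w : V, ‖w‖ = 1 ∧ inner ℝ e w = 0 := by
  have h1 : 0 < Module.finrank ℝ (ℝ ∙ e)ᗮ := by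
    have h2 := Submodule.finrank_add_finrank_orthogonal (ℝ ∙ e)
    have h3 : Module.finrank ℝ (ℝ ∙ e) ≤ 1 := by
      simpa using finrank_span_le_card (R := ℝ) ({e} : Set V)
    omega
  have := Module.nontrivial_of_finrank_pos h1
  obtain ⟨w, hw⟩ := exists_norm_eq (ℝ ∙ e)ᗮ zero_le_one
  exact ⟨w, by simpa using hw, Submodule.mem_orthogonal_singleton_iff_inner_right.1 w.2⟩

/-- **Blaschke's rolling theorem**: a convex body that is locally supported by balls of radius `r`
is globally supported by such balls. -/
theorem subset_closedBall_of_support [FiniteDimensional ℝ V] (hdim : 2 ≤ Module.finrank ℝ V)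
    {K : Set V} (hK : IsCompact K) (hKc : Convex ℝ K) (hKi : (interior K).Nonempty) {r : ℝ}
    (hr : 0 < r) (hloc : ∀ p ∈ frontier K, ∃ U ∈ 𝓝 p, ∃ c : V,
      p ∈ Metric.sphere c r ∧ U ∩ K ⊆ Metric.closedBall c r)
    {p u : V} (hp : p ∈ K) (hu : ‖u‖ = 1) (hsup : ∀ x ∈ K, inner ℝ u x ≤ inner ℝ u p) :
    K ⊆ Metric.closedBall (p - r • u) r := by
  intro x hx
  rcases eq_or_ne x p with rfl | hxp
  · rw [mem_closedBall_iff_norm, sub_sub_cancel, norm_smul, hu, mul_one, Real.norm_of_nonneg hr.le]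
  have hD : 0 < ‖x - p‖ := norm_pos_iff.2 (sub_ne_zero.2 hxp)
  set h := ‖x - p‖ / 2 with hh
  have hh0 : 0 < h := by positivity
  set e := ‖x - p‖⁻¹ • (x - p) with he
  have he1 : ‖e‖ = 1 := by rw [he, norm_smul, norm_inv, norm_norm, inv_mul_cancel₀ hD.ne']
  have hxe : x - p = (2 * h) • e := by
    rw [he, smul_smul, hh, mul_div_cancel₀ _ two_ne_zero, mul_inv_cancel₀ hD.ne', one_smul]
  clear_value h e
  set m := p + h • e with hm
  have hm1 : m - h • e ∈ K := by rw [hm, add_sub_cancel_right]; exact hp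
  have hm2 : m + h • e ∈ K := by
    have : m + h • e = x := by rw [hm, ← sub_add_cancel x p, hxe]; module
    rw [this]; exact hx
  -- For a chord longer than `2 * r`, every circle through its ends has radius greater than `r`.
  -- Letting `k → -∞` would put points arbitrarily far from the chord into `K`.
  have hhr : h ≤ r := by
    by_contra hlt
    push Not at hlt
    obtain ⟨w, hw, hew⟩ := exists_unit_orthogonal hdim e
    obtain ⟨M, hM⟩ := hK.isBounded.exists_norm_le
    have hM0 : 0 ≤ M := (norm_nonneg _).trans (hM p hp)
    set N := ‖m‖ + M + 1 with hN
    have hN0 : 0 ≤ N := by positivity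
    have := hM _ (arc_mem hK.isClosed hKc hKi hloc he1 hw hew (k := -N) hh0 hr (Or.inl hlt) hm1 hm2
      (a := 0) (b := N) hN0 (by nlinarith))
    have h3 : ‖N • w‖ = N := by rw [norm_smul, hw, mul_one, Real.norm_of_nonneg hN0]
    have h4 : ‖N • w‖ ≤ ‖m + (0 : ℝ) • e + N • w‖ + ‖m‖ := by
      have := norm_sub_le (m + (0 : ℝ) • e + N • w) m
      rw [zero_smul, add_zero, add_sub_cancel_left] at this
      rwa [zero_smul, add_zero]
    linarith
  set q := -inner ℝ u e with hq
  have hq0 : 0 ≤ q := by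
    have h1 := hsup x hx
    have h2 : inner ℝ u (x - p) = 2 * h * inner ℝ u e := by rw [hxe, real_inner_smul_right]
    rw [inner_sub_right] at h2
    by_contra hlt
    push Not at hlt
    nlinarith
  have hq1 : q ≤ 1 := by
    have := (abs_le.1 (abs_real_inner_le_norm u e)).1
    rw [hu, he1] at this; linarith
  -- This is equivalent to the goal, as `‖x - (p - r • u)‖² = r² + 4 * h * (h - q * r)`. If it
  -- fails, an arc of radius slightly above `r` from `p` to `x` leaves `p` across the supporting
  -- hyperplane.
  have hgoal : h ≤ q * r := by
    by_contra hlt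
    push Not at hlt
    have hq1' : q < 1 := lt_of_le_of_ne hq1 fun h1 => by rw [h1] at hlt; linarith
    have hs0 : 0 < 1 - q ^ 2 := by nlinarith
    set σ := √(1 - q ^ 2) with hσ
    have hσ0 : 0 < σ := Real.sqrt_pos.2 hs0
    have hσ2 : σ ^ 2 = 1 - q ^ 2 := Real.sq_sqrt hs0.le
    set w := σ⁻¹ • (u + q • e) with hw
    have huw : u = (-q) • e + σ • w := by
      rw [hw, smul_smul, mul_inv_cancel₀ hσ0.ne', one_smul]; module
    have hue : inner ℝ u e = -q := by rw [hq, neg_neg]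
    have hew : inner ℝ e w = 0 := by
      rw [hw, real_inner_smul_right, inner_add_right, real_inner_smul_right,
        real_inner_self_eq_norm_sq, he1, real_inner_comm, hue]
      ring
    have hwn : ‖w‖ = 1 := by
      have h1 : ‖u + q • e‖ ^ 2 = σ ^ 2 := by
        rw [norm_add_sq_real, norm_smul, real_inner_smul_right, hue, hu, he1, hσ2,
          Real.norm_of_nonneg hq0]
        ring
      have h2 : ‖u + q • e‖ = σ := (sq_eq_sq₀ (norm_nonneg _) hσ0.le).1 h1
      rw [hw, norm_smul, norm_inv, Real.norm_of_nonneg hσ0.le, h2, inv_mul_cancel₀ hσ0.ne']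
    clear_value w
    have hqr : q ^ 2 * r ^ 2 < h ^ 2 := by
      rw [← mul_pow]; exact pow_lt_pow_left₀ hlt (by positivity) two_ne_zero
    set ε := (h ^ 2 - q ^ 2 * r ^ 2) / 2 with hε
    have hε0 : 0 < ε := by rw [hε]; linarith
    have hk2 : 0 < r ^ 2 - h ^ 2 + ε := by nlinarith
    set k := √(r ^ 2 - h ^ 2 + ε) with hk
    have hk0 : 0 < k := Real.sqrt_pos.2 hk2
    have hkk : k ^ 2 = r ^ 2 - h ^ 2 + ε := Real.sq_sqrt hk2.le
    have hqk : q * k < σ * h := by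
      refine lt_of_pow_lt_pow_left₀ 2 (by positivity) ?_
      rw [mul_pow, mul_pow, hσ2, hkk]
      have : q ^ 2 * ε ≤ ε := by nlinarith
      nlinarith
    -- In the basis `e, w` the arc leaves `p` with slope `h / k`, and the supporting hyperplane has
    -- slope `q / σ`. A slope `β` strictly between them points below the arc but beyond the
    -- hyperplane.
    have hlt2 : q / σ < h / k := by rw [div_lt_div_iff₀ hσ0 hk0]; linarith
    obtain ⟨β, hβ1, hβ2⟩ := exists_between hlt2
    have hβ0 : 0 ≤ β := (div_nonneg hq0 hσ0.le).trans hβ1.le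
    rw [div_lt_iff₀ hσ0] at hβ1
    rw [lt_div_iff₀ hk0] at hβ2
    -- The ray of slope `β` from `p` meets the circle again at parameter `2 * s`; halving it gives a
    -- point strictly inside.
    set s := (h - β * k) / (1 + β ^ 2) with hs
    have hs0 : 0 < s := div_pos (by linarith) (by positivity)
    have hs1 : s * (1 + β ^ 2) = h - β * k := div_mul_cancel₀ _ (by positivity)
    have hP := arc_mem hK.isClosed hKc hKi hloc he1 hwn hew (k := k) hh0 hr
      (Or.inr ⟨hk0.le, by rw [hkk]; linarith⟩) hm1 hm2 (a := -h + s) (b := s * β)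
      (by positivity) (by nlinarith [mul_pos hs0 (by linarith : 0 < h - β * k)])
    have h5 := hsup _ hP
    have h6 : m + (-h + s) • e + (s * β) • w = p + (s • e + (s * β) • w) := by rw [hm]; module
    have huw' : inner ℝ u w = σ := by
      rw [huw, inner_add_left, real_inner_smul_left, real_inner_smul_left, hew,
        real_inner_self_eq_norm_sq, hwn]; ring
    rw [h6, inner_add_right, inner_add_right, real_inner_smul_right, real_inner_smul_right, hue,
      huw'] at h5
    have : 0 < s * (β * σ - q) := mul_pos hs0 (by linarith)
    linarith
  rw [mem_closedBall_iff_norm, ← sq_le_sq₀ (norm_nonneg _) hr.le]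
  have h7 : x - (p - r • u) = (2 * h) • e + r • u := by rw [← hxe]; module
  rw [h7, norm_add_sq_real, norm_smul, norm_smul, real_inner_smul_left, real_inner_smul_right,
    real_inner_comm, hu, he1, Real.norm_of_nonneg hr.le, Real.norm_of_nonneg (by positivity)]
  have : inner ℝ u e = -q := by rw [hq, neg_neg]
  rw [this]
  nlinarith

end Rolling

/-! ### The smallest enclosing ball and its contact points. -/

section Circumball

theorem circumradius_le {n : ℕ} {K : Set (E n)} {r : ℝ} {c : E n} (hr : 0 ≤ r)
    (h : K ⊆ Metric.closedBall c r) : circumradius K ≤ r :=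
  csInf_le ⟨0, fun _ hs => hs.1⟩ ⟨hr, c, h⟩

theorem circumradius_nonneg {n : ℕ} (K : Set (E n)) : 0 ≤ circumradius K :=
  Real.sInf_nonneg fun _ hs => hs.1

theorem exists_circumcenter {n : ℕ} {K : Set (E n)} (hK : IsCompact K) (hne : K.Nonempty) :
    ∃ o : E n, K ⊆ Metric.closedBall o (circumradius K) := by
  obtain ⟨x₀, hx₀⟩ := hne
  obtain ⟨R, hR⟩ := hK.isBounded.subset_closedBall x₀
  have hR0 : 0 ≤ R := by
    have := hR hx₀
    rwa [Metric.mem_closedBall, dist_self] at this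
  set T : Set (ℝ × E n) := (Set.Icc 0 R ×ˢ Metric.closedBall x₀ R) ∩
    ⋂ x ∈ K, {p | dist x p.2 ≤ p.1} with hT
  have hTc : IsCompact T := (isCompact_Icc.prod (isCompact_closedBall _ _)).inter_right
    (isClosed_biInter fun x _ => isClosed_le (by fun_prop) (by fun_prop))
  have hTne : T.Nonempty := ⟨(R, x₀), ⟨⟨hR0, le_rfl⟩, by simpa using hR0⟩,
    Set.mem_iInter₂.2 fun x hx => hR hx⟩
  obtain ⟨⟨r, o⟩, ⟨⟨⟨hr0, hrR⟩, -⟩, ho⟩, hmin⟩ := hTc.exists_isMinOn hTne continuous_fst.continuousOn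
  have hoK : K ⊆ Metric.closedBall o r := fun x hx => Set.mem_iInter₂.1 ho x hx
  refine ⟨o, hoK.trans (Metric.closedBall_subset_closedBall ?_)⟩
  refine le_csInf ⟨r, hr0, o, hoK⟩ ?_
  rintro s ⟨hs0, c, hc⟩
  rcases le_total s R with hs | hs
  · refine hmin (a := (s, c)) ⟨⟨⟨hs0, hs⟩, ?_⟩, Set.mem_iInter₂.2 fun x hx => hc hx⟩
    have := hc hx₀
    rw [Metric.mem_closedBall, dist_comm] at this
    exact this.trans hs
  · exact hrR.trans hs

/-- In finite dimension the convex hull of a compact set is compact. -/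
theorem isCompact_convexHull_of_isCompact {V : Type*} [NormedAddCommGroup V] [NormedSpace ℝ V]
    [FiniteDimensional ℝ V] {T : Set V} (hT : IsCompact T) : IsCompact (convexHull ℝ T) := by
  set N := Module.finrank ℝ V + 1 with hN
  -- By Carathéodory a fixed number `N` of points suffices, unused places being filled with weight
  -- zero; the hull is thus a continuous image of a compact set.
  have himage : convexHull ℝ T = (fun p : (Fin N → ℝ) × (Fin N → V) => ∑ i, p.1 i • p.2 i) ''
      (stdSimplex ℝ (Fin N) ×ˢ Set.univ.pi fun _ => T) := by
    apply Set.Subset.antisymm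
    · intro x hx
      obtain ⟨ι, _, z, w, hz, hzi, hw, hw1, hwz⟩ := eq_pos_convex_span_of_mem_convexHull hx
      have hcard : Fintype.card ι ≤ Fintype.card (Fin N) := by
        rw [Fintype.card_fin]; exact hzi.card_le_finrank_succ.trans (by
          have := Submodule.finrank_le (vectorSpan ℝ (Set.range z))
          omega)
      obtain ⟨f⟩ := Function.Embedding.nonempty_of_card_le hcard
      obtain ⟨t₀, ht₀⟩ : T.Nonempty := convexHull_nonempty_iff.1 ⟨x, hx⟩
      refine ⟨(Function.extend f w 0, Function.extend f z fun _ => t₀), ⟨⟨fun j => ?_, ?_⟩, ?_⟩, ?_⟩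
      · by_cases hj : ∃ i, f i = j
        · obtain ⟨i, rfl⟩ := hj
          simp only [f.injective.extend_apply]; exact (hw i).le
        · simp [Function.extend_apply' _ _ _ hj]
      · rw [← hw1]
        refine (Fintype.sum_of_injective f f.injective _ _ (fun j hj => ?_) fun i => ?_).symm
        · exact Function.extend_apply' _ _ _ hj
        · exact (f.injective.extend_apply _ _ _).symm
      · intro j _
        by_cases hj : ∃ i, f i = j
        · obtain ⟨i, rfl⟩ := hj
          simp only [f.injective.extend_apply]; exact hz ⟨i, rfl⟩
        · simpa [Function.extend_apply' _ _ _ hj] using ht₀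
      · simp only
        rw [← hwz]
        refine (Fintype.sum_of_injective f f.injective _ _ (fun j hj => ?_) fun i => ?_).symm
        · rw [Function.extend_apply' _ _ _ hj, Pi.zero_apply, zero_smul]
        · rw [f.injective.extend_apply, f.injective.extend_apply]
    · rintro _ ⟨⟨w, z⟩, ⟨⟨hw0, hw1⟩, hz⟩, rfl⟩
      exact (convex_convexHull ℝ T).sum_mem (fun i _ => hw0 i) hw1
        fun i _ => subset_convexHull ℝ T (hz i trivial)
  rw [himage]
  exact ((isCompact_stdSimplex ℝ (Fin N)).prod (isCompact_univ_pi fun _ => hT)).image (by fun_prop)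

/-- The centre of the smallest enclosing ball is in the convex hull of the contact points. -/
theorem mem_convexHull_of_circumcenter {n : ℕ} {K : Set (E n)} (hK : IsCompact K)
    (hne : K.Nonempty) {o : E n} (ho : K ⊆ Metric.closedBall o (circumradius K)) :
    o ∈ convexHull ℝ (K ∩ Metric.sphere o (circumradius K)) := by
  by_contra hnot
  set R := circumradius K with hR
  have hTc : IsCompact (K ∩ Metric.sphere o R) := hK.inter_right Metric.isClosed_sphere
  obtain ⟨f, s, hs1, hs2⟩ := geometric_hahn_banach_point_closed (convex_convexHull ℝ _)
    (isCompact_convexHull_of_isCompact hTc).isClosed hnot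
  set v := (InnerProductSpace.toDual ℝ (E n)).symm f with hv
  have hfv : ∀ y, f y = inner ℝ v y := fun y => by
    rw [hv, InnerProductSpace.toDual_symm_apply]
  set ε := s - f o with hε
  have hε0 : 0 < ε := sub_pos.2 hs1
  set K' := K ∩ {x | inner ℝ v (x - o) ≤ ε} with hK'
  have hK'c : IsCompact K' := hK.inter_right (isClosed_le (by fun_prop) (by fun_prop))
  have hlt : ∀ x ∈ K', ‖x - o‖ < R := by
    rintro x ⟨hx, hxv⟩
    refine lt_of_le_of_ne (mem_closedBall_iff_norm.1 (ho hx)) fun heq => ?_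
    have h1 := hs2 x (subset_convexHull ℝ _ ⟨hx, mem_sphere_iff_norm.2 heq⟩)
    rw [Set.mem_ofPred_eq, inner_sub_right, ← hfv, ← hfv, hε] at hxv
    linarith
  obtain ⟨δ, hδ0, hδ⟩ : ∃ δ : ℝ, 0 < δ ∧ ∀ x ∈ K', ‖x - o‖ ≤ R - δ := by
    rcases K'.eq_empty_or_nonempty with h0 | h0
    · exact ⟨1, one_pos, by simp [h0]⟩
    · obtain ⟨y, hy, hmax⟩ := hK'c.exists_isMaxOn h0
        (f := fun x => ‖x - o‖) (by fun_prop)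
      exact ⟨R - ‖y - o‖, sub_pos.2 (hlt y hy), fun x hx => by
        have : ‖x - o‖ ≤ ‖y - o‖ := hmax hx
        linarith⟩
  -- A shift of the centre by `η • v` puts `K` into a smaller ball: points on the near side have
  -- slack `δ`, more than `η * ‖v‖`, and points with `⟪v, x - o⟫ > ε` get closer.
  set η := min (δ / (2 * (‖v‖ + 1))) (ε / (‖v‖ ^ 2 + 1)) with hη
  have hv0 := norm_nonneg v
  have hη0 : 0 < η := lt_min (by positivity) (by positivity)
  have hη1 : η * (2 * (‖v‖ + 1)) ≤ δ := by
    rw [← le_div_iff₀ (by positivity)]; exact min_le_left _ _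
  have hη2 : η * (‖v‖ ^ 2 + 1) ≤ ε := by
    rw [← le_div_iff₀ (by positivity)]; exact min_le_right _ _
  have hall : ∀ x ∈ K, ‖x - (o + η • v)‖ < R := by
    intro x hx
    by_cases hxv : inner ℝ v (x - o) ≤ ε
    · have h1 := hδ x ⟨hx, hxv⟩
      have h2 : ‖x - (o + η • v)‖ ≤ ‖x - o‖ + η * ‖v‖ := by
        have := norm_sub_le (x - o) (η • v)
        rwa [norm_smul, Real.norm_of_nonneg hη0.le, sub_sub] at this
      nlinarith
    · push Not at hxv
      have h1 := mem_closedBall_iff_norm.1 (ho hx)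
      have h2 : ‖x - (o + η • v)‖ ^ 2 = ‖x - o‖ ^ 2 - 2 * (η * inner ℝ v (x - o)) + η ^ 2 * ‖v‖ ^ 2 := by
        rw [← sub_sub, norm_sub_sq_real, real_inner_smul_right, real_inner_comm, norm_smul,
          Real.norm_of_nonneg hη0.le]
        ring
      have h3 : ‖x - o‖ ^ 2 ≤ R ^ 2 := pow_le_pow_left₀ (norm_nonneg _) h1 2
      refine lt_of_pow_lt_pow_left₀ 2 (circumradius_nonneg K) ?_
      rw [h2]
      nlinarith [mul_lt_mul_of_pos_left hxv hη0, mul_le_mul_of_nonneg_left hη2 hη0.le]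
  obtain ⟨y, hy, hmax⟩ := hK.exists_isMaxOn hne (f := fun x => ‖x - (o + η • v)‖) (by fun_prop)
  have := circumradius_le (K := K) (c := o + η • v) (norm_nonneg (y - (o + η • v)))
    fun x hx => mem_closedBall_iff_norm.2 (hmax hx)
  exact absurd (hall y hy) (not_lt.2 this)

/-- The contact points of a body with its smallest enclosing ball carry a centred measure. -/
theorem exists_contact_weights {n : ℕ} {K : Set (E n)} (hK : IsCompact K) (hne : K.Nonempty)
    (hR : 0 < circumradius K) :
    ∃ (o : E n) (k : ℕ) (e : Fin k → E n) (w : Fin k → ℝ), Function.Injective e ∧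
      (∀ i, ‖e i‖ = 1) ∧ (∀ i, 0 < w i) ∧ ∑ i, w i = 1 ∧ ∑ i, w i • e i = 0 ∧
      ∀ i, o + circumradius K • e i ∈ K := by
  obtain ⟨o, ho⟩ := exists_circumcenter hK hne
  obtain ⟨ι, _, z, w, hz, hzi, hw, hw1, hwz⟩ :=
    eq_pos_convex_span_of_mem_convexHull (mem_convexHull_of_circumcenter hK hne ho)
  set R := circumradius K with hRdef
  have σ := (Fintype.equivFin ι).symm
  refine ⟨o, _, fun i => R⁻¹ • (z (σ i) - o), fun i => w (σ i), ?_, fun i => ?_, fun i => hw _, ?_,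
    ?_, fun i => ?_⟩
  · intro i j hij
    exact σ.injective (hzi.injective (sub_left_injective
      (smul_right_injective (E n) (inv_ne_zero hR.ne') hij)))
  · have := mem_sphere_iff_norm.1 (hz ⟨σ i, rfl⟩).2
    rw [norm_smul, this, norm_inv, Real.norm_of_nonneg hR.le, inv_mul_cancel₀ hR.ne']
  · rw [Equiv.sum_comp σ w, hw1]
  · rw [Equiv.sum_comp σ (fun i => w i • R⁻¹ • (z i - o))]
    simp only [smul_comm _ R⁻¹, ← Finset.smul_sum, smul_sub, Finset.sum_sub_distrib,
      ← Finset.sum_smul]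
    rw [hwz, hw1, one_smul, sub_self]
  · rw [smul_smul, mul_inv_cancel₀ hR.ne', one_smul, add_sub_cancel]
    exact (hz ⟨σ i, rfl⟩).1

end Circumball

/-! ### The support function of a spindle as a function of one variable. -/

section Profile

/-- The support function of a spindle with half-length `h` as a function of the cosine of the
angle between the direction and the axis. -/
noncomputable def profile (r h t : ℝ) : ℝ :=
  if h ≤ r * t then h * t else r - √(r ^ 2 - h ^ 2) * √(1 - t ^ 2)

/-- The two branches agree at `t = h / r`. Writing the function as a sum of terms in `max t (h / r)`
and `min t (h / r)` makes continuity and monotonicity visible without cases. -/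
theorem profile_eq_max_min {r h : ℝ} (hh : 0 < h) (hhr : h ≤ r) (t : ℝ) :
    profile r h t = h * max t (h / r) + (r - √(r ^ 2 - h ^ 2) * √(1 - min t (h / r) ^ 2) - h ^ 2 / r) := by
  have hr : 0 < r := hh.trans_le hhr
  have hd : 0 ≤ r ^ 2 - h ^ 2 := by nlinarith
  unfold profile
  split_ifs with h1
  · have h2 : h / r ≤ t := by rw [div_le_iff₀ hr]; linarith
    rw [max_eq_left h2, min_eq_right h2]
    have h3 : √(1 - (h / r) ^ 2) = √(r ^ 2 - h ^ 2) / r := by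
      rw [show 1 - (h / r) ^ 2 = (r ^ 2 - h ^ 2) / r ^ 2 by field_simp, Real.sqrt_div hd,
        Real.sqrt_sq hr.le]
    rw [h3, ← mul_div_assoc, Real.mul_self_sqrt hd]
    field_simp; ring
  · have h2 : t ≤ h / r := by rw [le_div_iff₀ hr]; linarith
    rw [max_eq_right h2, min_eq_left h2]
    ring

theorem profile_mono {r h : ℝ} (hh : 0 < h) (hhr : h ≤ r) {s t : ℝ} (hs : 0 ≤ s) (hst : s ≤ t) :
    profile r h s ≤ profile r h t := by
  have hr : 0 < r := hh.trans_le hhr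
  rw [profile_eq_max_min hh hhr s, profile_eq_max_min hh hhr t]
  have h1 : 0 ≤ min s (h / r) := le_min hs (by positivity)
  gcongr

theorem profile_le {r h : ℝ} (hh : 0 < h) (hhr : h ≤ r) {t : ℝ} (ht0 : 0 ≤ t) (ht : t ≤ 1) :
    profile r h t ≤ h := by
  refine (profile_mono hh hhr ht0 ht).trans ?_
  rw [profile, if_pos (by linarith), mul_one]

theorem continuous_profile {r h : ℝ} (hh : 0 < h) (hhr : h ≤ r) : Continuous (profile r h) := by
  rw [funext (profile_eq_max_min hh hhr)]
  fun_prop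

variable {V : Type*} [NormedAddCommGroup V] [InnerProductSpace ℝ V]

theorem inner_sub_smul_self {e : V} (he : ‖e‖ = 1) (u : V) :
    inner ℝ e (u - inner ℝ u e • e) = 0 := by
  rw [inner_sub_right, real_inner_smul_right, real_inner_self_eq_norm_sq, he, real_inner_comm]
  ring

theorem norm_sub_smul_self_sq {e u : V} (he : ‖e‖ = 1) (hu : ‖u‖ = 1) :
    ‖u - inner ℝ u e • e‖ ^ 2 = 1 - inner ℝ u e ^ 2 := by
  rw [norm_sub_sq_real, real_inner_smul_right, norm_smul, hu, he, mul_one, Real.norm_eq_abs, sq_abs]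
  ring

set_option maxHeartbeats 800000 in
/-- The bound on the centre of a supporting ball, with the cases of equality. -/
theorem neg_inner_le_sqrt_mul_sqrt {r h : ℝ} (hh : 0 < h) (hhr : h ≤ r) {c e u : V}
    (he : ‖e‖ = 1) (hu : ‖u‖ = 1) (hc : ‖c‖ ^ 2 ≤ r ^ 2 - h ^ 2) (hce : ‖h • e - c‖ ≤ r)
    (ht0 : 0 ≤ inner ℝ u e) (ht : r * inner ℝ u e < h) :
    -inner ℝ u c ≤ √(r ^ 2 - h ^ 2) * √(1 - inner ℝ u e ^ 2) ∧
    (-inner ℝ u c = √(r ^ 2 - h ^ 2) * √(1 - inner ℝ u e ^ 2) → 0 < inner ℝ u e →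
      √(1 - inner ℝ u e ^ 2) • c = -√(r ^ 2 - h ^ 2) • (u - inner ℝ u e • e)) := by
  set t := inner ℝ u e with htdef
  have hr : 0 < r := hh.trans_le hhr
  have ht1 : t < 1 := by nlinarith
  have hs : 0 < 1 - t ^ 2 := by nlinarith
  have hd : 0 ≤ r ^ 2 - h ^ 2 := by nlinarith
  obtain ⟨σ, hσ⟩ : ∃ σ, σ = √(1 - t ^ 2) := ⟨_, rfl⟩
  obtain ⟨ρ, hρ⟩ : ∃ ρ, ρ = √(r ^ 2 - h ^ 2) := ⟨_, rfl⟩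
  have hσ0 : 0 < σ := hσ ▸ Real.sqrt_pos.2 hs
  have hσ2 : σ ^ 2 = 1 - t ^ 2 := hσ ▸ Real.sq_sqrt hs.le
  have hρ0 : 0 ≤ ρ := hρ ▸ Real.sqrt_nonneg _
  have hρ2 : ρ ^ 2 = r ^ 2 - h ^ 2 := hρ ▸ Real.sq_sqrt hd
  rw [← hσ, ← hρ]
  obtain ⟨f, hf⟩ : ∃ f, f = u - t • e := ⟨_, rfl⟩
  have hfe : inner ℝ e f = 0 := by rw [hf, htdef]; exact inner_sub_smul_self he u
  have hfn : ‖f‖ ^ 2 = σ ^ 2 := by rw [hf, hσ2, htdef]; exact norm_sub_smul_self_sq he hu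
  have hfn' : ‖f‖ = σ := (sq_eq_sq₀ (norm_nonneg _) hσ0.le).1 hfn
  have hcn : ‖c‖ ≤ ρ := by rw [← hρ2] at hc; exact (sq_le_sq₀ (norm_nonneg _) hρ0).1 hc
  rw [← hf]
  obtain ⟨a, ha⟩ : ∃ a, a = inner ℝ e c := ⟨_, rfl⟩
  obtain ⟨B, hB⟩ : ∃ B, B = -inner ℝ f c := ⟨_, rfl⟩
  have hdec : -inner ℝ u c = B - t * a := by
    have : u = f + t • e := by rw [hf]; abel
    rw [this, inner_add_left, real_inner_smul_left, hB, ha]; ring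
  have hB1 : B ≤ ρ * σ := by
    have h1 := real_inner_le_norm (-f) c
    rw [inner_neg_left, norm_neg, hfn', ← hB] at h1
    nlinarith
  -- For `a ≥ 0` the bound `B ≤ ρ * σ` is enough. For `a < 0` the ball condition at the contact
  -- point `h • e` enters: Cauchy–Schwarz is applied to `h • e - c` and `(σ * h) • e + ρ • f`, a
  -- vector of norm `σ * r`.
  have hcase : a < 0 → B - t * a < ρ * σ := by
    intro ha0
    have hρpos : 0 < ρ := by
      refine lt_of_le_of_ne hρ0 fun h0 => ?_
      rw [← h0] at hcn
      have hc0 : c = 0 := norm_le_zero_iff.1 hcn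
      rw [ha, hc0, inner_zero_right] at ha0
      exact lt_irrefl _ ha0
    have h1 := real_inner_le_norm (h • e - c) ((σ * h) • e + ρ • f)
    have h2 : ‖(σ * h) • e + ρ • f‖ = σ * r := by
      refine (sq_eq_sq₀ (norm_nonneg _) (by positivity)).1 ?_
      rw [norm_add_sq_real, norm_smul, norm_smul, real_inner_smul_left, real_inner_smul_right, hfe,
        he, hfn', Real.norm_of_nonneg (by positivity), Real.norm_of_nonneg hρ0]
      rw [mul_pow ρ, hρ2]; ring
    have h3 : inner ℝ (h • e - c) ((σ * h) • e + ρ • f) = σ * h ^ 2 - σ * h * a + ρ * B := by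
      rw [inner_sub_left, inner_add_right, inner_add_right, real_inner_smul_left,
        real_inner_smul_left, real_inner_smul_right, real_inner_smul_right, real_inner_smul_right,
        real_inner_smul_right, hfe, real_inner_self_eq_norm_sq, he, real_inner_comm e c,
        real_inner_comm f c, ha, hB]
      ring
    rw [h2, h3] at h1
    have h4 : σ * h ^ 2 - σ * h * a + ρ * B ≤ r * (σ * r) :=
      h1.trans (mul_le_mul_of_nonneg_right hce (by positivity))
    have h5 : ρ * B ≤ σ * ρ ^ 2 + σ * h * a := by rw [hρ2]; linarith
    have h6 : t * ρ < σ * h := by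
      refine lt_of_pow_lt_pow_left₀ 2 (by positivity) ?_
      rw [mul_pow, mul_pow, hσ2, hρ2]
      have : (r * t) ^ 2 < h ^ 2 := pow_lt_pow_left₀ ht (by positivity) two_ne_zero
      nlinarith
    have h7 : ρ * (B - t * a) < ρ * (ρ * σ) := by nlinarith
    exact lt_of_mul_lt_mul_left h7 hρ0
  rw [hdec]
  refine ⟨?_, fun heq htpos => ?_⟩
  · rcases lt_or_ge a 0 with ha0 | ha0
    · exact (hcase ha0).le
    · nlinarith
  · have ha0 : a = 0 := by
      rcases lt_trichotomy a 0 with h0 | h0 | h0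
      · exact absurd heq (hcase h0).ne
      · exact h0
      · nlinarith
    rw [ha0, mul_zero, sub_zero] at heq
    -- Equality in Cauchy–Schwarz for `-f` and `c`, written as a vanishing square.
    have h1 : ‖σ • c + ρ • f‖ ^ 2 ≤ 0 := by
      rw [norm_add_sq_real, norm_smul, norm_smul, real_inner_smul_left, real_inner_smul_right,
        real_inner_comm, Real.norm_of_nonneg hσ0.le, Real.norm_of_nonneg hρ0, hfn']
      have h2 : inner ℝ f c = -(ρ * σ) := by linarith
      have h3 : (σ * ‖c‖) ^ 2 ≤ (σ * ρ) ^ 2 :=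
        pow_le_pow_left₀ (by positivity) (mul_le_mul_of_nonneg_left hcn hσ0.le) 2
      rw [h2]
      linarith
    have h2 : σ • c + ρ • f = 0 := by
      have := sq_nonneg ‖σ • c + ρ • f‖
      exact norm_eq_zero.1 (pow_eq_zero_iff two_ne_zero |>.1 (le_antisymm h1 this))
    rw [neg_smul]
    exact eq_neg_of_add_eq_zero_left h2

end Profile

/-! ### Support function and circumradius of a spindle. -/

section Spindle

variable {n : ℕ} {lam : ℝ}

theorem mem_spindle {x y z : E n} : z ∈ spindle lam x y ↔
    ∀ c, ‖x - c‖ ≤ 1 / lam → ‖y - c‖ ≤ 1 / lam → ‖z - c‖ ≤ 1 / lam := by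
  simp [spindle, dist_eq_norm]

theorem left_mem_spindle (x y : E n) : x ∈ spindle lam x y := mem_spindle.2 fun _ h _ => h

theorem right_mem_spindle (x y : E n) : y ∈ spindle lam x y := mem_spindle.2 fun _ _ h => h

theorem spindle_comm (x y : E n) : spindle lam x y = spindle lam y x := by
  ext z; rw [mem_spindle, mem_spindle]; exact forall_congr' fun c => ⟨fun h a b => h b a, fun h a b => h b a⟩

theorem convex_spindle (x y : E n) : Convex ℝ (spindle lam x y) :=
  convex_iInter₂ fun _ _ => convex_closedBall _ _

theorem isCompact_spindle {m e : E n} (he : ‖e‖ = 1) {h : ℝ} (hh : 0 < h) (hhr : h ≤ 1 / lam) :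
    IsCompact (spindle lam (m + h • e) (m - h • e)) := by
  refine Metric.isCompact_of_isClosed_isBounded (isClosed_biInter fun _ _ => Metric.isClosed_closedBall) ?_
  refine (Metric.isBounded_closedBall (x := m) (r := 1 / lam)).subset fun z hz => ?_
  rw [mem_closedBall_iff_norm]
  have hn : ‖h • e‖ = h := by rw [norm_smul, he, mul_one, Real.norm_of_nonneg hh.le]
  refine mem_spindle.1 hz m ?_ ?_
  · rwa [add_sub_cancel_left, hn]
  · rwa [sub_sub_cancel_left, norm_neg, hn]

-- Let `f` be the unit component of `u` orthogonal to `e` and `ρ = √(r² - h²)`. The upper bound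
-- comes from one ball through a vertex: its centre is `m + h • e - r • u` if `h ≤ r * t`, and `m -
-- ρ • f` otherwise. The lower bound comes from the point where that ball attains its support value,
-- which must be shown to lie in the spindle.
set_option maxHeartbeats 800000 in
theorem supportFn_spindle_of_nonneg {m e u : E n} (he : ‖e‖ = 1) (hu : ‖u‖ = 1) {h : ℝ} (hh : 0 < h)
    (hhr : h ≤ 1 / lam) (ht : 0 ≤ inner ℝ u e) :
    supportFn (spindle lam (m + h • e) (m - h • e)) u =
      inner ℝ u m + profile (1 / lam) h (inner ℝ u e) := by
  have hcpt := isCompact_spindle (m := m) he hh hhr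
  have hne : (spindle lam (m + h • e) (m - h • e)).Nonempty := ⟨_, left_mem_spindle _ _⟩
  obtain ⟨r, hr⟩ : ∃ r, r = 1 / lam := ⟨_, rfl⟩
  rw [← hr] at hhr ⊢
  have hr0 : 0 < r := hh.trans_le hhr
  obtain ⟨t, htd⟩ : ∃ t, t = inner ℝ u e := ⟨_, rfl⟩
  have ht1 : t ≤ 1 := by
    have := real_inner_le_norm u e
    rwa [hu, he, mul_one, ← htd] at this
  rw [← htd] at ht ⊢
  have hball : ∀ c, ‖m + h • e - c‖ ≤ r → ‖m - h • e - c‖ ≤ r →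
      supportFn (spindle lam (m + h • e) (m - h • e)) u ≤ inner ℝ u c + r := by
    intro c h1 h2
    refine supportFn_le hne fun z hz => ?_
    rw [hr] at h1 h2
    have h3 := mem_spindle.1 hz c h1 h2
    rw [← hr] at h3
    have h4 := real_inner_le_norm u (z - c)
    rw [hu, one_mul, inner_sub_right] at h4
    linarith
  unfold profile
  split_ifs with hcase
  · apply le_antisymm
    · refine (hball (m + h • e - r • u) ?_ ?_).trans (le_of_eq ?_)
      · rw [sub_sub_cancel, norm_smul, hu, mul_one, Real.norm_of_nonneg hr0.le]
      · rw [← sq_le_sq₀ (norm_nonneg _) hr0.le]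
        have e1 : m - h • e - (m + h • e - r • u) = r • u - (2 * h) • e := by module
        rw [e1, norm_sub_sq_real, norm_smul, norm_smul, hu, he, real_inner_smul_left,
          real_inner_smul_right, ← htd, Real.norm_of_nonneg hr0.le, Real.norm_of_nonneg (by positivity)]
        nlinarith
      · rw [inner_sub_right, inner_add_right, real_inner_smul_right, real_inner_smul_right, ← htd,
          real_inner_self_eq_norm_sq, hu]
        ring
    · have := inner_le_supportFn hcpt (left_mem_spindle (lam := lam) (m + h • e) (m - h • e)) u
      rwa [inner_add_right, real_inner_smul_right, ← htd] at this
  · push Not at hcase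
    have ht1' : t < 1 := by nlinarith
    have hs : 0 < 1 - t ^ 2 := by nlinarith
    have hd : 0 ≤ r ^ 2 - h ^ 2 := by nlinarith
    obtain ⟨σ, hσ⟩ : ∃ σ, σ = √(1 - t ^ 2) := ⟨_, rfl⟩
    obtain ⟨ρ, hρ⟩ : ∃ ρ, ρ = √(r ^ 2 - h ^ 2) := ⟨_, rfl⟩
    have hσ0 : 0 < σ := hσ ▸ Real.sqrt_pos.2 hs
    have hσ2 : σ ^ 2 = 1 - t ^ 2 := hσ ▸ Real.sq_sqrt hs.le
    have hρ0 : 0 ≤ ρ := hρ ▸ Real.sqrt_nonneg _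
    have hρ2 : ρ ^ 2 = r ^ 2 - h ^ 2 := hρ ▸ Real.sq_sqrt hd
    rw [← hσ, ← hρ]
    obtain ⟨f, hf⟩ : ∃ f, f = σ⁻¹ • (u - t • e) := ⟨_, rfl⟩
    have hσf : σ • f = u - t • e := by rw [hf, smul_smul, mul_inv_cancel₀ hσ0.ne', one_smul]
    have hfe : inner ℝ e f = 0 := by
      rw [hf, real_inner_smul_right, htd, inner_sub_smul_self he u, mul_zero]
    have hfn : ‖f‖ = 1 := by
      have h1 : ‖u - t • e‖ ^ 2 = σ ^ 2 := by rw [hσ2, htd]; exact norm_sub_smul_self_sq he hu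
      have h2 : ‖u - t • e‖ = σ := (sq_eq_sq₀ (norm_nonneg _) hσ0.le).1 h1
      rw [hf, norm_smul, h2, norm_inv, Real.norm_of_nonneg hσ0.le, inv_mul_cancel₀ hσ0.ne']
    have hu' : u = t • e + σ • f := by rw [hσf]; abel
    have huf : inner ℝ u f = σ := by
      rw [hu', inner_add_left, real_inner_smul_left, real_inner_smul_left, hfe,
        real_inner_self_eq_norm_sq, hfn]
      ring
    apply le_antisymm
    · refine (hball (m - ρ • f) ?_ ?_).trans (le_of_eq ?_)
      · rw [← sq_le_sq₀ (norm_nonneg _) hr0.le]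
        have e1 : m + h • e - (m - ρ • f) = h • e + ρ • f := by module
        rw [e1, norm_smul_add_smul_sq he hfn hfe, hρ2]; linarith
      · rw [← sq_le_sq₀ (norm_nonneg _) hr0.le]
        have e1 : m - h • e - (m - ρ • f) = (-h) • e + ρ • f := by module
        rw [e1, norm_smul_add_smul_sq he hfn hfe, hρ2]; linarith
      · rw [inner_sub_right, real_inner_smul_right, huf]; ring
    · have hmem : m - ρ • f + r • u ∈ spindle lam (m + h • e) (m - h • e) := by
        refine mem_spindle.2 fun c h1 h2 => ?_
        rw [← hr] at h1 h2 ⊢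
        obtain ⟨d, hd'⟩ : ∃ d, d = c - m := ⟨_, rfl⟩
        obtain ⟨α, hα⟩ : ∃ α, α = inner ℝ e d := ⟨_, rfl⟩
        obtain ⟨B, hB⟩ : ∃ B, B = inner ℝ f d := ⟨_, rfl⟩
        have e1 : m + h • e - c = h • e - d := by rw [hd']; abel
        have e2 : m - h • e - c = -(h • e + d) := by rw [hd']; abel
        rw [e1, ← sq_le_sq₀ (norm_nonneg _) hr0.le, norm_sub_sq_real, norm_smul, he,
          real_inner_smul_left, ← hα, Real.norm_of_nonneg hh.le] at h1
        rw [e2, norm_neg, ← sq_le_sq₀ (norm_nonneg _) hr0.le, norm_add_sq_real, norm_smul, he,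
          real_inner_smul_left, ← hα, Real.norm_of_nonneg hh.le] at h2
        -- This single inequality expresses that the ball around `c = m + d` contains both vertices.
        have hdn : ‖d‖ ^ 2 + 2 * h * |α| ≤ ρ ^ 2 := by
          rw [hρ2]
          rcases abs_cases α with ⟨h0, -⟩ | ⟨h0, -⟩ <;> rw [h0] <;> nlinarith
        have hdρ : ‖d‖ ≤ ρ := by
          rw [← sq_le_sq₀ (norm_nonneg _) hρ0]
          have := mul_nonneg hh.le (abs_nonneg α)
          linarith
        have hBρ : 0 ≤ B + ρ := by
          have := (abs_le.1 (abs_real_inner_le_norm f d)).1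
          rw [hfn, one_mul, ← hB] at this
          linarith
        have hσr : ρ ≤ r * σ := by
          rw [← sq_le_sq₀ hρ0 (by positivity), mul_pow, hσ2, hρ2]
          have : (r * t) ^ 2 ≤ h ^ 2 := pow_le_pow_left₀ (by positivity) hcase.le 2
          nlinarith
        rw [← sq_le_sq₀ (norm_nonneg _) hr0.le]
        have e3 : m - ρ • f + r • u - c = r • u - (ρ • f + d) := by rw [hd']; abel
        have hud : inner ℝ u d = t * α + σ * B := by
          rw [hu', inner_add_left, real_inner_smul_left, real_inner_smul_left, hα, hB]
        rw [e3, norm_sub_sq_real, real_inner_smul_left, inner_add_right, real_inner_smul_right, huf,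
          hud, norm_add_sq_real, norm_smul, norm_smul, hu, hfn, real_inner_smul_left, ← hB,
          Real.norm_of_nonneg hr0.le, Real.norm_of_nonneg hρ0]
        have h5 : -(r * t * α) ≤ h * |α| := by
          have := neg_abs_le α
          have h6 : r * t * |α| ≤ h * |α| := mul_le_mul_of_nonneg_right hcase.le (abs_nonneg α)
          have h7 : 0 ≤ r * t := by positivity
          nlinarith
        have h8 := mul_nonneg (sub_nonneg.2 hσr) hBρ
        linarith
      have := inner_le_supportFn hcpt hmem u
      rw [inner_add_right, inner_sub_right, real_inner_smul_right, real_inner_smul_right, huf,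
        real_inner_self_eq_norm_sq, hu] at this
      linarith

theorem supportFn_spindle {m e u : E n} (he : ‖e‖ = 1) (hu : ‖u‖ = 1) {h : ℝ} (hh : 0 < h)
    (hhr : h ≤ 1 / lam) :
    supportFn (spindle lam (m + h • e) (m - h • e)) u =
      inner ℝ u m + profile (1 / lam) h |inner ℝ u e| := by
  rcases le_total 0 (inner ℝ u e) with h0 | h0
  · rw [abs_of_nonneg h0]; exact supportFn_spindle_of_nonneg he hu hh hhr h0
  · rw [abs_of_nonpos h0, ← inner_neg_right, spindle_comm]
    have := supportFn_spindle_of_nonneg (m := m) (e := -e) (u := u) (by rwa [norm_neg]) hu hh hhr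
      (by rw [inner_neg_right]; linarith)
    rw [← this, smul_neg, sub_neg_eq_add, ← sub_eq_add_neg]

theorem circumradius_spindle {m e : E n} (he : ‖e‖ = 1) {h : ℝ} (hh : 0 < h)
    (hhr : h ≤ 1 / lam) : circumradius (spindle lam (m + h • e) (m - h • e)) = h := by
  apply le_antisymm
  · refine circumradius_le (c := m) hh.le fun z hz => ?_
    rw [mem_closedBall_iff_norm]
    rcases eq_or_ne z m with rfl | hzm
    · simpa using hh.le
    have hD : 0 < ‖z - m‖ := norm_pos_iff.2 (sub_ne_zero.2 hzm)
    set u := ‖z - m‖⁻¹ • (z - m) with hu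
    have hun : ‖u‖ = 1 := by rw [hu, norm_smul, norm_inv, norm_norm, inv_mul_cancel₀ hD.ne']
    have h1 := inner_le_supportFn (isCompact_spindle he hh hhr) hz u
    rw [supportFn_spindle he hun hh hhr] at h1
    have h2 : inner ℝ u (z - m) = ‖z - m‖ := by
      rw [hu, real_inner_smul_left, real_inner_self_eq_norm_sq]; field_simp
    rw [inner_sub_right] at h2
    have h3 : |inner ℝ u e| ≤ 1 := by
      have := abs_real_inner_le_norm u e
      rwa [hun, he, mul_one] at this
    have := profile_le hh hhr (abs_nonneg _) h3
    linarith
  · have hne : {r : ℝ | 0 ≤ r ∧ ∃ c : E n,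
        spindle lam (m + h • e) (m - h • e) ⊆ Metric.closedBall c r}.Nonempty := by
      obtain ⟨R, hR⟩ := (isCompact_spindle (m := m) he hh hhr).isBounded.subset_closedBall 0
      exact ⟨max 0 R, le_max_left _ _, 0,
        hR.trans (Metric.closedBall_subset_closedBall (le_max_right _ _))⟩
    refine le_csInf hne ?_
    rintro s ⟨-, c, hc⟩
    have h1 := mem_closedBall_iff_norm.1 (hc (left_mem_spindle _ _))
    have h2 := mem_closedBall_iff_norm.1 (hc (right_mem_spindle _ _))
    have h3 := norm_sub_le (m + h • e - c) (m - h • e - c)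
    have h4 : m + h • e - c - (m - h • e - c) = (2 * h) • e := by module
    rw [h4, norm_smul, he, mul_one, Real.norm_of_nonneg (by positivity)] at h3
    linarith

theorem IsSpindle.exists_eq {S : Set (E n)} (hS : IsSpindle lam S) :
    ∃ (m e : E n) (h : ℝ), ‖e‖ = 1 ∧ 0 < h ∧ h ≤ 1 / lam ∧
      S = spindle lam (m + h • e) (m - h • e) := by
  obtain ⟨x, y, hxy, hd, rfl⟩ := hS
  have hD : 0 < ‖x - y‖ := norm_pos_iff.2 (sub_ne_zero.2 hxy)
  refine ⟨(1 / 2 : ℝ) • (x + y), ‖x - y‖⁻¹ • (x - y), ‖x - y‖ / 2, ?_, by positivity, ?_, ?_⟩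
  · rw [norm_smul, norm_inv, norm_norm, inv_mul_cancel₀ hD.ne']
  · rw [dist_eq_norm] at hd
    have : (2 : ℝ) / lam = 2 * (1 / lam) := by ring
    linarith
  · have h1 : (‖x - y‖ / 2) • ‖x - y‖⁻¹ • (x - y) = (1 / 2 : ℝ) • (x - y) := by
      rw [smul_smul]; congr 1; field_simp
    rw [h1]
    congr 1 <;> module

theorem isSpindle_spindle {m e : E n} (he : ‖e‖ = 1) {h : ℝ} (hh : 0 < h)
    (hhr : h ≤ 1 / lam) : IsSpindle lam (spindle lam (m + h • e) (m - h • e)) := by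
  have h4 : m + h • e - (m - h • e) = (2 * h) • e := by module
  have h5 : ‖m + h • e - (m - h • e)‖ = 2 * h := by
    rw [h4, norm_smul, he, mul_one, Real.norm_of_nonneg (by positivity)]
  refine ⟨_, _, fun h0 => ?_, ?_, rfl⟩
  · rw [h0, sub_self, norm_zero] at h5; linarith
  · rw [dist_eq_norm, h5]
    have : (2 : ℝ) / lam = 2 * (1 / lam) := by ring
    linarith

end Spindle

/-! ### Means of monotone functions over sectors. -/

section Sector

open MeasureTheory

/-- Some constant `κ` separates the values of `φ` on `D ∩ Q` from those on `D \ Q`, so the mean over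
`D ∩ Q` is at least the mean over `D`. The form without quotients covers null sets. -/
theorem measureReal_mul_integral_le_of_sector {Z : Type*} [MeasurableSpace Z] {ζ : Measure Z}
    {D Q : Set Z} (hD : MeasurableSet D) (hDf : ζ D ≠ ⊤) (hQ : MeasurableSet Q) {φ : Z → ℝ}
    (hφ : IntegrableOn φ D ζ) (h : ∀ z ∈ D ∩ Q, ∀ z' ∈ D \ Q, φ z' ≤ φ z) :
    ζ.real (D ∩ Q) * ∫ z in D, φ z ∂ζ ≤ ζ.real D * ∫ z in D ∩ Q, φ z ∂ζ := by
  have hi1 : IntegrableOn φ (D ∩ Q) ζ := hφ.mono_set Set.inter_subset_left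
  have hi2 : IntegrableOn φ (D \ Q) ζ := hφ.mono_set Set.sdiff_subset
  have hf1 : ζ (D ∩ Q) ≠ ⊤ := ((measure_mono Set.inter_subset_left).trans_lt hDf.lt_top).ne
  have hf2 : ζ (D \ Q) ≠ ⊤ := ((measure_mono Set.sdiff_subset).trans_lt hDf.lt_top).ne
  rcases (D ∩ Q).eq_empty_or_nonempty with h0 | ⟨z₀, hz₀⟩
  · simp [h0]
  rcases (D \ Q).eq_empty_or_nonempty with h1 | ⟨z₁, hz₁⟩
  · have : D ∩ Q = D := Set.inter_eq_left.2 (Set.sdiff_eq_empty.1 h1)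
    rw [this]
  have hb : BddBelow (φ '' (D ∩ Q)) := ⟨φ z₁, by rintro _ ⟨z, hz, rfl⟩; exact h z hz z₁ hz₁⟩
  set κ := sInf (φ '' (D ∩ Q)) with hκ
  have hκ1 : ∀ z ∈ D ∩ Q, κ ≤ φ z := fun z hz => csInf_le hb ⟨z, hz, rfl⟩
  have hκ2 : ∀ z ∈ D \ Q, φ z ≤ κ := fun z hz =>
    le_csInf ⟨_, z₀, hz₀, rfl⟩ (by rintro _ ⟨y, hy, rfl⟩; exact h y hy z hz)
  have e1 : κ * ζ.real (D ∩ Q) ≤ ∫ z in D ∩ Q, φ z ∂ζ := by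
    have := setIntegral_mono_on (integrableOn_const (C := κ) hf1) hi1 (hD.inter hQ) hκ1
    rwa [setIntegral_const, smul_eq_mul, mul_comm] at this
  have e2 : ∫ z in D \ Q, φ z ∂ζ ≤ κ * ζ.real (D \ Q) := by
    have := setIntegral_mono_on hi2 (integrableOn_const (C := κ) hf2) (hD.diff hQ) hκ2
    rwa [setIntegral_const, smul_eq_mul, mul_comm] at this
  rw [← measureReal_inter_add_sdiff hQ (s := D) hDf, ← integral_inter_add_sdiff hQ hφ]
  have p1 : 0 ≤ ζ.real (D ∩ Q) := measureReal_nonneg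
  have p2 : 0 ≤ ζ.real (D \ Q) := measureReal_nonneg
  nlinarith [mul_le_mul_of_nonneg_left e1 p2, mul_le_mul_of_nonneg_left e2 p1]

/-- Fubini reduces this to the previous inequality on each fibre. It integrates because `ζ.real D`
and the integral over `D` do not depend on `ω`. -/
theorem measureReal_mul_integral_le_of_sectors {Ω Z : Type*} [MeasurableSpace Ω]
    [MeasurableSpace Z] {σ : Measure Ω} [IsFiniteMeasure σ] {ζ : Measure Z} [SFinite ζ]
    {D : Set Z} (hD : MeasurableSet D) (hDf : ζ D ≠ ⊤) {Q : Set (Ω × Z)} (hQ : MeasurableSet Q)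
    {φ : Z → ℝ} (hφ : IntegrableOn φ D ζ)
    (h : ∀ ω, ∀ z ∈ D, (ω, z) ∈ Q → ∀ z' ∈ D, (ω, z') ∉ Q → φ z' ≤ φ z) :
    (σ.prod ζ).real (Prod.snd ⁻¹' D ∩ Q) * ∫ z in D, φ z ∂ζ ≤
      ζ.real D * ∫ p in Prod.snd ⁻¹' D ∩ Q, φ p.2 ∂(σ.prod ζ) := by
  have hS : MeasurableSet (Prod.snd ⁻¹' D ∩ Q : Set (Ω × Z)) := (measurable_snd hD).inter hQ
  have hprod : σ.prod (ζ.restrict D) = (σ.prod ζ).restrict (Prod.snd ⁻¹' D) := by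
    rw [← Set.univ_prod, ← Measure.prod_restrict, Measure.restrict_univ]
  have hfin : IsFiniteMeasure (ζ.restrict D) := ⟨by rw [Measure.restrict_apply_univ]; exact hDf.lt_top⟩
  have hφ2 : IntegrableOn (fun p : Ω × Z => φ p.2) (Prod.snd ⁻¹' D) (σ.prod ζ) := by
    rw [IntegrableOn, ← hprod]
    exact Integrable.comp_snd hφ σ
  have hfib : ∀ ω, MeasurableSet (Prod.mk ω ⁻¹' Q) := fun ω => measurable_prodMk_left hQ
  have e1 : ∫ p in Prod.snd ⁻¹' D ∩ Q, φ p.2 ∂(σ.prod ζ) =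
      ∫ ω, ∫ z in D ∩ Prod.mk ω ⁻¹' Q, φ z ∂ζ ∂σ := by
    rw [← integral_indicator hS, integral_prod _ ((integrable_indicator_iff hS).2
      (hφ2.mono_set Set.inter_subset_left))]
    refine integral_congr_ae (Filter.Eventually.of_forall fun ω => ?_)
    simp only
    rw [← integral_indicator (hD.inter (hfib ω))]
    rfl
  have hfin2 : (σ.prod ζ) (Prod.snd ⁻¹' D ∩ Q) ≠ ⊤ := by
    refine ((measure_mono Set.inter_subset_left).trans_lt ?_).ne
    rw [← Set.univ_prod, Measure.prod_prod]
    exact ENNReal.mul_lt_top (measure_lt_top _ _) hDf.lt_top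
  have e2 : (σ.prod ζ).real (Prod.snd ⁻¹' D ∩ Q) = ∫ ω, ζ.real (D ∩ Prod.mk ω ⁻¹' Q) ∂σ := by
    have := setIntegral_const (μ := σ.prod ζ) (s := Prod.snd ⁻¹' D ∩ Q) (1 : ℝ)
    rw [smul_eq_mul, mul_one] at this
    rw [← this, ← integral_indicator hS, integral_prod _ ((integrable_indicator_iff hS).2
      (integrableOn_const hfin2))]
    refine integral_congr_ae (Filter.Eventually.of_forall fun ω => ?_)
    have h2 := setIntegral_const (μ := ζ) (s := D ∩ Prod.mk ω ⁻¹' Q) (1 : ℝ)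
    rw [smul_eq_mul, mul_one] at h2
    simp only
    rw [← h2, ← integral_indicator (hD.inter (hfib ω))]
    rfl
  have hint1 : Integrable (fun ω => ∫ z in D ∩ Prod.mk ω ⁻¹' Q, φ z ∂ζ) σ := by
    have := ((integrable_indicator_iff hS).2
      (hφ2.mono_set Set.inter_subset_left)).integral_prod_left
    refine this.congr (Filter.Eventually.of_forall fun ω => ?_)
    simp only
    rw [← integral_indicator (hD.inter (hfib ω))]
    rfl
  have hint2 : Integrable (fun ω => ζ.real (D ∩ Prod.mk ω ⁻¹' Q)) σ := by
    have := ((integrable_indicator_iff hS).2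
      (integrableOn_const (C := (1 : ℝ)) hfin2)).integral_prod_left
    refine this.congr (Filter.Eventually.of_forall fun ω => ?_)
    have h2 := setIntegral_const (μ := ζ) (s := D ∩ Prod.mk ω ⁻¹' Q) (1 : ℝ)
    rw [smul_eq_mul, mul_one] at h2
    simp only
    rw [← h2, ← integral_indicator (hD.inter (hfib ω))]
    rfl
  rw [e1, e2, ← integral_mul_const, ← integral_const_mul]
  refine integral_mono (hint2.mul_const _) (hint1.const_mul _) fun ω => ?_
  exact measureReal_mul_integral_le_of_sector hD hDf (hfib ω) hφ
    fun z hz z' hz' => h ω z hz.1 hz.2 z' hz'.1 hz'.2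

end Sector

/-! ### Cylindrical coordinates around an axis. -/

section Cylinder

open MeasureTheory Measure

variable {V : Type*} [NormedAddCommGroup V] [InnerProductSpace ℝ V] [FiniteDimensional ℝ V]
  [MeasurableSpace V] [BorelSpace V]

/-- The decomposition of the space into a line and its orthogonal complement. -/
noncomputable def lineProdEquiv {e : V} (he : ‖e‖ = 1) : (ℝ × (ℝ ∙ e)ᗮ) ≃L[ℝ] V :=
  LinearEquiv.toContinuousLinearEquiv
    { toFun := fun p => p.1 • e + (p.2 : V)
      map_add' := fun p q => by simp only [Prod.fst_add, Prod.snd_add, Submodule.coe_add]; module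
      map_smul' := fun c p => by
        simp only [Prod.smul_fst, Prod.smul_snd, Submodule.coe_smul, RingHom.id_apply, smul_eq_mul]
        module
      invFun := fun x => (inner ℝ x e, ⟨x - inner ℝ x e • e, by
        rw [Submodule.mem_orthogonal_singleton_iff_inner_right]
        exact inner_sub_smul_self he x⟩)
      left_inv := fun p => by
        have h := Submodule.mem_orthogonal_singleton_iff_inner_left.1 p.2.2
        have h1 : inner ℝ (p.1 • e + (p.2 : V)) e = p.1 := by
          rw [inner_add_left, h, real_inner_smul_left, real_inner_self_eq_norm_sq, he]; ring
        ext
        · exact h1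
        · simp only [h1, add_sub_cancel_left]
      right_inv := fun x => by simp }

/-- Cylindrical coordinates around the axis `e`. -/
noncomputable def cylinderMap (e : V) :
    Metric.sphere (0 : (ℝ ∙ e)ᗮ) 1 × (ℝ × Set.Ioi (0 : ℝ)) → V :=
  fun p => p.2.1 • e + (p.2.2 : ℝ) • ((p.1 : (ℝ ∙ e)ᗮ) : V)

/-- The target is only claimed to be some Haar measure: the inequality for which it serves is
homogeneous in the measure, so the normalisation is irrelevant. -/
theorem measurePreserving_cylinderMap {e : V} (he : ‖e‖ = 1) (hdim : 2 ≤ Module.finrank ℝ V) :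
    ∃ μ' : Measure V, μ'.IsAddHaarMeasure ∧ MeasurePreserving (cylinderMap e)
      ((volume : Measure (ℝ ∙ e)ᗮ).toSphere.prod ((volume : Measure ℝ).prod
        (volumeIoiPow (Module.finrank ℝ (ℝ ∙ e)ᗮ - 1)))) μ' := by
  have h1 : 0 < Module.finrank ℝ (ℝ ∙ e)ᗮ := by
    have h2 := Submodule.finrank_add_finrank_orthogonal (ℝ ∙ e)
    have h3 : Module.finrank ℝ (ℝ ∙ e) ≤ 1 := by
      simpa using finrank_span_le_card (R := ℝ) ({e} : Set V)
    omega
  have := Module.nontrivial_of_finrank_pos h1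
  refine ⟨(volume.prod volume).map (lineProdEquiv he),
    (lineProdEquiv he).isAddHaarMeasure_map _, ?_⟩
  have hp := measurePreserving_polar (volume : Measure (ℝ ∙ e)ᗮ)
  set σ := (volume : Measure (ℝ ∙ e)ᗮ).toSphere
  set τ := volumeIoiPow (Module.finrank ℝ (ℝ ∙ e)ᗮ - 1)
  have a1 : MeasurePreserving _ (σ.prod ((volume : Measure ℝ).prod τ)) _ :=
    (measurePreserving_prodAssoc σ (volume : Measure ℝ) τ).symm MeasurableEquiv.prodAssoc
  have a2 := ((measurePreserving_swap (μ := σ) (ν := (volume : Measure ℝ))).prod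
    (MeasurePreserving.id τ)).comp a1
  have a3 := (measurePreserving_prodAssoc (volume : Measure ℝ) σ τ).comp a2
  have a4 := ((MeasurePreserving.id (volume : Measure ℝ)).prod hp).comp a3
  have a5 : MeasurePreserving (lineProdEquiv he) (volume.prod volume)
      ((volume.prod volume).map (lineProdEquiv he)) :=
    ⟨(lineProdEquiv he).continuous.measurable, rfl⟩
  exact a5.comp a4

end Cylinder

/-! ### Comparison of means over cells and half-balls. -/

section Cells

open MeasureTheory Measure

variable {V : Type*} [NormedAddCommGroup V] [InnerProductSpace ℝ V]

theorem div_sqrt_le_div_sqrt {s r s' r' : ℝ} (hr : 0 < r) (hr' : 0 < r') (hs : 0 ≤ s)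
    (hs' : 0 ≤ s') (h : s' * r ≤ s * r') :
    s' / √(s' ^ 2 + r' ^ 2) ≤ s / √(s ^ 2 + r ^ 2) := by
  have h1 : 0 < s ^ 2 + r ^ 2 := by positivity
  have h2 : 0 < s' ^ 2 + r' ^ 2 := by positivity
  rw [div_le_div_iff₀ (Real.sqrt_pos.2 h2) (Real.sqrt_pos.2 h1)]
  refine (sq_le_sq₀ (by positivity) (by positivity)).1 ?_
  rw [mul_pow, mul_pow, Real.sq_sqrt h1.le, Real.sq_sqrt h2.le]
  have := pow_le_pow_left₀ (by positivity) h 2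
  nlinarith

theorem norm_cylinderMap_sq {e : V} (he : ‖e‖ = 1)
    (p : Metric.sphere (0 : (ℝ ∙ e)ᗮ) 1 × (ℝ × Set.Ioi (0 : ℝ))) :
    ‖cylinderMap e p‖ ^ 2 = p.2.1 ^ 2 + (p.2.2 : ℝ) ^ 2 := by
  refine norm_smul_add_smul_sq he ?_ ?_ _ _
  · rw [← Submodule.coe_norm]; exact norm_eq_of_mem_sphere p.1
  · exact Submodule.mem_orthogonal_singleton_iff_inner_right.1 (p.1 : (ℝ ∙ e)ᗮ).2

theorem inner_cylinderMap {e : V} (he : ‖e‖ = 1)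
    (p : Metric.sphere (0 : (ℝ ∙ e)ᗮ) 1 × (ℝ × Set.Ioi (0 : ℝ))) :
    inner ℝ (cylinderMap e p) e = p.2.1 := by
  have h := Submodule.mem_orthogonal_singleton_iff_inner_left.1 (p.1 : (ℝ ∙ e)ᗮ).2
  rw [cylinderMap, inner_add_left, real_inner_smul_left, real_inner_smul_left, h,
    real_inner_self_eq_norm_sq, he]
  ring

variable [FiniteDimensional ℝ V] [MeasurableSpace V] [BorelSpace V]

omit [FiniteDimensional ℝ V] in
theorem measurableSet_halfBall (e : V) : MeasurableSet {x : V | 0 ≤ inner ℝ x e ∧ ‖x‖ < 1} := by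
  have h1 : MeasurableSet {x : V | 0 ≤ inner ℝ x e} :=
    (isClosed_le (by fun_prop) (by fun_prop)).measurableSet
  have h2 : MeasurableSet {x : V | ‖x‖ < 1} :=
    (isOpen_lt (by fun_prop) (by fun_prop)).measurableSet
  exact h1.inter h2

/-- Over a cone `C` that is invariant under translations in the direction `e`, the mean of an
increasing function of the cosine of the angle with `e` is at least its mean over the half-space
with inner normal `e`. -/
theorem halfBall_mean_le_cone_mean {e : V} (he : ‖e‖ = 1) (hdim : 2 ≤ Module.finrank ℝ V)
    {C : Set V} (hC : MeasurableSet C) (hcone : ∀ x ∈ C, ∀ c : ℝ, 0 < c → c • x ∈ C)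
    (hadd : ∀ x ∈ C, ∀ s : ℝ, 0 ≤ s → x + s • e ∈ C) (hhalf : ∀ x ∈ C, 0 ≤ inner ℝ x e)
    {f : ℝ → ℝ} (hf : Continuous f) (hmono : ∀ s t, 0 ≤ s → s ≤ t → f s ≤ f t) :
    (volume : Measure V).real (C ∩ Metric.ball 0 1) *
        ∫ x in {x : V | 0 ≤ inner ℝ x e ∧ ‖x‖ < 1}, f (inner ℝ (‖x‖⁻¹ • x) e) ≤
      (volume : Measure V).real {x : V | 0 ≤ inner ℝ x e ∧ ‖x‖ < 1} *
        ∫ x in C ∩ Metric.ball 0 1, f (inner ℝ (‖x‖⁻¹ • x) e) := by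
  obtain ⟨μ', hμ', hΨ⟩ := measurePreserving_cylinderMap he hdim
  set σ := (volume : Measure (ℝ ∙ e)ᗮ).toSphere with hσ
  set τ := volumeIoiPow (Module.finrank ℝ (ℝ ∙ e)ᗮ - 1) with hτ
  set D : Set V := {x : V | 0 ≤ inner ℝ x e ∧ ‖x‖ < 1} with hD
  set F : V → ℝ := fun x => f (inner ℝ (‖x‖⁻¹ • x) e) with hF
  have hFm : Measurable F := by
    have h1 : Measurable fun u : V => f (inner ℝ u e) := by fun_prop
    exact measurable_comp_inv_norm_smul h1
  have hDm : MeasurableSet D :=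
    measurableSet_halfBall e
  have hCD : C ∩ Metric.ball 0 1 = D ∩ C := by
    ext x
    simp only [Set.mem_inter_iff, mem_ball_zero_iff, hD, Set.mem_ofPred_eq]
    exact ⟨fun h => ⟨⟨hhalf x h.1, h.2⟩, h.1⟩, fun h => ⟨h.2, h.1.2⟩⟩
  set Dz : Set (ℝ × Set.Ioi (0 : ℝ)) := {z | 0 ≤ z.1 ∧ z.1 ^ 2 + (z.2 : ℝ) ^ 2 < 1} with hDz
  set φ : ℝ × Set.Ioi (0 : ℝ) → ℝ := fun z => f (z.1 / √(z.1 ^ 2 + (z.2 : ℝ) ^ 2)) with hφ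
  have hDzm : MeasurableSet Dz := by
    have h1 : MeasurableSet {z : ℝ × Set.Ioi (0 : ℝ) | 0 ≤ z.1} :=
      measurableSet_le measurable_const measurable_fst
    have h2 : MeasurableSet {z : ℝ × Set.Ioi (0 : ℝ) | z.1 ^ 2 + (z.2 : ℝ) ^ 2 < 1} :=
      measurableSet_lt (by fun_prop) measurable_const
    exact h1.inter h2
  have hΨD : cylinderMap e ⁻¹' D = Prod.snd ⁻¹' Dz := by
    ext p
    simp only [Set.mem_preimage, hD, hDz, Set.mem_ofPred_eq, inner_cylinderMap he]
    rw [← norm_cylinderMap_sq he, sq_lt_one_iff₀ (norm_nonneg _)]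
  have hFΨ : ∀ p, F (cylinderMap e p) = φ p.2 := by
    intro p
    have hn : ‖cylinderMap e p‖ = √(p.2.1 ^ 2 + (p.2.2 : ℝ) ^ 2) := by
      rw [← norm_cylinderMap_sq he, Real.sqrt_sq (norm_nonneg _)]
    simp only [hF, hφ]
    rw [real_inner_smul_left, inner_cylinderMap he, hn, inv_mul_eq_div]
  have hDzf : (volume.prod τ) Dz ≠ ⊤ := by
    have hsub : Dz ⊆ Set.Icc 0 1 ×ˢ Set.Iio (⟨1, Set.mem_Ioi.2 one_pos⟩ : Set.Ioi (0 : ℝ)) := by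
      rintro ⟨s, r, hr⟩ ⟨h1, h2⟩
      simp only at h1 h2
      have hr' : 0 < r := hr
      refine ⟨⟨h1, by nlinarith⟩, ?_⟩
      rw [Set.mem_Iio, ← Subtype.coe_lt_coe]
      simp only
      nlinarith
    refine ((measure_mono hsub).trans_lt ?_).ne
    rw [Measure.prod_prod, volumeIoiPow_apply_Iio]
    exact ENNReal.mul_lt_top measure_Icc_lt_top ENNReal.ofReal_lt_top
  have hφb : ∃ M, ∀ z, |φ z| ≤ M := by
    obtain ⟨M, hM⟩ := (isCompact_Icc (a := (-1 : ℝ)) (b := 1)).exists_bound_of_continuousOn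
      hf.continuousOn
    refine ⟨M, fun z => hM _ ?_⟩
    have hpos : 0 < z.1 ^ 2 + (z.2 : ℝ) ^ 2 := by
      have : (0 : ℝ) < z.2 := z.2.2
      positivity
    rw [Set.mem_Icc, ← abs_le, abs_div, abs_of_pos (Real.sqrt_pos.2 hpos),
      div_le_one (Real.sqrt_pos.2 hpos)]
    exact Real.abs_le_sqrt (by nlinarith [sq_nonneg (z.2 : ℝ)])
  have hφi : IntegrableOn φ Dz (volume.prod τ) := by
    obtain ⟨M, hM⟩ := hφb
    refine Measure.integrableOn_of_bounded (M := M) hDzf ?_ (Filter.Eventually.of_forall hM)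
    exact (hf.measurable.comp (by fun_prop)).aestronglyMeasurable
  -- In each half-plane bounded by the axis the cone is a sector around `e`: a point `(s', r')` with
  -- `s' / r' > s / r` is reached from `(s, r)` by scaling with `r' / r` and then moving along `e`.
  have hsec := measureReal_mul_integral_le_of_sectors (σ := σ) (ζ := volume.prod τ) hDzm hDzf
    (Q := cylinderMap e ⁻¹' C) (hΨ.measurable hC) hφi (by
    rintro ω ⟨s, r, hr⟩ ⟨hs0, -⟩ hz ⟨s', r', hr'⟩ ⟨hs0', -⟩ hz'
    have hr0 : 0 < r := hr
    have hr0' : 0 < r' := hr'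
    refine hmono _ _ (by positivity) (div_sqrt_le_div_sqrt hr0 hr0' hs0 hs0' ?_)
    by_contra hlt
    push Not at hlt
    simp only at hlt
    refine hz' ?_
    have h1 := hadd _ (hcone _ hz (r' / r) (by positivity)) (s' - r' / r * s) (by
      rw [sub_nonneg, div_mul_eq_mul_div, div_le_iff₀ hr0]; linarith)
    have h2 : (r' / r) • cylinderMap e (ω, s, ⟨r, hr⟩) + (s' - r' / r * s) • e =
        cylinderMap e (ω, s', ⟨r', hr'⟩) := by
      simp only [cylinderMap]
      rw [smul_add, smul_smul, smul_smul, div_mul_cancel₀ _ hr0.ne']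
      module
    rw [h2] at h1
    exact h1)
  rw [← hΨD, ← Set.preimage_inter] at hsec
  have hint : ∀ S : Set V, MeasurableSet S → ∫ x in S, F x ∂μ' =
      ∫ p in cylinderMap e ⁻¹' S, φ p.2 ∂(σ.prod (volume.prod τ)) := by
    intro S hS
    rw [← hΨ.map_eq, setIntegral_map hS hFm.aestronglyMeasurable hΨ.measurable.aemeasurable]
    simp only [hFΨ]
  have hvol : ∀ S : Set V, MeasurableSet S → μ'.real S =
      (σ.prod (volume.prod τ)).real (cylinderMap e ⁻¹' S) := fun S hS =>
    (hΨ.measureReal_preimage hS.nullMeasurableSet).symm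
  rw [← hvol _ (hDm.inter hC), ← hint _ (hDm.inter hC), ← hCD] at hsec
  have hD1 : μ'.real D = σ.real Set.univ * (volume.prod τ).real Dz := by
    rw [hvol D hDm, hΨD, ← Set.univ_prod, measureReal_prod_prod]
  have hD2 : ∫ x in D, F x ∂μ' = σ.real Set.univ * ∫ z in Dz, φ z ∂(volume.prod τ) := by
    rw [hint D hDm, hΨD, ← Set.univ_prod, ← Measure.prod_restrict, Measure.restrict_univ,
      integral_fun_snd, smul_eq_mul]
  have hmain : μ'.real (C ∩ Metric.ball 0 1) * ∫ x in D, F x ∂μ' ≤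
      μ'.real D * ∫ x in C ∩ Metric.ball 0 1, F x ∂μ' := by
    rw [hD1, hD2]
    have := mul_le_mul_of_nonneg_left hsec (measureReal_nonneg (μ := σ) (s := Set.univ))
    linarith
  -- Both sides are quadratic in the measure, so the factor between the two Haar measures enters as
  -- its square.
  rw [isAddLeftInvariant_eq_smul (volume : Measure V) μ']
  simp only [Measure.restrict_smul, integral_smul_nnreal_measure, measureReal_nnreal_smul_apply]
  set c := addHaarScalarFactor (volume : Measure V) μ'
  have := mul_le_mul_of_nonneg_left hmain (mul_self_nonneg (c : ℝ))
  simp only [NNReal.smul_def, smul_eq_mul]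
  linarith

theorem volume_inner_eq_zero {e : V} (he : ‖e‖ = 1) :
    (volume : Measure V) {x : V | inner ℝ x e = 0} = 0 := by
  have h1 : {x : V | inner ℝ x e = 0} = ((ℝ ∙ e)ᗮ : Submodule ℝ V) := by
    ext x
    rw [Set.mem_ofPred_eq, SetLike.mem_coe, Submodule.mem_orthogonal_singleton_iff_inner_left]
  rw [h1]
  refine addHaar_submodule _ _ fun h => ?_
  have h2 : e ∈ (ℝ ∙ e)ᗮ := h ▸ Submodule.mem_top
  rw [Submodule.mem_orthogonal_singleton_iff_inner_left, real_inner_self_eq_norm_sq, he] at h2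
  norm_num at h2

/-- The integral of an even function over a ball is twice that over the half-ball. -/
theorem integral_ball_eq_two_mul {e : V} (he : ‖e‖ = 1) {F : V → ℝ} (heven : ∀ x, F (-x) = F x)
    (hF : IntegrableOn F (Metric.ball (0 : V) 1)) :
    ∫ x in Metric.ball (0 : V) 1, F x = 2 * ∫ x in {x : V | 0 ≤ inner ℝ x e ∧ ‖x‖ < 1}, F x := by
  have hP : MeasurableSet {x : V | 0 ≤ inner ℝ x e} := measurableSet_le measurable_const (by fun_prop)
  rw [← integral_inter_add_sdiff hP hF]
  have h1 : Metric.ball (0 : V) 1 ∩ {x : V | 0 ≤ inner ℝ x e} =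
      {x : V | 0 ≤ inner ℝ x e ∧ ‖x‖ < 1} := by
    ext x; simp [and_comm]
  have h2 : Metric.ball (0 : V) 1 \ {x : V | 0 ≤ inner ℝ x e} =
      {x : V | inner ℝ x e < 0 ∧ ‖x‖ < 1} := by
    ext x; simp [and_comm]
  have h3 : ∫ x in {x : V | inner ℝ x e < 0 ∧ ‖x‖ < 1}, F x =
      ∫ x in {x : V | 0 < inner ℝ x e ∧ ‖x‖ < 1}, F x := by
    have h4 := ((LinearIsometryEquiv.neg ℝ (E := V)).measurePreserving.restrict_preimage_emb
      (LinearIsometryEquiv.neg ℝ (E := V)).toMeasurableEquiv.measurableEmbedding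
      {x : V | inner ℝ x e < 0 ∧ ‖x‖ < 1}).integral_comp
      (LinearIsometryEquiv.neg ℝ (E := V)).toMeasurableEquiv.measurableEmbedding F
    rw [← h4]
    have h5 : (LinearIsometryEquiv.neg ℝ (E := V)) ⁻¹' {x : V | inner ℝ x e < 0 ∧ ‖x‖ < 1} =
        {x : V | 0 < inner ℝ x e ∧ ‖x‖ < 1} := by
      ext x; simp
    rw [h5]
    simp only [LinearIsometryEquiv.coe_neg, heven]
  have h6 : ({x : V | 0 < inner ℝ x e ∧ ‖x‖ < 1} : Set V) =ᵐ[volume]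
      {x : V | 0 ≤ inner ℝ x e ∧ ‖x‖ < 1} := by
    have h7 : ∀ᵐ x : V, inner ℝ x e ≠ 0 := by
      rw [ae_iff]; simpa using volume_inner_eq_zero he
    filter_upwards [h7] with x hx
    apply propext
    change (0 < inner ℝ x e ∧ ‖x‖ < 1) ↔ (0 ≤ inner ℝ x e ∧ ‖x‖ < 1)
    exact and_congr_left fun _ => ⟨le_of_lt, fun h => lt_of_le_of_ne h (Ne.symm hx)⟩
  rw [h1, h2, h3, setIntegral_congr_set h6]
  ring

/-- Comparison of a centred configuration of directions with a pair of antipodal directions. -/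
theorem integral_antipodal_le_integral (hdim : 2 ≤ Module.finrank ℝ V) {k : ℕ} {e : Fin k → V}
    {w : Fin k → ℝ} (he : ∀ i, ‖e i‖ = 1) (hw : ∀ i, 0 < w i) (hw1 : ∑ i, w i = 1)
    (hw0 : ∑ i, w i • e i = 0) {f : ℝ → ℝ} (hf : Continuous f)
    (hmono : ∀ s t, 0 ≤ s → s ≤ t → f s ≤ f t) {H : V → ℝ} (hH : Measurable H) {M : ℝ}
    (hHM : ∀ u : V, ‖u‖ ≤ 1 → |H u| ≤ M)
    (hfH : ∀ u : V, ‖u‖ = 1 → ∀ i, 0 ≤ inner ℝ u (e i) → (∀ j, inner ℝ u (e j) ≤ inner ℝ u (e i)) →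
      f (inner ℝ u (e i)) ≤ H u)
    {e₀ : V} (he₀ : ‖e₀‖ = 1) :
    ∫ x in Metric.ball (0 : V) 1, f |inner ℝ (‖x‖⁻¹ • x) e₀| ≤
      ∫ x in Metric.ball (0 : V) 1, H (‖x‖⁻¹ • x) := by
  obtain ⟨J, hJ⟩ : ∃ J, J = ∫ x in Metric.ball (0 : V) 1, f |inner ℝ (‖x‖⁻¹ • x) e₀| := ⟨_, rfl⟩
  rw [← hJ]
  obtain ⟨N, hN⟩ := (isCompact_Icc (a := (-1 : ℝ)) (b := 1)).exists_bound_of_continuousOn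
      hf.continuousOn
  have hin : ∀ e : V, ‖e‖ = 1 → ∀ u : V, ‖u‖ ≤ 1 → |inner ℝ u e| ≤ 1 := fun e he u hu => by
    have := abs_real_inner_le_norm u e
    rw [he, mul_one] at this
    exact this.trans hu
  have hi1 : ∀ e : V, ‖e‖ = 1 → IntegrableOn (fun x => f (inner ℝ (‖x‖⁻¹ • x) e))
      (Metric.ball (0 : V) 1) := fun e he =>
    integrableOn_comp_inv_norm_smul (F := fun u => f (inner ℝ u e)) (M := N) (by fun_prop)
      (fun u hu => hN _ (abs_le.1 (hin e he u hu))) volume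
  have hi2 : ∀ e : V, ‖e‖ = 1 → IntegrableOn (fun x => f |inner ℝ (‖x‖⁻¹ • x) e|)
      (Metric.ball (0 : V) 1) := fun e he =>
    integrableOn_comp_inv_norm_smul (F := fun u => f |inner ℝ u e|) (M := N) (by fun_prop)
      (fun u hu => hN _ ⟨by linarith [abs_nonneg (inner ℝ u e)], hin e he u hu⟩) volume
  have hi3 : IntegrableOn (fun x => H (‖x‖⁻¹ • x)) (Metric.ball (0 : V) 1) :=
    integrableOn_comp_inv_norm_smul hH hHM volume
  have hJi : ∀ i, ∫ x in Metric.ball (0 : V) 1, f |inner ℝ (‖x‖⁻¹ • x) (e i)| = J := by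
    intro i
    obtain ⟨g, hg⟩ := exists_linearIsometryEquiv_map_eq (x := e₀) (y := e i) (by rw [he₀, he])
    rw [hJ, ← setIntegral_comp_isometry g (S := Metric.ball (0 : V) 1) (by ext; simp)]
    congr 1
    ext x
    rw [← hg, LinearIsometryEquiv.norm_map, ← LinearIsometryEquiv.map_smul,
      LinearIsometryEquiv.inner_map_map]
  set b := (volume : Measure V).real (Metric.ball (0 : V) 1) with hb
  have hb0 : 0 < b :=
    ENNReal.toReal_pos (Metric.measure_ball_pos _ _ one_pos).ne' measure_ball_lt_top.ne
  -- Ties are given to the smallest index, so that the cells are disjoint and still cover the space.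
  set C : Fin k → Set V := fun i =>
    {x | ∀ j, inner ℝ x (e j) ≤ inner ℝ x (e i) ∧ (j < i → inner ℝ x (e j) < inner ℝ x (e i))} with hC
  have hCm : ∀ i, MeasurableSet (C i) := by
    intro i
    have : C i = ⋂ j, ({x | inner ℝ x (e j) ≤ inner ℝ x (e i)} ∩
        {x | j < i → inner ℝ x (e j) < inner ℝ x (e i)}) := by
      ext x; simp [hC]
    rw [this]
    refine MeasurableSet.iInter fun j => (measurableSet_le (by fun_prop) (by fun_prop)).inter ?_
    by_cases hji : j < i
    · simpa [hji] using measurableSet_lt (f := fun x : V => inner ℝ x (e j))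
        (g := fun x : V => inner ℝ x (e i)) (by fun_prop) (by fun_prop)
    · simp [hji]
  -- The numbers `⟪x, e j⟫` have weighted mean zero, so the largest is nonnegative and each cell
  -- lies in its half-space.
  have hmax0 : ∀ (x : V) i, (∀ j, inner ℝ x (e j) ≤ inner ℝ x (e i)) → 0 ≤ inner ℝ x (e i) := by
    intro x i hi
    have h1 : ∑ j, w j * inner ℝ x (e j) = 0 := by
      simp only [← real_inner_smul_right, ← inner_sum]
      rw [hw0, inner_zero_right]
    have h2 : ∑ j, w j * inner ℝ x (e j) ≤ ∑ j, w j * inner ℝ x (e i) :=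
      Finset.sum_le_sum fun j _ => mul_le_mul_of_nonneg_left (hi j) (hw j).le
    rwa [h1, ← Finset.sum_mul, hw1, one_mul] at h2
  have hdisj : Pairwise (Function.onFun Disjoint fun i => C i ∩ Metric.ball (0 : V) 1) := by
    intro i j hij
    refine Set.disjoint_left.2 fun x hx hx' => ?_
    rcases lt_or_gt_of_ne hij with h | h
    · exact absurd (hx.1 j).1 (not_le.2 ((hx'.1 i).2 h))
    · exact absurd (hx'.1 i).1 (not_le.2 ((hx.1 j).2 h))
  have hk : Nonempty (Fin k) := by
    by_contra h
    rw [not_nonempty_iff] at h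
    simp at hw1
  have hcover : ⋃ i, C i ∩ Metric.ball (0 : V) 1 = Metric.ball (0 : V) 1 := by
    rw [← Set.iUnion_inter]
    refine Set.inter_eq_right.2 fun x _ => ?_
    obtain ⟨i₀, hi₀⟩ := Finite.exists_max fun i => inner ℝ x (e i)
    obtain ⟨i, hi, hmin⟩ := WellFounded.has_min (wellFounded_lt (α := Fin k))
      {i | ∀ j, inner ℝ x (e j) ≤ inner ℝ x (e i)} ⟨i₀, hi₀⟩
    refine Set.mem_iUnion.2 ⟨i, fun j => ⟨hi j, fun hji => ?_⟩⟩
    refine lt_of_le_of_ne (hi j) fun heq => hmin j (fun l => ?_) hji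
    rw [heq]; exact hi l
  have hcell : ∀ i, (volume : Measure V).real (C i ∩ Metric.ball 0 1) * J ≤
      b * ∫ x in C i ∩ Metric.ball (0 : V) 1, H (‖x‖⁻¹ • x) := by
    intro i
    have h1 := halfBall_mean_le_cone_mean (he i) hdim (hCm i) ?_ ?_
      (fun x hx => hmax0 x i fun j => (hx j).1) hf hmono
    · have h2 : b = 2 * (volume : Measure V).real {x : V | 0 ≤ inner ℝ x (e i) ∧ ‖x‖ < 1} := by
        have h3 := integral_ball_eq_two_mul (he i) (F := fun _ => (1 : ℝ)) (fun _ => rfl)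
          (integrableOn_const measure_ball_lt_top.ne)
        simpa only [setIntegral_const, smul_eq_mul, mul_one] using h3
      have h3 : J = 2 * ∫ x in {x : V | 0 ≤ inner ℝ x (e i) ∧ ‖x‖ < 1},
          f (inner ℝ (‖x‖⁻¹ • x) (e i)) := by
        rw [← hJi i, integral_ball_eq_two_mul (he i) (fun x => by simp) (hi2 _ (he i))]
        congr 1
        refine setIntegral_congr_fun (measurableSet_halfBall (e i)) fun x hx => ?_
        rw [abs_of_nonneg]
        rw [real_inner_smul_left]
        exact mul_nonneg (inv_nonneg.2 (norm_nonneg x)) hx.1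
      have h4 : ∫ x in C i ∩ Metric.ball (0 : V) 1, f (inner ℝ (‖x‖⁻¹ • x) (e i)) ≤
          ∫ x in C i ∩ Metric.ball (0 : V) 1, H (‖x‖⁻¹ • x) := by
        refine setIntegral_mono_on_ae ((hi1 _ (he i)).mono_set Set.inter_subset_right)
          (hi3.mono_set Set.inter_subset_right) ((hCm i).inter measurableSet_ball) ?_
        have : Nontrivial V := Module.nontrivial_of_finrank_pos (R := ℝ) (by omega)
        have hne : ∀ᵐ x : V, x ≠ 0 := by simp [ae_iff]
        filter_upwards [hne] with x hx hxC
        have hn : 0 < ‖x‖ := norm_pos_iff.2 hx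
        have hle : ∀ j, inner ℝ (‖x‖⁻¹ • x) (e j) ≤ inner ℝ (‖x‖⁻¹ • x) (e i) := fun j => by
          rw [real_inner_smul_left, real_inner_smul_left]
          exact mul_le_mul_of_nonneg_left (hxC.1 j).1 (inv_nonneg.2 hn.le)
        refine hfH _ ?_ i (hmax0 _ _ hle) hle
        rw [norm_smul, norm_inv, norm_norm, inv_mul_cancel₀ hn.ne']
      rw [h2, h3]
      have h5 := mul_le_mul_of_nonneg_left h4 (measureReal_nonneg (μ := (volume : Measure V))
        (s := {x : V | 0 ≤ inner ℝ x (e i) ∧ ‖x‖ < 1}))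
      linarith
    · intro x hx c hc j
      simp only [real_inner_smul_left]
      exact ⟨mul_le_mul_of_nonneg_left (hx j).1 hc.le, fun h => mul_lt_mul_of_pos_left ((hx j).2 h) hc⟩
    -- Moving along `e i` increases `⟪x, e i⟫` at least as much as any `⟪x, e j⟫`, because `⟪e i, e
    -- j⟫ ≤ 1 = ⟪e i, e i⟫`.
    · intro x hx s hs j
      have hle : inner ℝ (e i) (e j) ≤ inner ℝ (e i) (e i) := by
        have := real_inner_le_norm (e i) (e j)
        rw [he, he, mul_one] at this
        rwa [real_inner_self_eq_norm_sq, he, one_pow]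
      have := mul_le_mul_of_nonneg_left hle hs
      simp only [inner_add_left, real_inner_smul_left]
      exact ⟨add_le_add (hx j).1 this, fun h => add_lt_add_of_lt_of_le ((hx j).2 h) this⟩
  have hsumI : ∫ x in Metric.ball (0 : V) 1, H (‖x‖⁻¹ • x) =
      ∑ i, ∫ x in C i ∩ Metric.ball (0 : V) 1, H (‖x‖⁻¹ • x) := by
    rw [← integral_iUnion_fintype (fun i => (hCm i).inter measurableSet_ball) hdisj
      (fun i => hi3.mono_set Set.inter_subset_right), hcover]
  have hsumV : b = ∑ i, (volume : Measure V).real (C i ∩ Metric.ball 0 1) := by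
    rw [← measureReal_iUnion_fintype hdisj (fun i => (hCm i).inter measurableSet_ball)
      (fun i => ((measure_mono Set.inter_subset_right).trans_lt measure_ball_lt_top).ne), hcover]
  have htot : b * J ≤ b * ∫ x in Metric.ball (0 : V) 1, H (‖x‖⁻¹ • x) := by
    rw [hsumI, Finset.mul_sum]
    conv_lhs => rw [hsumV, Finset.sum_mul]
    exact Finset.sum_le_sum fun i _ => hcell i
  exact le_of_mul_le_mul_left htot hb0

end Cells

/-! ### Comparison of spherical means of continuous functions. -/

section SphereIntegrals

open MeasureTheory

variable {V : Type*} [NormedAddCommGroup V] [InnerProductSpace ℝ V]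

theorem norm_inv_norm_smul {x : V} (hx : x ≠ 0) : ‖‖x‖⁻¹ • x‖ = 1 := by
  rw [norm_smul, norm_inv, norm_norm, inv_mul_cancel₀ (norm_ne_zero_iff.2 hx)]

variable [FiniteDimensional ℝ V]

theorem exists_abs_le_of_continuous {F : V → ℝ} (hF : Continuous F) :
    ∃ M, ∀ u, ‖u‖ ≤ 1 → |F u| ≤ M := by
  obtain ⟨M, hM⟩ := (isCompact_closedBall (0 : V) 1).exists_bound_of_continuousOn hF.continuousOn
  exact ⟨M, fun u hu => hM u (mem_closedBall_zero_iff.2 hu)⟩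

variable [MeasurableSpace V] [BorelSpace V]

theorem integrableOn_comp_inv_norm_smul_of_continuous {F : V → ℝ} (hF : Continuous F) :
    IntegrableOn (fun x => F (‖x‖⁻¹ • x)) (Metric.ball 0 1) := by
  obtain ⟨M, hM⟩ := exists_abs_le_of_continuous hF
  exact integrableOn_comp_inv_norm_smul hF.measurable hM volume

theorem integral_comp_inv_norm_smul_mono [Nontrivial V] {F G : V → ℝ} (hF : Continuous F)
    (hG : Continuous G) (h : ∀ u, ‖u‖ = 1 → F u ≤ G u) :
    ∫ x in Metric.ball (0 : V) 1, F (‖x‖⁻¹ • x) ≤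
      ∫ x in Metric.ball (0 : V) 1, G (‖x‖⁻¹ • x) := by
  refine integral_mono_ae (integrableOn_comp_inv_norm_smul_of_continuous hF)
    (integrableOn_comp_inv_norm_smul_of_continuous hG) (ae_restrict_of_ae ?_)
  have hne : ∀ᵐ x : V, x ≠ 0 := by simp [ae_iff]
  filter_upwards [hne] with x hx
  exact h _ (norm_inv_norm_smul hx)

/-- A nonnegative function with vanishing integral is zero almost everywhere, hence everywhere on
the punctured ball by continuity. The value at `u` is read off at `(1 / 2) • u`. -/
theorem eq_of_integral_comp_inv_norm_smul_le [Nontrivial V] {F G : V → ℝ} (hF : Continuous F)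
    (hG : Continuous G) (h : ∀ u, ‖u‖ = 1 → F u ≤ G u)
    (hint : ∫ x in Metric.ball (0 : V) 1, G (‖x‖⁻¹ • x) ≤
      ∫ x in Metric.ball (0 : V) 1, F (‖x‖⁻¹ • x)) {u : V} (hu : ‖u‖ = 1) : F u = G u := by
  have hFi := integrableOn_comp_inv_norm_smul_of_continuous hF
  have hGi := integrableOn_comp_inv_norm_smul_of_continuous hG
  have hne : ∀ᵐ x : V, x ≠ 0 := by simp [ae_iff]
  have hnonneg : 0 ≤ᵐ[volume.restrict (Metric.ball (0 : V) 1)]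
      fun x => G (‖x‖⁻¹ • x) - F (‖x‖⁻¹ • x) := by
    refine ae_restrict_of_ae ?_
    filter_upwards [hne] with x hx
    exact sub_nonneg.2 (h _ (norm_inv_norm_smul hx))
  have hzero := (setIntegral_eq_zero_iff_of_nonneg_ae hnonneg (hGi.sub hFi)).1 (by
    refine le_antisymm ?_ (integral_nonneg_of_ae hnonneg)
    rw [integral_sub hGi hFi]
    linarith)
  have hU : IsOpen (Metric.ball (0 : V) 1 \ {0}) :=
    Metric.isOpen_ball.sdiff isClosed_singleton
  have hcont : ∀ F : V → ℝ, Continuous F →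
      ContinuousOn (fun x : V => F (‖x‖⁻¹ • x)) (Metric.ball (0 : V) 1 \ {0}) := fun F hF =>
    hF.comp_continuousOn ((continuous_norm.continuousOn.inv₀ fun x hx =>
      norm_ne_zero_iff.2 hx.2).smul continuousOn_id)
  have heq := Measure.eqOn_open_of_ae_eq (μ := (volume : Measure V))
    (ae_restrict_of_ae_restrict_of_subset Set.sdiff_subset hzero) hU
    ((hcont G hG).sub (hcont F hF)) continuousOn_const
  have hu0 : u ≠ 0 := norm_ne_zero_iff.1 (by rw [hu]; norm_num)
  have hhalf : ‖(1 / 2 : ℝ) • u‖ = 1 / 2 := by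
    rw [norm_smul, hu, mul_one]; norm_num
  have hmem : (1 / 2 : ℝ) • u ∈ Metric.ball (0 : V) 1 \ {0} := by
    refine ⟨?_, smul_ne_zero (by norm_num) hu0⟩
    rw [mem_ball_zero_iff, hhalf]; norm_num
  have h1 := heq hmem
  simp only [hhalf, smul_smul] at h1
  norm_num at h1
  linarith

end SphereIntegrals

/-! ### Unit vectors with balanced positive weights. -/

section Directions

variable {V : Type*} [NormedAddCommGroup V] [InnerProductSpace ℝ V]

theorem exists_inner_neg_of_sum_smul_eq_zero {k : ℕ} {e : Fin k → V} {w : Fin k → ℝ}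
    (he : ∀ i, ‖e i‖ = 1) (hw : ∀ i, 0 < w i) (hw0 : ∑ i, w i • e i = 0) (i : Fin k) :
    ∃ j, inner ℝ (e i) (e j) < 0 := by
  by_contra! h
  have h1 : ∑ j, w j * inner ℝ (e i) (e j) = 0 := by
    simp only [← real_inner_smul_right, ← inner_sum]
    rw [hw0, inner_zero_right]
  have h2 := (Finset.sum_eq_zero_iff_of_nonneg fun j _ => mul_nonneg (hw j).le (h j)).1 h1 i
    (Finset.mem_univ i)
  rw [real_inner_self_eq_norm_sq, he, one_pow, mul_one] at h2
  exact (hw i).ne' h2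

theorem exists_inner_nonneg_of_sum_smul_eq_zero {k : ℕ} {e : Fin k → V} {w : Fin k → ℝ}
    (hw : ∀ i, 0 < w i) (hw1 : ∑ i, w i = 1) (hw0 : ∑ i, w i • e i = 0) (u : V) :
    ∃ i, 0 ≤ inner ℝ u (e i) := by
  by_contra! h
  have h1 : ∑ j, w j * inner ℝ u (e j) = 0 := by
    simp only [← real_inner_smul_right, ← inner_sum]
    rw [hw0, inner_zero_right]
  have h2 : (Finset.univ : Finset (Fin k)).Nonempty := by
    rw [Finset.nonempty_iff_ne_empty]
    intro h2
    rw [h2] at hw1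
    simp at hw1
  exact (Finset.sum_neg (fun j _ => mul_neg_of_pos_of_neg (hw j) (h j)) h2).ne h1

/-- Among finitely many unit vectors, either two are antipodal or the maximum of the inner product
with some unit vector is positive and attained twice. -/
theorem exists_antipodal_or_exists_inner_eq {k : ℕ} {e : Fin k → V} (he : ∀ i, ‖e i‖ = 1)
    {i₀ j₀ : Fin k} (hij : i₀ ≠ j₀) :
    (∃ i j, e j = -e i) ∨ ∃ (u : V) (i j : Fin k), ‖u‖ = 1 ∧ i ≠ j ∧ 0 < inner ℝ u (e i) ∧
      inner ℝ u (e j) = inner ℝ u (e i) ∧ ∀ l, inner ℝ u (e l) ≤ inner ℝ u (e i) := by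
  rw [or_iff_not_imp_left]
  intro hanti
  have hne : e i₀ ≠ -e j₀ := fun h => hanti ⟨j₀, i₀, h⟩
  -- Along the segment from `e i₀` to `e j₀`, the index `i₀` is maximal at the start and some other
  -- index does at least as well at the end. The intermediate value theorem gives a tie.
  set γ : ℝ → V := fun s => (1 - s) • e i₀ + s • e j₀ with hγ
  have hs : (Finset.univ.erase i₀).Nonempty := ⟨j₀, Finset.mem_erase.2 ⟨hij.symm, Finset.mem_univ _⟩⟩
  set b : ℝ → ℝ := fun s => (Finset.univ.erase i₀).sup' hs fun j => inner ℝ (γ s) (e j) with hb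
  have hγc : Continuous γ := by fun_prop
  have hbc : Continuous b := Continuous.finset_sup'_apply hs fun j _ => by fun_prop
  have hle1 : ∀ i j, inner ℝ (e i) (e j) ≤ 1 := fun i j => by
    have := real_inner_le_norm (e i) (e j)
    rwa [he, he, mul_one] at this
  have hself : ∀ i, inner ℝ (e i) (e i) = 1 := fun i => by
    rw [real_inner_self_eq_norm_sq, he, one_pow]
  obtain ⟨s, -, hs0⟩ := intermediate_value_Icc (zero_le_one (α := ℝ))
    (f := fun s => b s - inner ℝ (γ s) (e i₀)) (by fun_prop) (show (0 : ℝ) ∈ _ by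
      constructor
      · have h1 : b 0 ≤ 1 := Finset.sup'_le hs _ fun j _ => by simpa [hγ] using hle1 i₀ j
        have h2 : inner ℝ (γ 0) (e i₀) = 1 := by simp [hγ, he]
        linarith
      · have h1 : inner ℝ (γ 1) (e j₀) ≤ b 1 := Finset.le_sup' (fun j => inner ℝ (γ 1) (e j))
          (Finset.mem_erase.2 ⟨hij.symm, Finset.mem_univ _⟩)
        have h2 : inner ℝ (γ 1) (e j₀) = 1 := by simp [hγ, he]
        have h3 : inner ℝ (γ 1) (e i₀) ≤ 1 := by simpa [hγ] using hle1 j₀ i₀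
        linarith)
  simp only [sub_eq_zero] at hs0
  obtain ⟨j, hj, hbj⟩ := Finset.exists_mem_eq_sup' hs fun j => inner ℝ (γ s) (e j)
  have hmax : ∀ l, inner ℝ (γ s) (e l) ≤ inner ℝ (γ s) (e i₀) := by
    intro l
    rcases eq_or_ne l i₀ with rfl | hl
    · rfl
    · rw [← hs0]
      exact Finset.le_sup' (fun j => inner ℝ (γ s) (e j)) (Finset.mem_erase.2 ⟨hl, Finset.mem_univ _⟩)
  -- The inner products of `γ s` with `e i₀` and `e j₀` sum to `1 + ⟪e i₀, e j₀⟫`, which is positive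
  -- without antipodal pairs, and the first is the larger.
  have hpos : 0 < inner ℝ (γ s) (e i₀) := by
    have h1 : inner ℝ (γ s) (e i₀) + inner ℝ (γ s) (e j₀) = 1 + inner ℝ (e i₀) (e j₀) := by
      simp only [hγ, inner_add_left, real_inner_smul_left, hself, real_inner_comm (e i₀) (e j₀)]
      ring
    have h2 : -1 < inner ℝ (e i₀) (e j₀) := by
      by_contra! h
      refine hne ((inner_eq_one_iff_of_norm_eq_one (𝕜 := ℝ) (he i₀) (by rw [norm_neg, he])).1 ?_)
      have := hle1 i₀ j₀
      have h4 : -inner ℝ (e i₀) (e j₀) ≤ 1 := by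
        have h3 := neg_le_of_abs_le (abs_real_inner_le_norm (e i₀) (e j₀))
        rw [he, he] at h3
        linarith
      rw [inner_neg_right]
      linarith
    have := hmax j₀
    linarith
  have hγ0 : γ s ≠ 0 := fun h => by rw [h, inner_zero_left] at hpos; exact lt_irrefl _ hpos
  have hn : 0 < ‖γ s‖⁻¹ := inv_pos.2 (norm_pos_iff.2 hγ0)
  refine ⟨‖γ s‖⁻¹ • γ s, i₀, j, ?_, (Finset.ne_of_mem_erase hj).symm, ?_, ?_, fun l => ?_⟩
  · rw [norm_smul, norm_inv, norm_norm, inv_mul_cancel₀ (norm_ne_zero_iff.2 hγ0)]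
  · rw [real_inner_smul_left]; exact mul_pos hn hpos
  · rw [real_inner_smul_left, real_inner_smul_left, ← hs0, ← hbj]
  · rw [real_inner_smul_left, real_inner_smul_left]
    exact mul_le_mul_of_nonneg_left (hmax l) hn.le

/-- The centre of a ball of radius `r` that contains contact points at distance `h` from `o`. -/
theorem norm_sub_sq_le_of_contact {k : ℕ} {e : Fin k → V} {w : Fin k → ℝ} (he : ∀ i, ‖e i‖ = 1)
    (hw : ∀ i, 0 < w i) (hw1 : ∑ i, w i = 1) (hw0 : ∑ i, w i • e i = 0) {r h : ℝ} {o c : V}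
    (hc : ∀ i, ‖o + h • e i - c‖ ≤ r) :
    ‖c - o‖ ^ 2 ≤ r ^ 2 - h ^ 2 := by
  have h1 : ∀ i, ‖o + h • e i - c‖ ^ 2 = ‖c - o‖ ^ 2 - 2 * h * inner ℝ (c - o) (e i) + h ^ 2 := by
    intro i
    have : o + h • e i - c = h • e i - (c - o) := by abel
    rw [this, norm_sub_sq_real, norm_smul, he, real_inner_smul_left, mul_one, Real.norm_eq_abs,
      sq_abs, real_inner_comm]
    ring
  have h2 : ∑ j, w j * inner ℝ (c - o) (e j) = 0 := by
    simp only [← real_inner_smul_right, ← inner_sum]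
    rw [hw0, inner_zero_right]
  -- In the weighted mean of the squared distances the cross terms cancel, leaving `‖c - o‖² + h²`.
  have h3 : ∑ i, w i * ‖o + h • e i - c‖ ^ 2 ≤ ∑ i, w i * r ^ 2 :=
    Finset.sum_le_sum fun i _ => mul_le_mul_of_nonneg_left
      (pow_le_pow_left₀ (norm_nonneg _) (hc i) 2) (hw i).le
  have h4 : ∑ i, w i * ‖o + h • e i - c‖ ^ 2 = ‖c - o‖ ^ 2 + h ^ 2 := by
    calc _ = ∑ i, (w i * (‖c - o‖ ^ 2 + h ^ 2) - 2 * h * (w i * inner ℝ (c - o) (e i))) :=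
          Finset.sum_congr rfl fun i _ => by rw [h1]; ring
      _ = _ := by
          rw [Finset.sum_sub_distrib, ← Finset.sum_mul, ← Finset.mul_sum, h2, hw1]; ring
  rw [h4, ← Finset.sum_mul, hw1] at h3
  linarith

/-- When `‖c - o‖` is extremal, each ball condition reads `⟪c - o, e i⟫ ≥ 0`; the weighted mean of
these numbers is zero. -/
theorem inner_eq_zero_of_contact {k : ℕ} {e : Fin k → V} {w : Fin k → ℝ} (he : ∀ i, ‖e i‖ = 1)
    (hw : ∀ i, 0 < w i) (hw0 : ∑ i, w i • e i = 0) {r h : ℝ} (hh : 0 < h) {o c : V}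
    (hc : ∀ i, ‖o + h • e i - c‖ ≤ r) (hco : ‖c - o‖ ^ 2 = r ^ 2 - h ^ 2) (i : Fin k) :
    inner ℝ (c - o) (e i) = 0 := by
  have h3 : ∀ i, 0 ≤ inner ℝ (c - o) (e i) := by
    intro i
    have h4 : o + h • e i - c = h • e i - (c - o) := by abel
    have h5 := pow_le_pow_left₀ (norm_nonneg _) (hc i) 2
    rw [h4, norm_sub_sq_real, norm_smul, he, real_inner_smul_left, mul_one, Real.norm_eq_abs,
      sq_abs, real_inner_comm, hco] at h5
    have h6 : 0 ≤ h * inner ℝ (c - o) (e i) := by linarith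
    exact nonneg_of_mul_nonneg_right h6 hh
  have h2 : ∑ j, w j * inner ℝ (c - o) (e j) = 0 := by
    simp only [← real_inner_smul_right, ← inner_sum]
    rw [hw0, inner_zero_right]
  have h7 := (Finset.sum_eq_zero_iff_of_nonneg fun j _ => mul_nonneg (hw j).le (h3 j)).1 h2 i
    (Finset.mem_univ i)
  exact (mul_eq_zero.1 h7).resolve_left (hw i).ne'

end Directions

/-! ### Bounds and equality cases for `lam`-convex bodies. -/

variable {n : ℕ} {lam : ℝ}

theorem IsLambdaConvexBody.exists_closedBall (hn : 2 ≤ n) (hlam : 0 < lam) {K : Set (E n)}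
    (hK : IsLambdaConvexBody lam K) {u : E n} (hu : ‖u‖ = 1) :
    ∃ c, (∀ x ∈ K, ‖x - c‖ ≤ 1 / lam) ∧ supportFn K u = inner ℝ u c + 1 / lam := by
  obtain ⟨⟨hKc, hKcv, hKi⟩, hloc⟩ := hK
  obtain ⟨p, hp, hpu⟩ := exists_inner_eq_supportFn hKc (hKi.mono interior_subset) u
  have hsub := subset_closedBall_of_support (by rw [finrank_euclideanSpace_fin]; exact hn) hKc hKcv
    hKi (one_div_pos.2 hlam) hloc hp hu fun x hx => by
      rw [hpu]; exact inner_le_supportFn hKc hx u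
  refine ⟨_, fun x hx => mem_closedBall_iff_norm.1 (hsub hx), ?_⟩
  rw [inner_sub_right, real_inner_smul_right, real_inner_self_eq_norm_sq, hu, hpu]
  ring

/-- The support function of a `lam`-convex body with a contact point in the direction `e`. -/
theorem IsLambdaConvexBody.profile_le_supportFn (hn : 2 ≤ n) (hlam : 0 < lam) {K : Set (E n)}
    (hK : IsLambdaConvexBody lam K) {h : ℝ} (hh : 0 < h) (hhr : h ≤ 1 / lam) {o e : E n}
    (hc : ∀ c, (∀ x ∈ K, ‖x - c‖ ≤ 1 / lam) → ‖c - o‖ ^ 2 ≤ (1 / lam) ^ 2 - h ^ 2)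
    (he : ‖e‖ = 1) (hmem : o + h • e ∈ K) {u : E n} (hu : ‖u‖ = 1) (h0 : 0 ≤ inner ℝ u e) :
    profile (1 / lam) h (inner ℝ u e) ≤ supportFn K u - inner ℝ u o := by
  unfold profile
  split_ifs with ht
  · have := inner_le_supportFn hK.1.1 hmem u
    rw [inner_add_right, real_inner_smul_right] at this
    linarith
  · obtain ⟨c, hKc, hcu⟩ := hK.exists_closedBall hn hlam hu
    have h1 : ‖h • e - (c - o)‖ ≤ 1 / lam := by
      rw [show h • e - (c - o) = o + h • e - c by abel]; exact hKc _ hmem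
    have h2 := (neg_inner_le_sqrt_mul_sqrt hh hhr he hu (hc c hKc) h1 h0 (not_le.1 ht)).1
    rw [inner_sub_right] at h2
    linarith

/-- Equality determines the supporting ball. In the vertex branch both contact points equal `c + r •
u`. In the other branch `c - o` has maximal norm and is a negative multiple of `u - ⟪u, e i⟫ • e i`;
being orthogonal to `e j`, it yields `⟪e i, e j⟫ = 1`. This needs `h < 1 / lam`, so that `c ≠ o`. -/
theorem IsLambdaConvexBody.eq_of_profile_eq_supportFn (hn : 2 ≤ n) (hlam : 0 < lam)
    {K : Set (E n)} (hK : IsLambdaConvexBody lam K) {h : ℝ} (hh : 0 < h) (hhr : h < 1 / lam)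
    {o : E n} {k : ℕ} {e : Fin k → E n} {w : Fin k → ℝ} (he : ∀ i, ‖e i‖ = 1) (hw : ∀ i, 0 < w i)
    (hw1 : ∑ i, w i = 1) (hw0 : ∑ i, w i • e i = 0) (hmem : ∀ i, o + h • e i ∈ K) {u : E n}
    (hu : ‖u‖ = 1) {i j : Fin k} (hpos : 0 < inner ℝ u (e i))
    (hij : inner ℝ u (e j) = inner ℝ u (e i))
    (heq : supportFn K u - inner ℝ u o = profile (1 / lam) h (inner ℝ u (e i))) :
    e i = e j := by
  obtain ⟨c, hKc, hcu⟩ := hK.exists_closedBall hn hlam hu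
  obtain ⟨r, hr⟩ : ∃ r, r = 1 / lam := ⟨_, rfl⟩
  rw [← hr] at hhr hKc hcu heq
  unfold profile at heq
  split_ifs at heq with ht
  · have key : ∀ l, inner ℝ u (e l) = inner ℝ u (e i) → o + h • e l - c = r • u := by
      intro l hl
      have h1 := hKc _ (hmem l)
      have h2 : inner ℝ (o + h • e l - c) u = r := by
        rw [real_inner_comm, inner_sub_right, inner_add_right, real_inner_smul_right, hl]
        linarith
      have h3 : ‖o + h • e l - c - r • u‖ ^ 2 ≤ 0 := by
        rw [norm_sub_sq_real, real_inner_smul_right, h2, norm_smul, hu, mul_one, Real.norm_eq_abs,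
          sq_abs]
        nlinarith [norm_nonneg (o + h • e l - c)]
      rw [← sub_eq_zero, ← norm_eq_zero]
      exact pow_eq_zero_iff two_ne_zero |>.1 (le_antisymm h3 (sq_nonneg _))
    have h4 : h • e i = h • e j := by
      have := (key i rfl).trans (key j hij).symm
      simpa using this
    exact smul_right_injective _ hh.ne' h4
  · push Not at ht
    have h0 := norm_sub_sq_le_of_contact he hw hw1 hw0 fun l => hKc _ (hmem l)
    have h1 : ‖h • e i - (c - o)‖ ≤ r := by
      rw [show h • e i - (c - o) = o + h • e i - c by abel]; exact hKc _ (hmem i)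
    have h2 := (neg_inner_le_sqrt_mul_sqrt hh hhr.le (he i) hu h0 h1 hpos.le ht).2 (by
      rw [inner_sub_right]; linarith) hpos
    have hr0 : 0 < r := hh.trans hhr
    have hq : 0 < √(r ^ 2 - h ^ 2) := Real.sqrt_pos.2 (by nlinarith)
    set t := inner ℝ u (e i) with htd
    have ht1 : t < 1 := by
      by_contra! h3
      nlinarith
    have hs : 0 < √(1 - t ^ 2) := Real.sqrt_pos.2 (by nlinarith)
    have hnorm := congrArg (fun x => ‖x‖ ^ 2) h2
    simp only [norm_smul, mul_pow, norm_neg, Real.norm_eq_abs, sq_abs] at hnorm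
    rw [Real.sq_sqrt (Real.sqrt_pos.1 hs).le, Real.sq_sqrt (Real.sqrt_pos.1 hq).le,
      norm_sub_smul_self_sq (he i) hu, mul_comm] at hnorm
    have hco : ‖c - o‖ ^ 2 = r ^ 2 - h ^ 2 :=
      mul_right_cancel₀ (Real.sqrt_pos.1 hs).ne' hnorm
    have horth := inner_eq_zero_of_contact he hw hw0 hh (fun l => hKc _ (hmem l)) hco j
    have h5 := congrArg (fun x => inner ℝ x (e j)) h2
    simp only [real_inner_smul_left, horth, inner_sub_left, mul_zero, hij] at h5
    have h6 := (mul_eq_zero.1 h5.symm).resolve_left (neg_ne_zero.2 hq.ne')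
    have h7 : inner ℝ (e i) (e j) = 1 := by
      have : t * (1 - inner ℝ (e i) (e j)) = 0 := by linarith
      linarith [(mul_eq_zero.1 this).resolve_left hpos.ne']
    exact (inner_eq_one_iff_of_norm_eq_one (𝕜 := ℝ) (he i) (he j)).1 h7

open MeasureTheory in
/-- The mean width in terms of the support function relative to a base point. -/
theorem kappa_mul_intrinsicVolume_one_eq (hn : 1 ≤ n) {K : Set (E n)} (hK : IsCompact K)
    (hKc : Convex ℝ K) (hne : K.Nonempty) (o : E n) :
    kappa (n - 1) * intrinsicVolume 1 K =
      n * ∫ x in Metric.ball (0 : E n) 1,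
        (supportFn K (‖x‖⁻¹ • x) - inner ℝ (‖x‖⁻¹ • x) o) := by
  have h1 : ∫ x in Metric.ball (0 : E n) 1, inner ℝ (‖x‖⁻¹ • x) o = 0 := by
    have h2 := setIntegral_comp_isometry (LinearIsometryEquiv.neg ℝ (E := E n))
      (S := Metric.ball (0 : E n) 1) (by ext; simp) fun x => inner ℝ (‖x‖⁻¹ • x) o
    simp only [LinearIsometryEquiv.coe_neg, norm_neg, smul_neg, inner_neg_left, integral_neg] at h2
    linarith
  rw [integral_sub (integrableOn_comp_inv_norm_smul_of_continuous (continuous_supportFn hK))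
    (integrableOn_comp_inv_norm_smul_of_continuous (F := fun u => inner ℝ u o) (by fun_prop)), h1,
    sub_zero, kappa_mul_intrinsicVolume_one hn hK hKc hne]

theorem continuous_supportFn_sub {K : Set (E n)} (hK : IsCompact K) (o : E n) :
    Continuous fun u => supportFn K u - inner ℝ u o :=
  (continuous_supportFn hK).sub (by fun_prop)

theorem continuous_profile_abs_inner {r h : ℝ} (hh : 0 < h) (hhr : h ≤ r) (e : E n) :
    Continuous fun u : E n => profile r h |inner ℝ u e| :=
  (continuous_profile hh hhr).comp (by fun_prop)

theorem nontrivial_of_two_le (hn : 2 ≤ n) : Nontrivial (E n) :=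
  Module.nontrivial_of_finrank_pos (R := ℝ) (by rw [finrank_euclideanSpace_fin]; omega)

theorem kappa_mul_intrinsicVolume_one_spindle (hn : 2 ≤ n) {m e : E n} (he : ‖e‖ = 1) {h : ℝ}
    (hh : 0 < h) (hhr : h ≤ 1 / lam) :
    kappa (n - 1) * intrinsicVolume 1 (spindle lam (m + h • e) (m - h • e)) =
      n * ∫ x in Metric.ball (0 : E n) 1, profile (1 / lam) h |inner ℝ (‖x‖⁻¹ • x) e| := by
  have := nontrivial_of_two_le hn
  have hc := isCompact_spindle (m := m) he hh hhr
  have heq : ∀ u : E n, ‖u‖ = 1 → supportFn (spindle lam (m + h • e) (m - h • e)) u - inner ℝ u m =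
      profile (1 / lam) h |inner ℝ u e| := fun u hu => by
    rw [supportFn_spindle he hu hh hhr]; ring
  rw [kappa_mul_intrinsicVolume_one_eq (by omega) hc (convex_spindle _ _)
    ⟨_, left_mem_spindle _ _⟩ m]
  congr 1
  have c1 := continuous_supportFn_sub hc m
  have c2 := continuous_profile_abs_inner hh hhr e
  exact le_antisymm (integral_comp_inv_norm_smul_mono c1 c2 fun u hu => (heq u hu).le)
    (integral_comp_inv_norm_smul_mono c2 c1 fun u hu => (heq u hu).ge)

/-- All spindles of the same circumradius have the same mean width. -/
theorem intrinsicVolume_one_eq_of_isSpindle (hn : 2 ≤ n) {S T : Set (E n)} (hS : IsSpindle lam S)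
    (hT : IsSpindle lam T) (hR : circumradius S = circumradius T) :
    intrinsicVolume 1 S = intrinsicVolume 1 T := by
  obtain ⟨m, e, h, he, hh, hhr, rfl⟩ := hS.exists_eq
  obtain ⟨m', e', h', he', hh', hhr', rfl⟩ := hT.exists_eq
  rw [circumradius_spindle he hh hhr, circumradius_spindle he' hh' hhr'] at hR
  subst hR
  refine mul_left_cancel₀ (kappa_pos (n - 1)).ne' ?_
  rw [kappa_mul_intrinsicVolume_one_spindle hn he hh hhr,
    kappa_mul_intrinsicVolume_one_spindle hn he' hh hhr]
  obtain ⟨g, hg⟩ := exists_linearIsometryEquiv_map_eq (x := e') (y := e) (by rw [he, he'])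
  rw [← setIntegral_comp_isometry g (S := Metric.ball (0 : E n) 1) (by ext; simp)]
  simp only [← hg, LinearIsometryEquiv.norm_map, ← LinearIsometryEquiv.map_smul,
    LinearIsometryEquiv.inner_map_map]

/-- A `lam`-convex body of the mean width of a spindle with antipodal contact points is a
spindle. -/
theorem IsLambdaConvexBody.eq_spindle (hn : 2 ≤ n) (hlam : 0 < lam) {K : Set (E n)}
    (hK : IsLambdaConvexBody lam K) {h : ℝ} (hh : 0 < h) (hhr : h ≤ 1 / lam) {o e : E n}
    (hc : ∀ c, (∀ x ∈ K, ‖x - c‖ ≤ 1 / lam) → ‖c - o‖ ^ 2 ≤ (1 / lam) ^ 2 - h ^ 2)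
    (he : ‖e‖ = 1) (hmem : o + h • e ∈ K) (hmem' : o + h • (-e) ∈ K)
    (hle : ∫ x in Metric.ball (0 : E n) 1,
        (supportFn K (‖x‖⁻¹ • x) - inner ℝ (‖x‖⁻¹ • x) o) ≤
      ∫ x in Metric.ball (0 : E n) 1, profile (1 / lam) h |inner ℝ (‖x‖⁻¹ • x) e|) :
    K = spindle lam (o + h • e) (o - h • e) := by
  have := nontrivial_of_two_le hn
  have hbound : ∀ u : E n, ‖u‖ = 1 →
      profile (1 / lam) h |inner ℝ u e| ≤ supportFn K u - inner ℝ u o := by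
    intro u hu
    rcases le_total 0 (inner ℝ u e) with h0 | h0
    · rw [abs_of_nonneg h0]
      exact hK.profile_le_supportFn hn hlam hh hhr hc he hmem hu h0
    · rw [abs_of_nonpos h0, ← inner_neg_right]
      exact hK.profile_le_supportFn hn hlam hh hhr hc (by rwa [norm_neg]) hmem' hu (by
        rw [inner_neg_right]; linarith)
  have heq : ∀ u : E n, ‖u‖ = 1 →
      supportFn K u = supportFn (spindle lam (o + h • e) (o - h • e)) u := by
    intro u hu
    rw [supportFn_spindle he hu hh hhr]
    have := eq_of_integral_comp_inv_norm_smul_le (continuous_profile_abs_inner hh hhr e)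
      (continuous_supportFn_sub hK.1.1 o) hbound hle hu
    linarith
  have hS := isCompact_spindle (m := o) he hh hhr
  exact Set.Subset.antisymm
    (subset_of_supportFn_le hK.1.1 hS ⟨_, left_mem_spindle _ _⟩ (convex_spindle _ _)
      fun u hu => (heq u hu).le)
    (subset_of_supportFn_le hS hK.1.1 (hK.1.2.2.mono interior_subset) hK.1.2.1
      fun u hu => (heq u hu).ge)

/-- Under equality in the comparison of mean widths, there are antipodal contact points. -/
theorem IsLambdaConvexBody.exists_antipodal (hn : 2 ≤ n) (hlam : 0 < lam) {K : Set (E n)}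
    (hK : IsLambdaConvexBody lam K) {h : ℝ} (hh : 0 < h) (hhr : h ≤ 1 / lam) {o : E n}
    {k : ℕ} {e : Fin k → E n} {w : Fin k → ℝ} (hinj : Function.Injective e) (he : ∀ i, ‖e i‖ = 1)
    (hw : ∀ i, 0 < w i) (hw1 : ∑ i, w i = 1) (hw0 : ∑ i, w i • e i = 0)
    (hmem : ∀ i, o + h • e i ∈ K) {e₀ : E n} (he₀ : ‖e₀‖ = 1)
    (hle : ∫ x in Metric.ball (0 : E n) 1,
        (supportFn K (‖x‖⁻¹ • x) - inner ℝ (‖x‖⁻¹ • x) o) ≤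
      ∫ x in Metric.ball (0 : E n) 1, profile (1 / lam) h |inner ℝ (‖x‖⁻¹ • x) e₀|) :
    ∃ i, o + h • (-e i) ∈ K := by
  have := nontrivial_of_two_le hn
  have hc : ∀ c, (∀ x ∈ K, ‖x - c‖ ≤ 1 / lam) → ‖c - o‖ ^ 2 ≤ (1 / lam) ^ 2 - h ^ 2 :=
    fun c hKc => norm_sub_sq_le_of_contact he hw hw1 hw0 fun i => hKc _ (hmem i)
  have hbound : ∀ u : E n, ‖u‖ = 1 → ∀ i, 0 ≤ inner ℝ u (e i) →
      profile (1 / lam) h (inner ℝ u (e i)) ≤ supportFn K u - inner ℝ u o :=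
    fun u hu i h0 => hK.profile_le_supportFn hn hlam hh hhr hc (he i) (hmem i) hu h0
  obtain ⟨i₀, -⟩ := exists_inner_nonneg_of_sum_smul_eq_zero hw hw1 hw0 (0 : E n)
  rcases hhr.eq_or_lt with hhr' | hhr'
  -- For `h = 1 / lam` the profile is at least `h`, so `K` contains the whole ball of radius `h`
  -- around `o`.
  · refine ⟨i₀, ?_⟩
    have hsub : Metric.closedBall o h ⊆ K := by
      refine subset_of_supportFn_le (isCompact_closedBall _ _) hK.1.1
        (hK.1.2.2.mono interior_subset) hK.1.2.1 fun u hu => ?_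
      refine supportFn_le (Metric.nonempty_closedBall.2 hh.le) fun x hx => ?_
      obtain ⟨i, hi⟩ := exists_inner_nonneg_of_sum_smul_eq_zero hw hw1 hw0 u
      have h1 := hbound u hu i hi
      have h2 : h ≤ profile (1 / lam) h (inner ℝ u (e i)) := by
        rw [← hhr']
        unfold profile
        split_ifs with h3
        · linarith
        · simp
      have h3 := real_inner_le_norm u (x - o)
      rw [hu, one_mul, inner_sub_right] at h3
      linarith [mem_closedBall_iff_norm.1 hx]
    refine hsub (mem_closedBall_iff_norm.2 ?_)
    rw [add_sub_cancel_left, norm_smul, norm_neg, he, mul_one, Real.norm_of_nonneg hh.le]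
  · obtain ⟨j₀, hj₀⟩ := exists_inner_neg_of_sum_smul_eq_zero he hw hw0 i₀
    have hij : i₀ ≠ j₀ := by
      rintro rfl
      rw [real_inner_self_eq_norm_sq, he] at hj₀
      norm_num at hj₀
    rcases exists_antipodal_or_exists_inner_eq he hij with ⟨i, j, hji⟩ | ⟨u, i, j, hu, hne, hpos, hj, hmax⟩
    · exact ⟨i, hji ▸ hmem j⟩
    · exfalso
      have hs : (Finset.univ : Finset (Fin k)).Nonempty := ⟨i₀, Finset.mem_univ _⟩
      -- The function `profile (1 / lam) h (m u)` lies below the relative support function and, by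
      -- the cell comparison, has at least the mean of the spindle. So `hle` forces equality
      -- pointwise, in particular at the direction with a tie.
      set m : E n → ℝ := fun u => Finset.univ.sup' hs fun i => inner ℝ u (e i) with hm
      have hmc : Continuous m := Continuous.finset_sup'_apply hs fun i _ => by fun_prop
      have hmi : ∀ (u : E n) i, (∀ l, inner ℝ u (e l) ≤ inner ℝ u (e i)) → m u = inner ℝ u (e i) :=
        fun u i hi => le_antisymm (Finset.sup'_le hs _ fun l _ => hi l)
          (Finset.le_sup' (fun i => inner ℝ u (e i)) (Finset.mem_univ i))
      have hpc : Continuous fun u => profile (1 / lam) h (m u) := (continuous_profile hh hhr).comp hmc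
      obtain ⟨M, hM⟩ := exists_abs_le_of_continuous hpc
      have h1 := integral_antipodal_le_integral
        (by rw [finrank_euclideanSpace_fin]; exact hn) he hw hw1 hw0
        (continuous_profile hh hhr) (fun s t hs hst => profile_mono hh hhr hs hst)
        hpc.measurable hM (fun u _ i _ hi => by rw [hmi u i hi]) he₀
      have h2 := eq_of_integral_comp_inv_norm_smul_le hpc (continuous_supportFn_sub hK.1.1 o)
        (fun u hu => by
          obtain ⟨i, hi⟩ := exists_inner_nonneg_of_sum_smul_eq_zero hw hw1 hw0 u
          obtain ⟨l, -, hl⟩ := Finset.exists_mem_eq_sup' hs fun i => inner ℝ u (e i)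
          have hl' : m u = inner ℝ u (e l) := hl
          rw [hl']
          refine hbound u hu l (hi.trans ?_)
          rw [← hl']
          exact Finset.le_sup' (fun i => inner ℝ u (e i)) (Finset.mem_univ i)) (hle.trans h1) hu
      rw [hmi u i hmax] at h2
      exact hne (hinj (hK.eq_of_profile_eq_supportFn hn hlam hh hhr' he hw hw1 hw0 hmem hu hpos hj
        h2.symm))

end LambdaConvex

/-! ### The main theorem. -/

theorem theoremB (n : ℕ) (hn : 2 ≤ n) (lam : ℝ) (hlam : 0 < lam)
    (K S : Set (LambdaConvex.E n))
    (hK : LambdaConvex.IsLambdaConvexBody lam K)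
    (hS : LambdaConvex.IsSpindle lam S)
    (hR : LambdaConvex.circumradius K = LambdaConvex.circumradius S) :
    LambdaConvex.intrinsicVolume 1 S ≤ LambdaConvex.intrinsicVolume 1 K ∧
      (LambdaConvex.intrinsicVolume 1 K = LambdaConvex.intrinsicVolume 1 S ↔
        LambdaConvex.IsSpindle lam K) := by
  open LambdaConvex in
  obtain ⟨m, e₀, h, he₀, hh, hhr, hSeq⟩ := hS.exists_eq
  have hRh : circumradius K = h := by rw [hR, hSeq, circumradius_spindle he₀ hh hhr]
  have hne := hK.1.2.2.mono interior_subset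
  obtain ⟨o, k, e, w, hinj, he, hw, hw1, hw0, hmem⟩ :=
    exists_contact_weights hK.1.1 hne (by rw [hRh]; exact hh)
  rw [hRh] at hmem
  have hc : ∀ c, (∀ x ∈ K, ‖x - c‖ ≤ 1 / lam) → ‖c - o‖ ^ 2 ≤ (1 / lam) ^ 2 - h ^ 2 :=
    fun c hKc => norm_sub_sq_le_of_contact he hw hw1 hw0 fun i => hKc _ (hmem i)
  have hVK := kappa_mul_intrinsicVolume_one_eq (by omega) hK.1.1 hK.1.2.1 hne o
  have hVS := kappa_mul_intrinsicVolume_one_spindle (lam := lam) (m := m) hn he₀ hh hhr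
  rw [← hSeq] at hVS
  have hκ := kappa_pos (n - 1)
  have hn0 : (0 : ℝ) < n := by exact_mod_cast (by omega : 0 < n)
  refine ⟨?_, fun hV => ?_, fun hKS => intrinsicVolume_one_eq_of_isSpindle hn hKS hS hR⟩
  · refine le_of_mul_le_mul_left ?_ hκ
    rw [hVK, hVS]
    have hcont := continuous_supportFn_sub hK.1.1 o
    obtain ⟨M, hM⟩ := exists_abs_le_of_continuous hcont
    exact mul_le_mul_of_nonneg_left (integral_antipodal_le_integral
      (by rw [finrank_euclideanSpace_fin]; exact hn) he hw hw1 hw0 (continuous_profile hh hhr)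
      (fun s t hs hst => profile_mono hh hhr hs hst) hcont.measurable hM
      (fun u hu i h0 _ => hK.profile_le_supportFn hn hlam hh hhr hc (he i) (hmem i) hu h0) he₀)
      hn0.le
  · rw [hV, hVS] at hVK
    have hle := (mul_left_cancel₀ hn0.ne' hVK).ge
    obtain ⟨i, hi⟩ := hK.exists_antipodal hn hlam hh hhr hinj he hw hw1 hw0 hmem he₀ hle
    -- The integral for the axis `e₀` of `S` is replaced by the one for the axis `e i` of the
    -- antipodal pair; both represent the mean width of a spindle of circumradius `h`.
    have hVi := kappa_mul_intrinsicVolume_one_spindle (lam := lam) (m := m) hn (he i) hh hhr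
    rw [intrinsicVolume_one_eq_of_isSpindle hn (isSpindle_spindle (he i) hh hhr) hS (by
      rw [circumradius_spindle (he i) hh hhr, ← hRh, hR]), hVS] at hVi
    rw [mul_left_cancel₀ hn0.ne' hVi] at hle
    rw [hK.eq_spindle hn hlam hh hhr hc (he i) (hmem i) hi hle]
    exact isSpindle_spindle (he i) hh hhr
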